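/- **Setting.** Let $N\ge 1$, $s,s'\in(0,1)$, $M<\infty$ and $1<p\le q\le p_*:=p\,\frac{2s+N}{N}$. Let $\Omega\subset\mathbb R^N$ be open and bounded, $0<T\le\infty$, $\Omega_T=\Omega\times(0,T)$, and let $a:\mathbb R^N\times\mathbb R^N\to\mathbb R$ be measurable with $0\le a\le M$. Put $$H(x,y,\xi)=\frac{|\xi|^p}{|x-y|^{ps}}+a(x,y)\frac{|\xi|^q}{|x-y|^{qs'}} .$$ $W^{s,p}(\mathbb R^N)$ is the fractional Sobolev space with norm $\|f\|_{L^p}+\big(\iint\frac{|f(x)-f(y)|^p}{|x-y|^{N+ps}}dx\,dy\big)^{1/p}$, and $W^{s,p}_0(\Omega)$ is its subspace of functions vanishing a.e. outside $\Omega$. Let $u_0\in W^{s,p}(\mathbb R^N)$ with $u_0|_\Omega\in L^2(\Omega)$ and $\iint_{\mathbb R^N\times\mathbb R^N} \frac{H(x,y,u_0(x)-u_0(y))}{|x-y|^N}dx\,dy<\infty$. A *variational solution* with data $u_0$ is a function $u\in L^p(0,T;W^{s,p}(\mathbb R^N))\cap C^0([0,T];L^2(\Omega))$ (with $[0,\infty)$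 in place of $[0,T]$ if $T=\infty$) with $u-u_0\in L^p(0,T;W^{s,p}_0(\Omega))$ such that for every $\tau\in(0,T)$ and every $v$ in the same class with weak derivative $\partial_tv\in L^2(\Omega_T)$ $$\int_0^\tau\!\!\int_\Omega \partial_t v\,(v-u)\,dx\,dt+\int_0^\tau\!\!\iint_{\mathbb R^N\times\mathbb R^N}\frac{H(x,y,v(x,t)-v(y,t))-H(x,y,u(x,t)-u(y,t))}{|x-y|^N}\,dx\,dy\,dt\ \ge\ \tfrac12\|(v-u)(\cdot,\tau)\|_{L^2(\Omega)}^2-\tfrac12\|(v-u)(\cdot,0)\|_{L^2(\Omega)}^2,$$ where the two $H$-energies are taken as separate elements of $[0,\infty]$, the energy of $u$ being moved to the right-hand side. For $m>1$, $\alpha>0$ write $L^{m-1}_{\alpha}(\mathbb R^N)$ for the functions $f$ with $\int\frac{|f(x)|^{m-1}}{1+|x|^{N+\alpha}}dx<\infty$, and for $\sigma\in(0,1)$, $\rho>0$ and an interval $I$, $$\mathrm{Tail}_{m,\sigma,\infty}(w;x_0,\rho,I)=\operatorname*{ess\,sup}_{t\in I}\Big(\rho^{\sigma m}\int_{\mathbb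 R^N\setminus B_\rho(x_0)}\frac{|w(x,t)|^{m-1}}{|x-x_0|^{N+\sigma m}}dx\Big)^{\frac1{m-1}} .$$ Finally $Q_{R,\tau}(z_0)=B_R(x_0)\times(t_0-\tau,t_0)$ for $z_0=(x_0,t_0)$. **Lemma 3.1 (Caccioppoli).** There is a constant $C=C(N,p,q,M,s,s')>0$ with the following property. Let $\Omega,T,a,u_0$ be as above and let $u$ be a variational solution with data $u_0$ such that $\partial_tu\in L^2(\Omega_T)$ and $u\in L^\infty(0,T;L^{p-1}_{sp}(\mathbb R^N))\cap L^\infty(0,T;L^{q-1}_{qs'}(\mathbb R^N))$. Let $\overline{B_R(x_0)}\subset\Omega$, $[t_0-\theta,t_0]\subset(0,T)$, $k\in\mathbb R$, $0<r<R$ and $t_0-\theta<t_0-\tau_2<t_0-\tau_1\le t_0-\frac\theta2$. Let $\psi\in C^1(t_0-\theta,t_0)$ with $0\le\psi\le1$, $\psi=0$ on $(t_0-\theta,t_0-\tau_2)$ and $\psi=1$ on $(t_0-\tau_1,t_0)$. Put $w_+=(u-k)_+$ and $I=(t_0-\theta,t_0)$. Then, as an inequality in $[0,\infty]$, $$\begin{aligned}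 &\sup_{t_0-\tau_1<t<t_0}\int_{B_r(x_0)}w_+(x,t)^2dx+\int_{t_0-\tau_1}^{t_0}\int_{B_r(x_0)}\int_{B_r(x_0)}\frac{H(x,y,w_+(x,t)-w_+(y,t))}{|x-y|^N}\,dx\,dy\,dt\\ &\quad\le C\frac{R^{p(1-s)}}{(R-r)^p}\|w_+\|^p_{L^p(Q_{R,\tau_2}(z_0))}+C\frac{R^{q(1-s')}}{(R-r)^q}\|w_+\|^q_{L^q(Q_{R,\tau_2}(z_0))}\\ &\qquad+C\Big(\frac Rr\Big)^{sp}\frac{R^N}{(R-r)^{N+sp}}\|w_+\|_{L^1(Q_{R,\tau_2}(z_0))}\,\mathrm{Tail}_{p,s,\infty}(w_+;x_0,r,I)^{p-1}\\ &\qquad+C\Big(\frac Rr\Big)^{s'q}\frac{R^N}{(R-r)^{N+s'q}}\|w_+\|_{L^1(Q_{R,\tau_2}(z_0))}\,\mathrm{Tail}_{q,s',\infty}(w_+;x_0,r,I)^{q-1}\\ &\qquad+C\int_{t_0-\tau_2}^{t_0}\int_{B_R(x_0)}w_+(x,t)^2\,|\partial_t\psi(t)|\,dx\,dt . \end{aligned}$$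 -/

import Mathlib

open MeasureTheory Set Filter Topology
open scoped ENNReal

noncomputable section

namespace NonlocalDoublePhase

/-- The Euclidean space `ℝ^N`. -/
abbrev Sp (N : ℕ) : Type := EuclideanSpace ℝ (Fin N)

/-- The open time interval `(0,T)`, where `0 < T ≤ ∞`. -/
def timeInterval (T : ℝ≥0∞) : Set ℝ := {t | 0 < t ∧ ENNReal.ofReal t < T}

/-- The closed time interval `[0,T]`, which is `[0,∞)` for `T = ∞`. -/
def closedTimeInterval (T : ℝ≥0∞) : Set ℝ := {t | 0 ≤ t ∧ ENNReal.ofReal t ≤ T}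

/-- The double phase integrand `H(x,y,ξ) = |ξ|^p / |x-y|^{ps} + a(x,y) |ξ|^q / |x-y|^{qs'}`. -/
def H {N : ℕ} (s s' p q : ℝ) (a : Sp N → Sp N → ℝ) (x y : Sp N) (ξ : ℝ) : ℝ :=
  |ξ| ^ p / ‖x - y‖ ^ (p * s) + a x y * (|ξ| ^ q / ‖x - y‖ ^ (q * s'))

/-- The nonlocal double phase energy of `f` over `A × A`:
`∬_{A×A} H(x,y,f(x)-f(y)) / |x-y|^N dx dy`, a number in `[0,∞]`. -/
def energy {N : ℕ} (s s' p q : ℝ) (a : Sp N → Sp N → ℝ) (A : Set (Sp N)) (f : Sp N → ℝ) :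
    ℝ≥0∞ :=
  ∫⁻ x in A, ∫⁻ y in A, ENNReal.ofReal (H s s' p q a x y (f x - f y) / ‖x - y‖ ^ N)

/-- The `p`-th power of the Gagliardo seminorm of `W^{s,p}(ℝ^N)`. -/
def gagliardo {N : ℕ} (s p : ℝ) (f : Sp N → ℝ) : ℝ≥0∞ :=
  ∫⁻ x, ∫⁻ y, ENNReal.ofReal (|f x - f y| ^ p / ‖x - y‖ ^ ((N : ℝ) + p * s))

/-- The norm of `W^{s,p}(ℝ^N)`, with values in `[0,∞]`. -/
def sobolevNorm {N : ℕ} (s p : ℝ) (f : Sp N → ℝ) : ℝ≥0∞ :=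
  eLpNorm f (ENNReal.ofReal p) volume + gagliardo s p f ^ (1 / p)

/-- `f ∈ W^{s,p}(ℝ^N)`. -/
def MemSobolev {N : ℕ} (s p : ℝ) (f : Sp N → ℝ) : Prop :=
  AEStronglyMeasurable f volume ∧ sobolevNorm s p f < ⊤

/-- `v ∈ L^p(0,T;W^{s,p}(ℝ^N))`. -/
structure MemLpSobolev {N : ℕ} (s p : ℝ) (T : ℝ≥0∞) (v : Sp N → ℝ → ℝ) : Prop where
  aemeasurable : AEMeasurable (fun z : Sp N × ℝ => v z.1 z.2)
    (volume.restrict (univ ×ˢ timeInterval T))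
  mem_ae : ∀ᵐ t ∂(volume.restrict (timeInterval T)), MemSobolev s p (fun x => v x t)
  lintegral_lt_top : ∫⁻ t in timeInterval T, sobolevNorm s p (fun x => v x t) ^ p < ⊤

/-- `v ∈ C⁰([0,T];L²(Ω))`; the values `v(·,t)` are those of the continuous representative. -/
structure MemContL2 {N : ℕ} (Ω : Set (Sp N)) (T : ℝ≥0∞) (v : Sp N → ℝ → ℝ) : Prop where
  memLp : ∀ t ∈ closedTimeInterval T, MemLp (fun x => v x t) 2 (volume.restrict Ω)
  tendsto : ∀ t ∈ closedTimeInterval T,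
    Tendsto (fun τ => eLpNorm (fun x => v x τ - v x t) 2 (volume.restrict Ω))
      (𝓝[closedTimeInterval T] t) (𝓝 0)

/-- `g` is the weak time derivative `∂ₜv` on `Ω_T = Ω × (0,T)`, and `g ∈ L²(Ω_T)`. -/
structure IsWeakTimeDerivL2 {N : ℕ} (Ω : Set (Sp N)) (T : ℝ≥0∞) (v g : Sp N → ℝ → ℝ) :
    Prop where
  memLp : MemLp (fun z : Sp N × ℝ => g z.1 z.2) 2 (volume.restrict (Ω ×ˢ timeInterval T))
  integral_eq : ∀ φ : Sp N × ℝ → ℝ, ContDiff ℝ ((⊤ : ℕ∞) : WithTop ℕ∞) φ → HasCompactSupport φ →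
    tsupport φ ⊆ Ω ×ˢ timeInterval T →
    ∫ z in Ω ×ˢ timeInterval T, v z.1 z.2 * deriv (fun t => φ (z.1, t)) z.2
      = -∫ z in Ω ×ˢ timeInterval T, g z.1 z.2 * φ z

/-- The class `v ∈ L^p(0,T;W^{s,p}(ℝ^N)) ∩ C⁰([0,T];L²(Ω))` with
`v - u₀ ∈ L^p(0,T;W₀^{s,p}(Ω))`, where `W₀^{s,p}(Ω)` consists of the functions of
`W^{s,p}(ℝ^N)` that vanish outside `Ω`. -/
structure InClass {N : ℕ} (s p : ℝ) (Ω : Set (Sp N)) (T : ℝ≥0∞) (u₀ : Sp N → ℝ)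
    (v : Sp N → ℝ → ℝ) : Prop where
  memLpSobolev : MemLpSobolev s p T v
  memContL2 : MemContL2 Ω T v
  sub_memLpSobolev : MemLpSobolev s p T (fun x t => v x t - u₀ x)
  eq_outside : ∀ᵐ t ∂(volume.restrict (timeInterval T)), ∀ᵐ x ∂(volume : Measure (Sp N)),
    x ∉ Ω → v x t - u₀ x = 0

/-- Admissible time-independent data: `u₀ ∈ W^{s,p}(ℝ^N)`, `u₀ ∈ L²(Ω)` and
`∬ H(x,y,u₀(x)-u₀(y)) / |x-y|^N dx dy < ∞`. -/
structure IsData {N : ℕ} (s s' p q : ℝ) (a : Sp N → Sp N → ℝ) (Ω : Set (Sp N))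
    (u₀ : Sp N → ℝ) : Prop where
  memSobolev : MemSobolev s p u₀
  memLp : MemLp u₀ 2 (volume.restrict Ω)
  energy_lt_top : energy s s' p q a univ u₀ < ⊤

/-- Variational solutions. For all comparison maps `v` with `∂ₜv ∈ L²(Ω_T)` and all `τ ∈ (0,T)`,
`∫₀^τ∫_Ω ∂ₜv (v-u) + ∫₀^τ∬ (H(v)-H(u)) / |x-y|^N ≥ ½‖(v-u)(τ)‖² - ½‖(v-u)(0)‖²`.
The energy of `u` is moved to the other side, so that both energies are numbers in `[0,∞]` and
the inequality holds trivially when the energy of `v` is infinite. -/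
structure IsVariationalSolution {N : ℕ} (s s' p q : ℝ) (a : Sp N → Sp N → ℝ)
    (Ω : Set (Sp N)) (T : ℝ≥0∞) (u₀ : Sp N → ℝ) (u : Sp N → ℝ → ℝ) : Prop where
  inClass : InClass s p Ω T u₀ u
  variational : ∀ v g : Sp N → ℝ → ℝ, InClass s p Ω T u₀ v → IsWeakTimeDerivL2 Ω T v g →
    ∀ τ ∈ timeInterval T,
      ((∫⁻ t in Ioo 0 τ, energy s s' p q a univ (fun x => u x t) : ℝ≥0∞) : EReal) ≤
        ((∫⁻ t in Ioo 0 τ, energy s s' p q a univ (fun x => v x t) : ℝ≥0∞) : EReal) +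
        (((∫ z in Ω ×ˢ Ioo 0 τ, g z.1 z.2 * (v z.1 z.2 - u z.1 z.2)) +
          1 / 2 * (∫ x in Ω, (v x 0 - u x 0) ^ 2) -
          1 / 2 * (∫ x in Ω, (v x τ - u x τ) ^ 2) : ℝ) : EReal)

/-- `v ∈ L^∞(0,T;L^m_α(ℝ^N))` for the tail space `L^m_α(ℝ^N)`, the space of the `f` with
`∫ |f(x)|^m / (1+|x|^{N+α}) dx < ∞` (such an `f` is in `L^m_loc`). -/
def MemLinftyTailSpace {N : ℕ} (m α : ℝ) (T : ℝ≥0∞) (v : Sp N → ℝ → ℝ) : Prop :=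
  AEMeasurable (fun z : Sp N × ℝ => v z.1 z.2) (volume.restrict (univ ×ˢ timeInterval T)) ∧
  essSup (fun t => ∫⁻ x, ENNReal.ofReal (|v x t| ^ m / (1 + ‖x‖ ^ ((N : ℝ) + α))))
    (volume.restrict (timeInterval T)) < ⊤

/-- `Tail_{m,s,∞}(v;x₀,R,I)`, the essential supremum over `t ∈ I` of
`(R^{sm} ∫_{ℝ^N ∖ B_R(x₀)} |v(x,t)|^{m-1} / |x-x₀|^{N+sm} dx)^{1/(m-1)}`. -/
def tail {N : ℕ} (m s : ℝ) (v : Sp N → ℝ → ℝ) (x₀ : Sp N) (R : ℝ) (I : Set ℝ) : ℝ≥0∞ :=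
  essSup (fun t => (ENNReal.ofReal (R ^ (s * m)) *
      ∫⁻ x in (Metric.ball x₀ R)ᶜ,
        ENNReal.ofReal (|v x t| ^ (m - 1) / ‖x - x₀‖ ^ ((N : ℝ) + s * m))) ^ (1 / (m - 1)))
    (volume.restrict I)

/-- The truncation `w₊ = (u - k)₊`. -/
def truncation {N : ℕ} (u : Sp N → ℝ → ℝ) (k : ℝ) : Sp N → ℝ → ℝ :=
  fun x t => max (u x t - k) 0

/-- `‖w‖_{L^m(Q_{R,τ}(z₀))}` with `Q_{R,τ}(z₀) = B_R(x₀) × (t₀-τ,t₀)`. -/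
def cylinderNorm {N : ℕ} (m : ℝ) (w : Sp N → ℝ → ℝ) (x₀ : Sp N) (t₀ R τ : ℝ) : ℝ≥0∞ :=
  eLpNorm (fun z : Sp N × ℝ => w z.1 z.2) (ENNReal.ofReal m)
    (volume.restrict (Metric.ball x₀ R ×ˢ Ioo (t₀ - τ) t₀))

end NonlocalDoublePhase

end

open NonlocalDoublePhase

/-!
The Caccioppoli estimate comes from testing the variational inequality with
`v = u - ψ(t) η(x)^q (u - k)₊` (`testMap`), where `η` is a Lipschitz cutoff between `B_r` and
`B_{(R+r)/2}` and `ψ` is a time cutoff, and comparing the energies of `u` and `v` at each time.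

*Energy at a fixed time.* For two points of `B_R` let `X = u(x) - k`, `Y = u(y) - k`, and let `α ≥ β`
be the values of `η`. If `X, Y ≥ 0`, then `v(x) - v(y)` is the convex combination with weight `ψ α^q`
of `X - Y` and a multiple of `Y` of size `1 - β^q/α^q ≤ q (α-β)/α`. Convexity of `|·|^m` with `m ≤ q`
then gives a gain `ψ min(α,β)^q |X₊-Y₊|^m` at the cost of `q^m |α-β|^m (X₊^m + Y₊^m)`, for all signs of
`X` and `Y` (`abs_sub_cutoff_rpow_near`). If `y ∉ B_R`, the cost is at most `m X₊ Y₊^{m-1}`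
(`abs_sub_cutoff_rpow_far`), which integrates to the tail. Integrating against the kernel yields
`energy(v) + ψ energy_{B_r}((u-k)₊) ≤ energy(u) + error`, for each phase separately and so for the
double phase (`exists_phaseEnergy_sub_cutoff_le`, `exists_energy_sub_cutoff_le`).

*Parabolic part.* By the lemma of du Bois-Reymond, for almost every `x ∈ Ω` the function `u(x,·)` is
the primitive of `∂ₜu(x,·)`. The chain rule for absolutely continuous functions then gives the weak
time derivative of `v` and, with `w = (u-k)₊`,
`∫∫ ∂ₜv (v-u) = ½ ∫ (v-u)²(τ) - ½ ∫ ψ(τ) η^q w²(τ) + ½ ∫∫ η^q ψ' w²` (`integral_testDeriv_mul`). The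
first term cancels against the right-hand side of the variational inequality.

*Conclusion.* The inequality for `v` and the energy estimate are added and the energy of `u` is
cancelled (`IsVariationalSolution.lintegral_cutoff_energy_add_le`). The cancellation is legitimate,
since testing with the time-independent map `u₀` shows that the energy of `u` up to any `τ < T` is
finite (`IsVariationalSolution.lintegral_energy_lt_top`). Finiteness of the error is not needed.
-/

namespace NonlocalDoublePhase

/-! ### Pointwise inequalities for the truncated test map -/

lemma abs_convex_comb_rpow_le {m ζ A y : ℝ} (hm : 1 ≤ m) (h0 : 0 ≤ ζ) (h1 : ζ ≤ 1) :
    |(1 - ζ) * A + ζ * y| ^ m ≤ (1 - ζ) * |A| ^ m + ζ * |y| ^ m := by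
  have h : |(1 - ζ) * A + ζ * y| ≤ (1 - ζ) * |A| + ζ * |y| := by
    refine (abs_add_le _ _).trans ?_
    rw [abs_mul, abs_mul, abs_of_nonneg h0, abs_of_nonneg (sub_nonneg.2 h1)]
  refine (Real.rpow_le_rpow (abs_nonneg _) h (by linarith)).trans ?_
  have := (convexOn_rpow hm).2 (mem_Ici.2 (abs_nonneg A)) (mem_Ici.2 (abs_nonneg y))
    (sub_nonneg.2 h1) h0 (by ring)
  simpa [smul_eq_mul] using this

/-- Bernoulli's inequality for the difference of two cutoff powers, divided by the larger one. -/
lemma one_sub_div_rpow_le {q α β : ℝ} (hq : 1 ≤ q) (hβ : 0 ≤ β) (hα : 0 < α) :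
    1 - β ^ q / α ^ q ≤ q * ((α - β) / α) := by
  have h := one_add_mul_self_le_rpow_one_add (s := β / α - 1) (by
    have : 0 ≤ β / α := by positivity
    linarith) hq
  rw [← Real.div_rpow hβ hα.le]
  have e : (α - β) / α = 1 - β / α := by field_simp
  rw [e]
  have e2 : 1 + (β / α - 1) = β / α := by ring
  rw [e2] at h
  linarith

/-- If both points lie in the superlevel set, the test map contracts the difference up to an error
in which only the oscillation of the cutoff occurs. -/
lemma abs_sub_cutoff_rpow_le_of_le {m q ψ α β X Y : ℝ} (hm : 1 ≤ m) (hmq : m ≤ q)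
    (hψ0 : 0 ≤ ψ) (hψ1 : ψ ≤ 1) (hα1 : α ≤ 1) (hβ : 0 ≤ β) (hβα : β ≤ α) (hY : 0 ≤ Y) :
    |X - Y - (ψ * α ^ q * X - ψ * β ^ q * Y)| ^ m + ψ * α ^ q * |X - Y| ^ m ≤
      |X - Y| ^ m + q ^ m * |α - β| ^ m * Y ^ m := by
  have hq : 1 ≤ q := hm.trans hmq
  have hq0 : 0 < q := by linarith
  rcases (hβ.trans hβα).eq_or_lt with h | hα
  · have hβ' : β = 0 := le_antisymm (h ▸ hβα) hβ
    subst hβ'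
    rw [← h, Real.zero_rpow hq0.ne']
    have : (0 : ℝ) ≤ q ^ m * |0 - 0| ^ m * Y ^ m := by positivity
    simp only [mul_zero, zero_mul, sub_zero, add_zero] at this ⊢
    linarith
  have hαq : 0 < α ^ q := Real.rpow_pos_of_pos hα _
  have hαq1 : α ^ q ≤ 1 := Real.rpow_le_one hα.le hα1 hq0.le
  have hζ0 : 0 ≤ ψ * α ^ q := by positivity
  have hζ1 : ψ * α ^ q ≤ 1 := mul_le_one₀ hψ1 hαq.le hαq1
  have hr : β ^ q ≤ α ^ q := Real.rpow_le_rpow hβ hβα hq0.le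
  have hd0 : 0 ≤ 1 - β ^ q / α ^ q := by
    rw [sub_nonneg, div_le_one hαq]; exact hr
  -- a convex combination with weight `ψ α^q`; the second point is small, by Bernoulli
  have e : X - Y - (ψ * α ^ q * X - ψ * β ^ q * Y) =
      (1 - ψ * α ^ q) * (X - Y) + ψ * α ^ q * (-((1 - β ^ q / α ^ q) * Y)) := by
    field_simp; ring
  have h1 := abs_convex_comb_rpow_le (A := X - Y) (y := -((1 - β ^ q / α ^ q) * Y)) hm hζ0 hζ1
  rw [← e, abs_neg, abs_of_nonneg (mul_nonneg hd0 hY), Real.mul_rpow hd0 hY] at h1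
  have h2 : ψ * α ^ q * (1 - β ^ q / α ^ q) ^ m ≤ q ^ m * |α - β| ^ m := by
    have h3 : (1 - β ^ q / α ^ q) ^ m ≤ (q * ((α - β) / α)) ^ m :=
      Real.rpow_le_rpow hd0 (one_sub_div_rpow_le hq hβ hα) (by linarith)
    have hs : 0 ≤ α - β := sub_nonneg.2 hβα
    rw [Real.mul_rpow hq0.le (by positivity), Real.div_rpow hs hα.le] at h3
    -- the weight `α^q` compensates the denominator `α^m`, as `m ≤ q`
    have h4 : α ^ q ≤ α ^ m := Real.rpow_le_rpow_of_exponent_ge hα hα1 hmq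
    have hαm : 0 < α ^ m := Real.rpow_pos_of_pos hα _
    have h5 : ψ * α ^ q ≤ α ^ m := (mul_le_of_le_one_left hαq.le hψ1).trans h4
    calc ψ * α ^ q * (1 - β ^ q / α ^ q) ^ m
        ≤ α ^ m * (q ^ m * ((α - β) ^ m / α ^ m)) := by gcongr
      _ = q ^ m * |α - β| ^ m := by rw [abs_of_nonneg hs]; field_simp
  have h3 := mul_le_mul_of_nonneg_right h2 (Real.rpow_nonneg hY m)
  nlinarith [h1, h3]

/-- If only one point lies in the superlevel set, the test map decreases the difference. -/
lemma abs_sub_cutoff_rpow_le_of_nonpos {m ζ X Y : ℝ} (hm : 1 ≤ m) (hζ0 : 0 ≤ ζ) (hζ1 : ζ ≤ 1)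
    (hX : 0 ≤ X) (hY : Y ≤ 0) :
    |X - Y - ζ * X| ^ m + ζ * X ^ m ≤ |X - Y| ^ m := by
  have e : X - Y - ζ * X = (1 - ζ) * (X - Y) + ζ * (-Y) := by ring
  have h1 := abs_convex_comb_rpow_le (A := X - Y) (y := -Y) hm hζ0 hζ1
  rw [← e] at h1
  have h2 := Real.add_rpow_le_rpow_add hX (neg_nonneg.2 hY) hm
  rw [← sub_eq_add_neg] at h2
  rw [abs_of_nonneg (neg_nonneg.2 hY), abs_of_nonneg (by linarith : 0 ≤ X - Y)] at h1
  rw [abs_of_nonneg (by linarith : 0 ≤ X - Y)]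
  nlinarith [mul_le_mul_of_nonneg_left h2 hζ0]

/-- The algebraic core of the Caccioppoli estimate for two nearby points: subtracting the test map
`ψ η^q (·)₊` lowers the `m`-th power of the difference by that of the truncation, up to an error
containing only the oscillation of the cutoff `η`. -/
lemma abs_sub_cutoff_rpow_near {m q ψ α β X Y : ℝ} (hm : 1 ≤ m) (hmq : m ≤ q)
    (hψ0 : 0 ≤ ψ) (hψ1 : ψ ≤ 1) (hα : 0 ≤ α) (hα1 : α ≤ 1) (hβ : 0 ≤ β) (hβ1 : β ≤ 1) :
    |X - Y - (ψ * α ^ q * max X 0 - ψ * β ^ q * max Y 0)| ^ m +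
        ψ * min α β ^ q * |max X 0 - max Y 0| ^ m ≤
      |X - Y| ^ m + q ^ m * |α - β| ^ m * (max X 0 ^ m + max Y 0 ^ m) := by
  have hq0 : 0 < q := by linarith
  wlog hβα : β ≤ α generalizing α β X Y
  · have h := this (X := Y) (Y := X) hβ hβ1 hα hα1 (le_of_not_ge hβα)
    rw [min_comm, abs_sub_comm (max Y 0), abs_sub_comm Y X, abs_sub_comm β α,
      add_comm (max Y 0 ^ m)] at h
    convert h using 3
    rw [← abs_neg]; congr 1; ring
  rw [min_eq_right hβα]
  have hb : β ^ q ≤ α ^ q := Real.rpow_le_rpow hβ hβα hq0.le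
  have hβq : 0 ≤ β ^ q := Real.rpow_nonneg hβ _
  have hζ1 : ψ * α ^ q ≤ 1 :=
    mul_le_one₀ hψ1 (Real.rpow_nonneg hα _) (Real.rpow_le_one hα hα1 hq0.le)
  have hE : 0 ≤ q ^ m * |α - β| ^ m * (max X 0 ^ m + max Y 0 ^ m) := by positivity
  have hζξ : ψ * β ^ q ≤ ψ * α ^ q := by gcongr
  have hξ0 : 0 ≤ ψ * β ^ q := by positivity
  rcases le_total X 0 with hX | hX <;> rcases le_total Y 0 with hY | hY
  · rw [max_eq_right hX, max_eq_right hY] at *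
    simp only [mul_zero, sub_zero, abs_zero] at *
    rw [Real.zero_rpow (by linarith)] at *
    linarith
  · have h := abs_sub_cutoff_rpow_le_of_nonpos hm hξ0 (hζξ.trans hζ1) hY hX
    rw [max_eq_right hX, max_eq_left hY] at *
    rw [mul_zero, zero_sub, zero_sub, abs_neg, abs_of_nonneg hY, ← abs_neg, abs_sub_comm X Y]
    rw [show -(X - Y - -(ψ * β ^ q * Y)) = Y - X - ψ * β ^ q * Y by ring]
    linarith
  · have h := abs_sub_cutoff_rpow_le_of_nonpos hm (hξ0.trans hζξ) hζ1 hX hY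
    rw [max_eq_left hX, max_eq_right hY] at *
    rw [mul_zero, sub_zero, sub_zero, abs_of_nonneg hX]
    have := mul_le_mul_of_nonneg_right hζξ (Real.rpow_nonneg hX m)
    linarith
  · have h := abs_sub_cutoff_rpow_le_of_le (X := X) hm hmq hψ0 hψ1 hα1 hβ hβα hY
    rw [max_eq_left hX, max_eq_left hY] at *
    have h1 := mul_le_mul_of_nonneg_right hζξ (Real.rpow_nonneg (abs_nonneg (X - Y)) m)
    have h2 : 0 ≤ q ^ m * |α - β| ^ m * X ^ m := by positivity
    linarith

/-- The interaction of a point carrying the test map with a point outside its support costs only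
the power `m - 1` of the truncation at the outer point, as needed for the tail. -/
lemma abs_sub_cutoff_rpow_far {m ζ X Y : ℝ} (hm : 1 < m) (hζ0 : 0 ≤ ζ) (hζ1 : ζ ≤ 1) :
    |X - Y - ζ * max X 0| ^ m ≤ |X - Y| ^ m + m * (max X 0 * max Y 0 ^ (m - 1)) := by
  have hE : 0 ≤ m * (max X 0 * max Y 0 ^ (m - 1)) := by positivity
  have hm0 : 0 < m := by linarith
  rcases le_total X 0 with hX | hX
  · rw [max_eq_right hX] at *
    simp
  rw [max_eq_left hX] at *
  have hζX : ζ * X ≤ X := mul_le_of_le_one_left hX hζ1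
  have hζX0 : 0 ≤ ζ * X := by positivity
  -- the difference can grow only if the test map makes `X` drop below `Y`
  rcases le_total Y ((1 - ζ) * X) with h | h
  · have : |X - Y - ζ * X| ≤ |X - Y| := by
      rw [abs_of_nonneg (by linarith), abs_of_nonneg (by linarith)]; linarith
    have := Real.rpow_le_rpow (abs_nonneg _) this hm0.le
    linarith
  have hY : 0 ≤ Y := by linarith
  rw [max_eq_left hY] at *
  have ea : |X - Y - ζ * X| = Y - (1 - ζ) * X := by
    rw [abs_of_nonpos (by linarith)]; ring
  rw [ea]
  set a := Y - (1 - ζ) * X with ha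
  have ha0 : 0 ≤ a := by linarith
  have haY : a ≤ Y := by linarith
  have hpow : a ^ (m - 1) ≤ Y ^ (m - 1) := Real.rpow_le_rpow ha0 haY (by linarith)
  rcases ha0.eq_or_lt with h0 | hapos
  · rw [← h0, Real.zero_rpow hm0.ne']
    positivity
  have eam : a ^ m = a * a ^ (m - 1) := by
    rw [← Real.rpow_one_add' ha0 (by linarith)]; congr 1; ring
  have hYm : 0 ≤ Y ^ (m - 1) := Real.rpow_nonneg hY _
  have ham : 0 ≤ a ^ (m - 1) := Real.rpow_nonneg ha0 _
  rcases le_total Y X with hYX | hXY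
  · have h1 : a * a ^ (m - 1) ≤ X * Y ^ (m - 1) := by gcongr; linarith
    have h2 : 0 ≤ |X - Y| ^ m := by positivity
    have h3 : 0 ≤ (m - 1) * (X * Y ^ (m - 1)) := by
      have : 0 ≤ m - 1 := by linarith
      positivity
    rw [eam]; linarith
  -- for `X ≤ Y` the growth from `Y - X` to `a` is estimated by Bernoulli's inequality
  · have hb : |X - Y| = Y - X := by rw [abs_of_nonpos (by linarith)]; ring
    rw [hb]
    have hB := one_add_mul_self_le_rpow_one_add (s := (Y - X) / a - 1) (by
      have : 0 ≤ (Y - X) / a := div_nonneg (by linarith) ha0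
      linarith) hm.le
    rw [show 1 + ((Y - X) / a - 1) = (Y - X) / a by ring,
      Real.div_rpow (by linarith) ha0, le_div_iff₀ (by positivity)] at hB
    have e1 : (1 + m * ((Y - X) / a - 1)) * a ^ m = a ^ m - m * (a - (Y - X)) * a ^ (m - 1) := by
      rw [eam]; field_simp; ring
    rw [e1] at hB
    have h1 : m * (a - (Y - X)) * a ^ (m - 1) ≤ m * X * Y ^ (m - 1) := by
      have : a - (Y - X) ≤ X := by rw [ha]; linarith
      have h0 : 0 ≤ a - (Y - X) := by rw [ha]; linarith
      gcongr
    linarith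

/-! ### The singular kernel -/

/-- The kernel `|x-y|^{-(N+mσ)}`, in the factored form in which it occurs in the energy. For
`N > 0` it vanishes on the diagonal, by the convention `0⁻¹ = 0`. -/
noncomputable def kernel {N : ℕ} (σ m : ℝ) (x y : Sp N) : ℝ := (‖x - y‖ ^ (m * σ) * ‖x - y‖ ^ N)⁻¹

lemma kernel_nonneg {N : ℕ} (σ m : ℝ) (x y : Sp N) : 0 ≤ kernel σ m x y := by
  unfold kernel; positivity

lemma kernel_comm {N : ℕ} (σ m : ℝ) (x y : Sp N) : kernel σ m x y = kernel σ m y x := by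
  unfold kernel; rw [norm_sub_rev]

@[fun_prop]
lemma measurable_kernel {N : ℕ} (σ m : ℝ) :
    Measurable fun z : Sp N × Sp N => kernel σ m z.1 z.2 := by
  unfold kernel; fun_prop

lemma measurable_kernel_right {N : ℕ} (σ m : ℝ) (x : Sp N) : Measurable (kernel σ m x) := by
  unfold kernel; fun_prop

/-- A power of the distance is integrable on balls as soon as its exponent exceeds `-N`, with the
scaling of the integral in the radius. -/
lemma exists_lintegral_norm_rpow_ball_le (N : ℕ) (hN : 0 < N) {γ : ℝ} (hγ : 0 < γ) :
    ∃ c : ℝ, 0 < c ∧ ∀ ρ : ℝ, 0 < ρ →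
      ∫⁻ z in Metric.ball (0 : Sp N) ρ, ENNReal.ofReal (‖z‖ ^ (γ - N)) ≤
        ENNReal.ofReal (c * ρ ^ γ) := by
  have : Nonempty (Fin N) := ⟨⟨0, hN⟩⟩
  have : Nontrivial (Sp N) := inferInstance
  have hdim : Module.finrank ℝ (Sp N) = N := by simp
  set ω := (volume : Measure (Sp N)).real (Metric.ball 0 1) with hω
  have hω0 : 0 < ω := ENNReal.toReal_pos (Metric.measure_ball_pos _ _ one_pos).ne' measure_ball_lt_top.ne
  refine ⟨N * ω / γ, by positivity, fun ρ hρ => ?_⟩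
  have hint1 : IntegrableOn (fun y : ℝ => y ^ (γ - 1)) (Ioo 0 ρ) := by
    have := intervalIntegral.intervalIntegrable_rpow' (a := 0) (b := ρ) (r := γ - 1) (by linarith)
    rw [intervalIntegrable_iff_integrableOn_Ioo_of_le hρ.le] at this
    exact this
  have hcongr : ∀ y ∈ Ioo (0 : ℝ) ρ, y ^ (γ - 1) = y ^ (N - 1) • y ^ (γ - N) := by
    intro y hy
    rw [smul_eq_mul, ← Real.rpow_natCast, ← Real.rpow_add hy.1]
    congr 1
    rw [Nat.cast_sub (by omega)]
    push_cast; ring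
  have hint : IntegrableOn (fun z : Sp N => ‖z‖ ^ (γ - N)) (Metric.ball 0 ρ) := by
    rw [integrableOn_fun_norm_addHaar (μ := (volume : Measure (Sp N)))
      (f := fun y : ℝ => y ^ (γ - N)), hdim]
    exact hint1.congr_fun hcongr measurableSet_Ioo
  rw [← ofReal_integral_eq_lintegral_ofReal hint (ae_of_all _ fun z => by positivity)]
  apply ENNReal.ofReal_le_ofReal
  have e1 : ∫ z in Metric.ball (0 : Sp N) ρ, ‖z‖ ^ (γ - N) =
      ∫ z : Sp N, (Iio ρ).indicator (fun y : ℝ => y ^ (γ - N)) ‖z‖ := by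
    rw [← integral_indicator measurableSet_ball]
    congr 1; ext z
    simp only [indicator, Metric.mem_ball, dist_zero_right, mem_Iio]
  rw [e1, integral_fun_norm_addHaar volume, hdim, ← hω]
  have e2 : ∫ y in Ioi (0 : ℝ), y ^ (N - 1) • (Iio ρ).indicator (fun y : ℝ => y ^ (γ - N)) y =
      ρ ^ γ / γ := by
    have : ∀ y : ℝ, y ^ (N - 1) • (Iio ρ).indicator (fun y : ℝ => y ^ (γ - N)) y =
        (Iio ρ).indicator (fun y : ℝ => y ^ (N - 1) • y ^ (γ - N)) y := by
      intro y; by_cases h : y ∈ Iio ρ <;> simp [h]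
    simp_rw [this]
    rw [setIntegral_indicator measurableSet_Iio, Ioi_inter_Iio,
      ← setIntegral_congr_fun measurableSet_Ioo hcongr, ← integral_Ioc_eq_integral_Ioo,
      ← intervalIntegral.integral_of_le hρ.le, integral_rpow (Or.inl (by linarith))]
    rw [sub_add_cancel, Real.zero_rpow hγ.ne', sub_zero]
  rw [e2]
  simp only [nsmul_eq_mul, smul_eq_mul]
  apply le_of_eq; ring

lemma norm_rpow_mul_kernel_le {N : ℕ} {σ m : ℝ} (hm : 0 < m) (x y : Sp N) :
    ‖x - y‖ ^ m * kernel σ m x y ≤ ‖x - y‖ ^ (m * (1 - σ) - N) := by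
  unfold kernel
  rcases (norm_nonneg (x - y)).eq_or_lt with h | h
  · rw [← h, Real.zero_rpow hm.ne', zero_mul]; positivity
  · rw [← Real.rpow_natCast, ← Real.rpow_add h, ← Real.rpow_neg h.le, ← Real.rpow_add h]
    apply le_of_eq; congr 1; ring

/-- The kernel integral governing the interaction of points at distance less than `2R`. -/
lemma exists_lintegral_norm_rpow_mul_kernel_le (N : ℕ) (hN : 0 < N) {σ m : ℝ} (hσ : σ < 1)
    (hm : 0 < m) :
    ∃ c : ℝ, 0 < c ∧ ∀ (x₀ x : Sp N) (R : ℝ), 0 < R → x ∈ Metric.ball x₀ R →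
      ∫⁻ y in Metric.ball x₀ R, ENNReal.ofReal (‖x - y‖ ^ m * kernel σ m x y) ≤
        ENNReal.ofReal (c * R ^ (m * (1 - σ))) := by
  have hγ : 0 < m * (1 - σ) := mul_pos hm (by linarith)
  obtain ⟨c, hc, H⟩ := exists_lintegral_norm_rpow_ball_le N hN hγ
  refine ⟨c * 2 ^ (m * (1 - σ)), by positivity, fun x₀ x R hR hx => ?_⟩
  calc ∫⁻ y in Metric.ball x₀ R, ENNReal.ofReal (‖x - y‖ ^ m * kernel σ m x y)
      ≤ ∫⁻ y in Metric.ball x (2 * R), ENNReal.ofReal (‖x - y‖ ^ (m * (1 - σ) - N)) := by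
        refine (lintegral_mono fun y => ENNReal.ofReal_le_ofReal
          (norm_rpow_mul_kernel_le hm x y)).trans (lintegral_mono_set ?_)
        apply Metric.ball_subset_ball'
        rw [dist_comm]
        have := Metric.mem_ball.1 hx
        linarith
    _ = ∫⁻ z in Metric.ball (0 : Sp N) (2 * R), ENNReal.ofReal (‖z‖ ^ (m * (1 - σ) - N)) := by
        rw [← lintegral_indicator measurableSet_ball, ← lintegral_indicator measurableSet_ball,
          ← lintegral_sub_left_eq_self _ x]
        congr 1; ext y
        simp only [indicator, Metric.mem_ball, dist_eq_norm]
        rw [norm_sub_rev]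
        simp
    _ ≤ _ := by
        refine (H (2 * R) (by positivity)).trans (le_of_eq ?_)
        rw [Real.mul_rpow (by norm_num) hR.le, mul_assoc]

/-- Away from the ball, the kernel is comparable to its value at the centre. -/
lemma kernel_le_of_far {N : ℕ} {σ m r R : ℝ} (hσm : 0 < m * σ) {x₀ x y : Sp N} (hr : 0 < r)
    (hrR : r < R) (hx : dist x x₀ < (R + r) / 2) (hy : R ≤ dist y x₀) :
    kernel σ m x y ≤
      (2 * R / (R - r)) ^ ((N : ℝ) + σ * m) * (1 / ‖y - x₀‖ ^ ((N : ℝ) + σ * m)) := by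
  have hR : 0 < R := hr.trans hrR
  have hd : 0 < R - r := by linarith
  have hy0 : 0 < ‖y - x₀‖ := by rw [← dist_eq_norm]; linarith
  have e : 0 ≤ (N : ℝ) + σ * m := by
    have : (0 : ℝ) ≤ N := by positivity
    linarith [mul_comm m σ]
  have htri : ‖y - x₀‖ ≤ ‖x - y‖ + dist x x₀ := by
    rw [← dist_eq_norm, ← dist_eq_norm, dist_comm x y]; exact dist_triangle _ _ _
  have hy' : R ≤ ‖y - x₀‖ := by rwa [← dist_eq_norm]
  have hlow : ‖y - x₀‖ * ((R - r) / (2 * R)) ≤ ‖x - y‖ := by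
    have h1 : dist x x₀ ≤ ‖y - x₀‖ * ((R + r) / (2 * R)) := by
      calc dist x x₀ ≤ R * ((R + r) / (2 * R)) := by
            rw [show R * ((R + r) / (2 * R)) = (R + r) / 2 by field_simp]; exact hx.le
        _ ≤ _ := by gcongr
    have h2 : ‖y - x₀‖ * ((R - r) / (2 * R)) = ‖y - x₀‖ - ‖y - x₀‖ * ((R + r) / (2 * R)) := by
      field_simp; ring
    linarith
  have hpos : 0 < ‖y - x₀‖ * ((R - r) / (2 * R)) := by positivity
  have hxy : 0 < ‖x - y‖ := hpos.trans_le hlow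
  have e1 : kernel σ m x y = 1 / ‖x - y‖ ^ ((N : ℝ) + σ * m) := by
    unfold kernel
    rw [Real.rpow_add hxy, Real.rpow_natCast, one_div, mul_comm m σ, mul_comm]
  rw [e1]
  calc 1 / ‖x - y‖ ^ ((N : ℝ) + σ * m)
      ≤ 1 / (‖y - x₀‖ * ((R - r) / (2 * R))) ^ ((N : ℝ) + σ * m) := by gcongr
    _ = _ := by
      rw [Real.mul_rpow hy0.le (by positivity), Real.div_rpow hd.le (by positivity),
        Real.div_rpow (by positivity) hd.le]
      field_simp

/-! ### The spatial cutoff -/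

/-- The Lipschitz cutoff that is `1` on `B_r(x₀)` and vanishes outside `B_{(R+r)/2}(x₀)`. -/
noncomputable def cutoff {N : ℕ} (x₀ : Sp N) (r R : ℝ) (x : Sp N) : ℝ :=
  max 0 (min 1 ((R + r - 2 * dist x x₀) / (R - r)))

section cutoff
variable {N : ℕ} {x₀ : Sp N} {r R : ℝ}

lemma cutoff_nonneg (x : Sp N) : 0 ≤ cutoff x₀ r R x := le_max_left _ _

lemma cutoff_le_one (x : Sp N) : cutoff x₀ r R x ≤ 1 := max_le zero_le_one (min_le_left _ _)

lemma continuous_cutoff : Continuous (cutoff x₀ r R) := by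
  unfold cutoff; fun_prop

lemma cutoff_eq_one (hrR : r < R) {x : Sp N} (hx : dist x x₀ < r) : cutoff x₀ r R x = 1 := by
  unfold cutoff
  rw [min_eq_left, max_eq_right zero_le_one]
  rw [le_div_iff₀ (by linarith)]; linarith

lemma cutoff_eq_zero (hrR : r < R) {x : Sp N} (hx : (R + r) / 2 ≤ dist x x₀) :
    cutoff x₀ r R x = 0 := by
  unfold cutoff
  apply max_eq_left
  exact (min_le_right _ _).trans (div_nonpos_of_nonpos_of_nonneg (by linarith) (by linarith))

lemma abs_cutoff_sub_le (hrR : r < R) (x y : Sp N) :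
    |cutoff x₀ r R x - cutoff x₀ r R y| ≤ 2 / (R - r) * ‖x - y‖ := by
  have hd : 0 < R - r := by linarith
  unfold cutoff
  rw [max_comm 0, max_comm 0]
  refine (abs_max_sub_max_le_abs _ _ _).trans ?_
  refine (abs_min_sub_min_le_max _ _ _ _).trans ?_
  rw [sub_self, abs_zero, max_eq_right (abs_nonneg _), ← sub_div, abs_div, abs_of_pos hd,
    div_le_iff₀ hd]
  have e : 2 / (R - r) * ‖x - y‖ * (R - r) = 2 * dist x y := by
    rw [dist_eq_norm]; field_simp
  rw [e, show R + r - 2 * dist x x₀ - (R + r - 2 * dist y x₀) = -(2 * (dist x x₀ - dist y x₀)) by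
    ring, abs_neg, abs_mul, abs_two]
  have := abs_dist_sub_le x y x₀
  linarith

end cutoff

/-! ### The energy estimate at a fixed time -/

/-- One phase of the energy over `A × A`, with exponent `m`, order `σ` and coefficient `b`. -/
noncomputable def phaseEnergy {N : ℕ} (σ m : ℝ) (b : Sp N → Sp N → ℝ) (A : Set (Sp N))
    (f : Sp N → ℝ) : ℝ≥0∞ :=
  ∫⁻ x in A, ∫⁻ y in A, ENNReal.ofReal (b x y * |f x - f y| ^ m * kernel σ m x y)

/-- The truncation of a function of the space variable. -/
def posTrunc {N : ℕ} (f : Sp N → ℝ) (k : ℝ) (x : Sp N) : ℝ := max (f x - k) 0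

lemma posTrunc_nonneg {N : ℕ} (f : Sp N → ℝ) (k : ℝ) (x : Sp N) : 0 ≤ posTrunc f k x :=
  le_max_right _ _

/-- The tail integral at one time: the `(m-1)`-st power of the tail of `w`. -/
noncomputable def tailSlice {N : ℕ} (σ m : ℝ) (w : Sp N → ℝ) (x₀ : Sp N) (r : ℝ) : ℝ≥0∞ :=
  ENNReal.ofReal (r ^ (σ * m)) * ∫⁻ x in (Metric.ball x₀ r)ᶜ,
    ENNReal.ofReal (|w x| ^ (m - 1) / ‖x - x₀‖ ^ ((N : ℝ) + σ * m))

section slice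

variable {N : ℕ} {σ m q M k r R ψ : ℝ} {x₀ : Sp N} {b : Sp N → Sp N → ℝ} {f : Sp N → ℝ}

open Classical in
/-- Half of the error density in the slice estimate: the part in which the point `x` carries the
test map. The full error density is its symmetrization. -/
noncomputable def errorDensity (σ m q M r R : ℝ) (x₀ : Sp N) (w : Sp N → ℝ) (x y : Sp N) : ℝ :=
  if x ∈ Metric.ball x₀ R then
    if y ∈ Metric.ball x₀ R then
      M * (q ^ m * (2 / (R - r)) ^ m) * w x ^ m * (‖x - y‖ ^ m * kernel σ m x y)
    else if x ∈ Metric.ball x₀ ((R + r) / 2) then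
      M * m * w x * (w y ^ (m - 1) * kernel σ m x y)
    else 0
  else 0

lemma errorDensity_nonneg (hM : 0 ≤ M) (hm : 0 ≤ m) (hq : 0 ≤ q) (hrR : r < R) {w : Sp N → ℝ}
    (hw : ∀ x, 0 ≤ w x) (x y : Sp N) : 0 ≤ errorDensity σ m q M r R x₀ w x y := by
  have h1 := hw x
  have h2 := hw y
  have h3 := kernel_nonneg σ m x y
  have h4 : 0 < R - r := by linarith
  unfold errorDensity
  split_ifs <;> positivity

lemma measurable_errorDensity {w : Sp N → ℝ} (hw : Measurable w) :
    Measurable fun z : Sp N × Sp N => errorDensity σ m q M r R x₀ w z.1 z.2 := by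
  unfold errorDensity
  have hb : ∀ ρ, MeasurableSet {z : Sp N × Sp N | z.1 ∈ Metric.ball x₀ ρ} := fun ρ =>
    measurable_fst measurableSet_ball
  have hb2 : ∀ ρ, MeasurableSet {z : Sp N × Sp N | z.2 ∈ Metric.ball x₀ ρ} := fun ρ =>
    measurable_snd measurableSet_ball
  refine Measurable.ite (hb _) (Measurable.ite (hb2 _) ?_
    (Measurable.ite (hb _) ?_ measurable_const)) measurable_const <;> fun_prop

/-- A pair of points only one of which can carry the test map. -/
lemma phase_density_far_le {β : ℝ} {X Y K ζ : ℝ} (hm : 1 < m) (hβ0 : 0 ≤ β) (hβM : β ≤ M)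
    (hK : 0 ≤ K) (hζ0 : 0 ≤ ζ) (hζ1 : ζ ≤ 1) :
    β * |X - Y - ζ * max X 0| ^ m * K ≤
      β * |X - Y| ^ m * K + M * m * max X 0 * (max Y 0 ^ (m - 1) * K) := by
  have h := abs_sub_cutoff_rpow_far (X := X) (Y := Y) hm hζ0 hζ1
  have h0 : 0 ≤ m * (max X 0 * max Y 0 ^ (m - 1)) := by
    have : 0 ≤ m := by linarith
    positivity
  calc β * |X - Y - ζ * max X 0| ^ m * K
      ≤ β * (|X - Y| ^ m + m * (max X 0 * max Y 0 ^ (m - 1))) * K := by gcongr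
    _ = β * |X - Y| ^ m * K + β * (m * (max X 0 * max Y 0 ^ (m - 1))) * K := by ring
    _ ≤ β * |X - Y| ^ m * K + M * (m * (max X 0 * max Y 0 ^ (m - 1))) * K := by gcongr
    _ = _ := by ring

open Classical in
/-- The pointwise form of the slice estimate. -/
lemma phase_density_le (hm : 1 < m) (hmq : m ≤ q) (hrR : r < R)
    (hb : ∀ x y, 0 ≤ b x y ∧ b x y ≤ M) (hψ0 : 0 ≤ ψ) (hψ1 : ψ ≤ 1) (x y : Sp N) :
    b x y * |(f x - ψ * cutoff x₀ r R x ^ q * posTrunc f k x) -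
          (f y - ψ * cutoff x₀ r R y ^ q * posTrunc f k y)| ^ m * kernel σ m x y +
        ψ * (if x ∈ Metric.ball x₀ r ∧ y ∈ Metric.ball x₀ r then
          b x y * |posTrunc f k x - posTrunc f k y| ^ m * kernel σ m x y else 0) ≤
      b x y * |f x - f y| ^ m * kernel σ m x y +
        (errorDensity σ m q M r R x₀ (posTrunc f k) x y +
          errorDensity σ m q M r R x₀ (posTrunc f k) y x) := by
  obtain ⟨hb0, hbM⟩ := hb x y
  have hM : 0 ≤ M := hb0.trans hbM
  have hK := kernel_nonneg σ m x y
  have hq0 : 0 < q := by linarith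
  have hd : 0 < R - r := by linarith
  set X := f x - k with hX
  set Y := f y - k with hY
  have e1 : (f x - ψ * cutoff x₀ r R x ^ q * posTrunc f k x) -
      (f y - ψ * cutoff x₀ r R y ^ q * posTrunc f k y) =
      X - Y - (ψ * cutoff x₀ r R x ^ q * max X 0 - ψ * cutoff x₀ r R y ^ q * max Y 0) := by
    simp only [posTrunc, hX, hY]; ring
  have e2 : f x - f y = X - Y := by simp only [hX, hY]; ring
  rw [e1, e2]
  have hpx : posTrunc f k x = max X 0 := rfl
  have hpy : posTrunc f k y = max Y 0 := rfl
  have hζ : ∀ z : Sp N, 0 ≤ ψ * cutoff x₀ r R z ^ q ∧ ψ * cutoff x₀ r R z ^ q ≤ 1 := fun z =>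
    ⟨mul_nonneg hψ0 (Real.rpow_nonneg (cutoff_nonneg z) _),
      mul_le_one₀ hψ1 (Real.rpow_nonneg (cutoff_nonneg z) _)
        (Real.rpow_le_one (cutoff_nonneg z) (cutoff_le_one z) hq0.le)⟩
  have hout : ∀ z : Sp N, z ∉ Metric.ball x₀ ((R + r) / 2) → cutoff x₀ r R z = 0 := fun z hz =>
    cutoff_eq_zero hrR (by simpa using hz)
  have hRout : ∀ z : Sp N, z ∉ Metric.ball x₀ R →
      z ∉ Metric.ball x₀ r ∧ z ∉ Metric.ball x₀ ((R + r) / 2) := fun z hz => by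
    simp only [Metric.mem_ball, not_lt] at hz ⊢
    constructor <;> linarith
  unfold errorDensity
  rw [hpx, hpy, kernel_comm σ m y x, norm_sub_rev y x]
  by_cases hx : x ∈ Metric.ball x₀ R <;> by_cases hy : y ∈ Metric.ball x₀ R
  · simp only [hx, hy, if_true]
    have h := abs_sub_cutoff_rpow_near (X := X) (Y := Y) hm.le hmq hψ0 hψ1
      (cutoff_nonneg (x₀ := x₀) (r := r) (R := R) x) (cutoff_le_one x)
      (cutoff_nonneg (x₀ := x₀) (r := r) (R := R) y) (cutoff_le_one y)
    have hG : ψ * (if x ∈ Metric.ball x₀ r ∧ y ∈ Metric.ball x₀ r then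
          b x y * |max X 0 - max Y 0| ^ m * kernel σ m x y else 0) ≤
        b x y * (ψ * min (cutoff x₀ r R x) (cutoff x₀ r R y) ^ q *
          |max X 0 - max Y 0| ^ m) * kernel σ m x y := by
      split_ifs with hr
      · rw [cutoff_eq_one hrR (Metric.mem_ball.1 hr.1), cutoff_eq_one hrR (Metric.mem_ball.1 hr.2),
          min_self, Real.one_rpow]
        apply le_of_eq; ring
      · rw [mul_zero]
        have : 0 ≤ min (cutoff x₀ r R x) (cutoff x₀ r R y) :=
          le_min (cutoff_nonneg x) (cutoff_nonneg y)
        positivity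
    have hL : |cutoff x₀ r R x - cutoff x₀ r R y| ^ m ≤ (2 / (R - r)) ^ m * ‖x - y‖ ^ m := by
      rw [← Real.mul_rpow (by positivity) (norm_nonneg _)]
      exact Real.rpow_le_rpow (abs_nonneg _) (abs_cutoff_sub_le hrR x y) (by linarith)
    have h1 := mul_le_mul_of_nonneg_right (mul_le_mul_of_nonneg_left h hb0) hK
    have h2 : b x y * (q ^ m * |cutoff x₀ r R x - cutoff x₀ r R y| ^ m *
          (max X 0 ^ m + max Y 0 ^ m)) * kernel σ m x y ≤
        M * (q ^ m * ((2 / (R - r)) ^ m * ‖x - y‖ ^ m) *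
          (max X 0 ^ m + max Y 0 ^ m)) * kernel σ m x y := by gcongr
    nlinarith [h1, h2, hG]
  · obtain ⟨hyr, hyρ⟩ := hRout y hy
    simp only [hx, hy, hyr, and_false, if_true, if_false]
    rw [hout y hyρ, Real.zero_rpow hq0.ne']
    simp only [mul_zero, zero_mul, sub_zero, add_zero]
    split_ifs with hxρ
    · exact phase_density_far_le hm hb0 hbM hK (hζ x).1 (hζ x).2
    · rw [hout x hxρ, Real.zero_rpow hq0.ne']; simp
  · obtain ⟨hxr, hxρ⟩ := hRout x hx
    simp only [hx, hy, hxr, false_and, if_true, if_false]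
    rw [hout x hxρ, Real.zero_rpow hq0.ne']
    simp only [mul_zero, zero_mul, zero_sub, add_zero, zero_add]
    rw [← abs_neg, show -(X - Y - -(ψ * cutoff x₀ r R y ^ q * max Y 0)) =
      Y - X - ψ * cutoff x₀ r R y ^ q * max Y 0 by ring, abs_sub_comm X Y]
    split_ifs with hyρ
    · exact phase_density_far_le hm hb0 hbM hK (hζ y).1 (hζ y).2
    · rw [hout y hyρ, Real.zero_rpow hq0.ne']; simp
  · obtain ⟨hxr, hxρ⟩ := hRout x hx
    obtain ⟨hyr, hyρ⟩ := hRout y hy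
    simp only [hx, hy, hxr, false_and, if_false]
    rw [hout x hxρ, hout y hyρ, Real.zero_rpow hq0.ne']
    simp

/-- The integral of the error density: near interactions contribute the oscillation of the
cutoff, far ones the tail. -/
lemma exists_lintegral_errorDensity_le (hN : 0 < N) (hσ : σ ∈ Ioo (0 : ℝ) 1) (hm : 1 < m)
    (hmq : m ≤ q) (hM : 0 ≤ M) :
    ∃ C : ℝ, 0 < C ∧ ∀ (x₀ : Sp N) (r R : ℝ) (w : Sp N → ℝ), 0 < r → r < R → Measurable w →
      (∀ x, 0 ≤ w x) →
      ∫⁻ x, ∫⁻ y, ENNReal.ofReal (errorDensity σ m q M r R x₀ w x y) ≤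
        ENNReal.ofReal (C * (R ^ (m * (1 - σ)) / (R - r) ^ m)) *
            (∫⁻ x in Metric.ball x₀ R, ENNReal.ofReal (w x ^ m)) +
          ENNReal.ofReal (C * (R / r) ^ (σ * m) * (R ^ N / (R - r) ^ ((N : ℝ) + σ * m))) *
            (∫⁻ x in Metric.ball x₀ R, ENNReal.ofReal (w x)) * tailSlice σ m w x₀ r := by
  have hm0 : 0 < m := by linarith
  have hq0 : 0 < q := by linarith
  obtain ⟨c, hc, hker⟩ := exists_lintegral_norm_rpow_mul_kernel_le N hN hσ.2 hm0
  set C₁ := M * (q ^ m * 2 ^ m) * c with hC₁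
  set C₂ := M * m * 2 ^ ((N : ℝ) + σ * m) with hC₂
  have hC₁0 : 0 ≤ C₁ := by positivity
  have hC₂0 : 0 ≤ C₂ := by positivity
  -- the summand `1` keeps the constant positive when `M = 0`
  refine ⟨1 + C₁ + C₂, by positivity, fun x₀ r R w hr hrR hwm hw => ?_⟩
  have hR : 0 < R := hr.trans hrR
  have hd : 0 < R - r := by linarith
  set S : ℝ≥0∞ := ∫⁻ x in (Metric.ball x₀ r)ᶜ,
    ENNReal.ofReal (|w x| ^ (m - 1) / ‖x - x₀‖ ^ ((N : ℝ) + σ * m)) with hS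
  have hTail : tailSlice σ m w x₀ r = ENNReal.ofReal (r ^ (σ * m)) * S := rfl
  have hr' : 0 < r ^ (σ * m) := Real.rpow_pos_of_pos hr _
  -- the near part of the inner integral
  have hnear : ∀ x ∈ Metric.ball x₀ R, ∫⁻ y in Metric.ball x₀ R,
      ENNReal.ofReal (errorDensity σ m q M r R x₀ w x y) ≤
      ENNReal.ofReal (C₁ * (R ^ (m * (1 - σ)) / (R - r) ^ m)) * ENNReal.ofReal (w x ^ m) := by
    intro x hx
    have e : ∀ y ∈ Metric.ball x₀ R, ENNReal.ofReal (errorDensity σ m q M r R x₀ w x y) =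
        ENNReal.ofReal (M * (q ^ m * (2 / (R - r)) ^ m) * w x ^ m) *
          ENNReal.ofReal (‖x - y‖ ^ m * kernel σ m x y) := by
      intro y hy
      have := hw x
      rw [← ENNReal.ofReal_mul (by positivity)]
      simp only [errorDensity, hx, hy, if_true]
    rw [setLIntegral_congr_fun measurableSet_ball e, lintegral_const_mul']
    · refine (mul_le_mul_right (hker x₀ x R hR hx) _).trans (le_of_eq ?_)
      have := hw x
      rw [← ENNReal.ofReal_mul (by positivity), ← ENNReal.ofReal_mul (by positivity)]
      congr 1
      rw [Real.div_rpow (by norm_num) hd.le, hC₁]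
      ring
    · exact ENNReal.ofReal_ne_top
  -- the far part of the inner integral
  have hfar : ∀ x ∈ Metric.ball x₀ R, ∫⁻ y in (Metric.ball x₀ R)ᶜ,
      ENNReal.ofReal (errorDensity σ m q M r R x₀ w x y) ≤
      ENNReal.ofReal (C₂ * (R / r) ^ (σ * m) * (R ^ N / (R - r) ^ ((N : ℝ) + σ * m))) *
        ENNReal.ofReal (w x) * tailSlice σ m w x₀ r := by
    intro x hx
    have hwx := hw x
    have hb : ∀ y ∈ (Metric.ball x₀ R)ᶜ, ENNReal.ofReal (errorDensity σ m q M r R x₀ w x y) ≤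
        ENNReal.ofReal (M * m * w x * (2 * R / (R - r)) ^ ((N : ℝ) + σ * m)) *
          ENNReal.ofReal (|w y| ^ (m - 1) / ‖y - x₀‖ ^ ((N : ℝ) + σ * m)) := by
      intro y hy
      have hy' : y ∉ Metric.ball x₀ R := hy
      rw [← ENNReal.ofReal_mul (by positivity)]
      apply ENNReal.ofReal_le_ofReal
      simp only [errorDensity, hx, hy', if_true, if_false]
      split_ifs with hxρ
      · have h := kernel_le_of_far (m := m) (mul_pos hm0 hσ.1) hr hrR (Metric.mem_ball.1 hxρ)
          (not_lt.1 (fun h => hy' (Metric.mem_ball.2 h)))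
        have hwy := hw y
        rw [abs_of_nonneg hwy]
        calc M * m * w x * (w y ^ (m - 1) * kernel σ m x y)
            ≤ M * m * w x * (w y ^ (m - 1) * ((2 * R / (R - r)) ^ ((N : ℝ) + σ * m) *
              (1 / ‖y - x₀‖ ^ ((N : ℝ) + σ * m)))) := by gcongr
          _ = _ := by ring
      · positivity
    refine (setLIntegral_mono' measurableSet_ball.compl hb).trans ?_
    rw [lintegral_const_mul' _ _ ENNReal.ofReal_ne_top]
    refine (mul_le_mul_right (lintegral_mono_set
      (compl_subset_compl.2 (Metric.ball_subset_ball hrR.le))) _).trans ?_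
    rw [hTail, ← hS, ← mul_assoc]
    refine mul_le_mul_left (le_of_eq ?_) S
    rw [← ENNReal.ofReal_mul (by positivity), ← ENNReal.ofReal_mul (by positivity)]
    congr 1
    rw [Real.div_rpow (by positivity) hd.le, Real.mul_rpow (by norm_num) hR.le, hC₂,
      Real.div_rpow hR.le hr.le, Real.rpow_add hR, Real.rpow_natCast]
    field_simp
  have hinner : ∀ x, ∫⁻ y, ENNReal.ofReal (errorDensity σ m q M r R x₀ w x y) ≤
      (Metric.ball x₀ R).indicator (fun x =>
        ENNReal.ofReal (C₁ * (R ^ (m * (1 - σ)) / (R - r) ^ m)) * ENNReal.ofReal (w x ^ m) +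
        ENNReal.ofReal (C₂ * (R / r) ^ (σ * m) * (R ^ N / (R - r) ^ ((N : ℝ) + σ * m))) *
        ENNReal.ofReal (w x) * tailSlice σ m w x₀ r) x := by
    intro x
    by_cases hx : x ∈ Metric.ball x₀ R
    · rw [indicator_of_mem hx, ← lintegral_add_compl _ (measurableSet_ball (x := x₀) (ε := R))]
      exact add_le_add (hnear x hx) (hfar x hx)
    · simp [errorDensity, hx]
  refine (lintegral_mono hinner).trans ?_
  rw [lintegral_indicator measurableSet_ball, lintegral_add_left (by fun_prop),
    lintegral_const_mul _ (by fun_prop)]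
  have e2 : ∫⁻ x in Metric.ball x₀ R, ENNReal.ofReal (C₂ * (R / r) ^ (σ * m) *
      (R ^ N / (R - r) ^ ((N : ℝ) + σ * m))) * ENNReal.ofReal (w x) * tailSlice σ m w x₀ r =
      ENNReal.ofReal (C₂ * (R / r) ^ (σ * m) * (R ^ N / (R - r) ^ ((N : ℝ) + σ * m))) *
        (∫⁻ x in Metric.ball x₀ R, ENNReal.ofReal (w x)) * tailSlice σ m w x₀ r := by
    rw [lintegral_mul_const _ (by fun_prop), lintegral_const_mul _ (by fun_prop)]
  rw [e2]
  gcongr <;> linarith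

/-- The slice estimate for one phase: subtracting the test map lowers the energy by the energy of
the truncation on the inner ball, up to the local and the tail error. -/
lemma exists_phaseEnergy_sub_cutoff_le (hN : 0 < N) (hσ : σ ∈ Ioo (0 : ℝ) 1) (hm : 1 < m)
    (hmq : m ≤ q) (hM : 0 ≤ M) :
    ∃ C : ℝ, 0 < C ∧ ∀ (b : Sp N → Sp N → ℝ), Measurable (fun z : Sp N × Sp N => b z.1 z.2) →
      (∀ x y, 0 ≤ b x y ∧ b x y ≤ M) →
      ∀ (x₀ : Sp N) (r R k ψ : ℝ) (f : Sp N → ℝ), 0 < r → r < R → 0 ≤ ψ → ψ ≤ 1 → Measurable f →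
      phaseEnergy σ m b univ (fun x => f x - ψ * cutoff x₀ r R x ^ q * posTrunc f k x) +
          ENNReal.ofReal ψ * phaseEnergy σ m b (Metric.ball x₀ r) (posTrunc f k) ≤
        phaseEnergy σ m b univ f +
        (ENNReal.ofReal (C * (R ^ (m * (1 - σ)) / (R - r) ^ m)) *
            (∫⁻ x in Metric.ball x₀ R, ENNReal.ofReal (posTrunc f k x ^ m)) +
          ENNReal.ofReal (C * (R / r) ^ (σ * m) * (R ^ N / (R - r) ^ ((N : ℝ) + σ * m))) *
            (∫⁻ x in Metric.ball x₀ R, ENNReal.ofReal (posTrunc f k x)) *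
            tailSlice σ m (posTrunc f k) x₀ r) := by
  classical
  obtain ⟨C, hC, hF⟩ := exists_lintegral_errorDensity_le (q := q) hN hσ hm hmq hM
  refine ⟨2 * C, by positivity, fun b hbm hb x₀ r R k ψ f hr hrR hψ0 hψ1 hf => ?_⟩
  have hR : 0 < R := hr.trans hrR
  have hd : 0 < R - r := by linarith
  have hq0 : 0 ≤ q := by linarith
  set w := posTrunc f k with hw
  have hwm : Measurable w := by
    rw [hw]; unfold posTrunc; fun_prop
  have hη : Measurable (cutoff x₀ r R) := continuous_cutoff.measurable
  set v : Sp N → ℝ := fun x => f x - ψ * cutoff x₀ r R x ^ q * w x with hv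
  have hvm : Measurable v := by rw [hv]; fun_prop
  have hF0 : ∀ x y, 0 ≤ errorDensity σ m q M r R x₀ w x y :=
    errorDensity_nonneg hM (by linarith) hq0 hrR (posTrunc_nonneg f k)
  have hFm : Measurable fun z : Sp N × Sp N => errorDensity σ m q M r R x₀ w z.1 z.2 :=
    measurable_errorDensity hwm
  have hFle := hF x₀ r R w hr hrR hwm (posTrunc_nonneg f k)
  have hdens := phase_density_le (f := f) (k := k) (σ := σ) (x₀ := x₀) hm hmq hrR hb hψ0 hψ1
  rw [← hw] at hdens
  generalize errorDensity σ m q M r R x₀ w = F at hF0 hFm hFle hdens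
  have hdm : ∀ h : Sp N → ℝ, Measurable h → Measurable fun z : Sp N × Sp N =>
      ENNReal.ofReal (b z.1 z.2 * |h z.1 - h z.2| ^ m * kernel σ m z.1 z.2) := by
    intro h hh; fun_prop
  have hds : ∀ h : Sp N → ℝ, Measurable h → ∀ x, Measurable fun y =>
      ENNReal.ofReal (b x y * |h x - h y| ^ m * kernel σ m x y) := fun h hh x =>
    (hdm h hh).comp measurable_prodMk_left
  have hG : phaseEnergy σ m b (Metric.ball x₀ r) w = ∫⁻ x, ∫⁻ y, ENNReal.ofReal
      (if x ∈ Metric.ball x₀ r ∧ y ∈ Metric.ball x₀ r then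
          b x y * |w x - w y| ^ m * kernel σ m x y else 0) := by
    unfold phaseEnergy
    rw [← lintegral_indicator measurableSet_ball]
    congr 1; ext x
    by_cases hx : x ∈ Metric.ball x₀ r
    · rw [indicator_of_mem hx, ← lintegral_indicator measurableSet_ball]
      congr 1; ext y
      by_cases hy : y ∈ Metric.ball x₀ r <;> simp [hx, hy]
    · simp [hx]
  have hpt : ∀ x y, ENNReal.ofReal (b x y * |v x - v y| ^ m * kernel σ m x y) +
      ENNReal.ofReal ψ * ENNReal.ofReal
      (if x ∈ Metric.ball x₀ r ∧ y ∈ Metric.ball x₀ r then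
          b x y * |w x - w y| ^ m * kernel σ m x y else 0) ≤
      ENNReal.ofReal (b x y * |f x - f y| ^ m * kernel σ m x y) +
        (ENNReal.ofReal (F x y) + ENNReal.ofReal (F y x)) := by
    intro x y
    have hb0 := (hb x y).1
    have hK := kernel_nonneg σ m x y
    rw [← ENNReal.ofReal_mul hψ0, ← ENNReal.ofReal_add (hF0 x y) (hF0 y x),
      ← ENNReal.ofReal_add (by positivity) (add_nonneg (hF0 x y) (hF0 y x)),
      ← ENNReal.ofReal_add (by positivity) (mul_nonneg hψ0 (by split_ifs <;> positivity))]
    exact ENNReal.ofReal_le_ofReal (hdens x y)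
  have hFm1 : Measurable fun x => ∫⁻ y, ENNReal.ofReal (F x y) :=
    hFm.ennreal_ofReal.lintegral_prod_right'
  have hFx : ∀ x, Measurable fun y => ENNReal.ofReal (F x y) := fun x =>
    hFm.ennreal_ofReal.comp (measurable_prodMk_left)
  have hswap : ∫⁻ x, ∫⁻ y, ENNReal.ofReal (F y x) = ∫⁻ x, ∫⁻ y, ENNReal.ofReal (F x y) :=
    (lintegral_lintegral_swap (f := fun x y => ENNReal.ofReal (F x y))
      hFm.ennreal_ofReal.aemeasurable).symm
  calc phaseEnergy σ m b univ v + ENNReal.ofReal ψ * phaseEnergy σ m b (Metric.ball x₀ r) w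
      = ∫⁻ x, ∫⁻ y, (ENNReal.ofReal (b x y * |v x - v y| ^ m * kernel σ m x y) +
        ENNReal.ofReal ψ * ENNReal.ofReal (if x ∈ Metric.ball x₀ r ∧ y ∈ Metric.ball x₀ r then
          b x y * |w x - w y| ^ m * kernel σ m x y else 0)) := by
        rw [hG, ← lintegral_const_mul' _ _ ENNReal.ofReal_ne_top]
        unfold phaseEnergy
        simp only [Measure.restrict_univ]
        rw [← lintegral_add_left (hdm v hvm).lintegral_prod_right']
        congr 1; ext x
        rw [← lintegral_const_mul' _ _ ENNReal.ofReal_ne_top,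
          ← lintegral_add_left (hds v hvm x)]
    _ ≤ ∫⁻ x, ∫⁻ y, (ENNReal.ofReal (b x y * |f x - f y| ^ m * kernel σ m x y) +
        (ENNReal.ofReal (F x y) + ENNReal.ofReal (F y x))) :=
        lintegral_mono fun x => lintegral_mono fun y => hpt x y
    _ = phaseEnergy σ m b univ f + 2 * ∫⁻ x, ∫⁻ y, ENNReal.ofReal (F x y) := by
        unfold phaseEnergy
        simp only [Measure.restrict_univ]
        rw [two_mul]
        nth_rw 2 [← hswap]
        rw [← lintegral_add_left hFm1,
          ← lintegral_add_left (hdm f hf).lintegral_prod_right']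
        congr 1; ext x
        rw [← lintegral_add_left (hFx x),
          ← lintegral_add_left (hds f hf x)]
    _ ≤ _ := by
        refine add_le_add le_rfl ((mul_le_mul_right hFle 2).trans (le_of_eq ?_))
        rw [mul_add, ← mul_assoc, ← mul_assoc, ← mul_assoc]
        have e2 : ∀ a : ℝ, 2 * ENNReal.ofReal a = ENNReal.ofReal (2 * a) := fun a => by
          rw [ENNReal.ofReal_mul (by norm_num), ENNReal.ofReal_ofNat]
        rw [e2, e2]
        simp only [mul_assoc]

end slice

/-! ### Absolutely continuous functions of time -/

lemma absolutelyContinuousOnInterval_abs {U : ℝ → ℝ} {a b : ℝ}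
    (hU : AbsolutelyContinuousOnInterval U a b) :
    AbsolutelyContinuousOnInterval (fun t => |U t|) a b := by
  refine squeeze_zero (fun t => Finset.sum_nonneg fun i _ => dist_nonneg) (fun t => ?_) hU
  refine Finset.sum_le_sum fun i _ => ?_
  rw [Real.dist_eq, Real.dist_eq]
  exact abs_abs_sub_abs_le _ _

lemma absolutelyContinuousOnInterval_const (c a b : ℝ) :
    AbsolutelyContinuousOnInterval (fun _ => c) a b :=
  ((LipschitzWith.const c).lipschitzOnWith (s := uIcc a b)).absolutelyContinuousOnInterval

lemma absolutelyContinuousOnInterval_max_sub {U : ℝ → ℝ} {a b : ℝ} (k : ℝ)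
    (hU : AbsolutelyContinuousOnInterval U a b) :
    AbsolutelyContinuousOnInterval (fun t => max (U t - k) 0) a b := by
  have h := (hU.fun_sub (absolutelyContinuousOnInterval_const k a b))
  have h2 := (h.fun_add (absolutelyContinuousOnInterval_abs h)).const_mul (1 / 2)
  refine cast (congrArg (fun f => AbsolutelyContinuousOnInterval f a b) (funext fun t => ?_)) h2
  rw [max_def]
  split_ifs with hk
  · rw [abs_of_nonpos hk]; ring
  · rw [abs_of_nonneg (not_le.1 hk).le]; ring

/-- Chain rule for the truncation: at a point of the level set `{U = k}` the truncation has a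
minimum, so that its derivative, where it exists, vanishes there. -/
lemma ae_hasDerivAt_max_sub {U g : ℝ → ℝ} {a b k : ℝ}
    (hU : AbsolutelyContinuousOnInterval U a b)
    (hg : ∀ᵐ t, t ∈ uIcc a b → HasDerivAt U (g t) t) :
    ∀ᵐ t, t ∈ uIcc a b →
      HasDerivAt (fun t => max (U t - k) 0) (if k < U t then g t else 0) t := by
  filter_upwards [hg, (absolutelyContinuousOnInterval_max_sub k hU).ae_differentiableAt]
    with t h1 h2 ht
  specialize h1 ht
  specialize h2 ht
  rcases lt_trichotomy (U t) k with hlt | heq | hgt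
  · rw [if_neg hlt.not_gt]
    refine (hasDerivAt_const t (0 : ℝ)).congr_of_eventuallyEq ?_
    filter_upwards [h1.continuousAt.eventually_lt_const hlt] with s hs
    exact max_eq_right (by linarith)
  · rw [if_neg heq.le.not_gt]
    have hmin : IsLocalMin (fun t => max (U t - k) 0) t := Eventually.of_forall fun s => by
      simp [heq]
    have := hmin.deriv_eq_zero
    have h3 := h2.hasDerivAt
    rwa [this] at h3
  · rw [if_pos hgt]
    refine (h1.sub_const k).congr_of_eventuallyEq ?_
    filter_upwards [h1.continuousAt.eventually_const_lt hgt] with s hs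
    exact max_eq_left (by linarith)

lemma integral_eq_sub_of_absolutelyContinuous {P g : ℝ → ℝ} {a b : ℝ}
    (hP : AbsolutelyContinuousOnInterval P a b)
    (hg : ∀ᵐ t, t ∈ uIcc a b → HasDerivAt P (g t) t) :
    ∫ t in a..b, g t = P b - P a := by
  rw [← hP.integral_deriv_eq_sub]
  refine intervalIntegral.integral_congr_ae ?_
  filter_upwards [hg] with t h ht
  exact (h (uIoc_subset_uIcc ht)).deriv.symm

lemma absolutelyContinuousOnInterval_of_contDiff {ψ : ℝ → ℝ} (hψ : ContDiff ℝ 1 ψ) (a b : ℝ) :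
    AbsolutelyContinuousOnInterval ψ a b :=
  hψ.contDiffOn.absolutelyContinuousOnInterval

lemma primitive_facts {g : ℝ → ℝ} {a b : ℝ} (c : ℝ) (hg : IntervalIntegrable g volume a b) :
    AbsolutelyContinuousOnInterval (fun t => c + ∫ s in a..t, g s) a b ∧
      ∀ᵐ t, t ∈ uIcc a b → HasDerivAt (fun t => c + ∫ s in a..t, g s) (g t) t := by
  refine ⟨(absolutelyContinuousOnInterval_const c a b).fun_add
    (hg.absolutelyContinuousOnInterval_intervalIntegral left_mem_uIcc), ?_⟩
  filter_upwards [hg.ae_hasDerivAt_integral] with t h ht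
  exact (h ht a left_mem_uIcc).const_add c

lemma integral_sub_mul_deriv_eq_zero {F G : ℝ → ℝ} {a b : ℝ} (hab : a < b)
    (hF : ContinuousOn F (Icc a b)) (hG : IntervalIntegrable G volume a b)
    (h : ∀ χ : ℝ → ℝ, ContDiff ℝ ((⊤ : ℕ∞) : WithTop ℕ∞) χ → HasCompactSupport χ →
      tsupport χ ⊆ Ioo a b → ∫ t in Ioo a b, F t * deriv χ t = -∫ t in Ioo a b, G t * χ t)
    {χ : ℝ → ℝ} (hχ : ContDiff ℝ ((⊤ : ℕ∞) : WithTop ℕ∞) χ) (hc : HasCompactSupport χ)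
    (hs : tsupport χ ⊆ Ioo a b) :
    ∫ t in a..b, (F t - ∫ s in a..t, G s) * deriv χ t = 0 := by
  obtain ⟨hP, hPd⟩ := primitive_facts 0 hG
  simp only [zero_add] at hP hPd
  have hχ1 : ContDiff ℝ 1 χ := hχ.of_le (by exact_mod_cast le_top)
  have hχa := absolutelyContinuousOnInterval_of_contDiff hχ1 a b
  have hdc : Continuous (deriv χ) := hχ1.continuous_deriv le_rfl
  have e1 := hP.integral_mul_deriv_eq_deriv_mul hχa
  have ha : χ a = 0 := image_eq_zero_of_notMem_tsupport fun h => (hs h).1.false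
  have hb : χ b = 0 := image_eq_zero_of_notMem_tsupport fun h => (hs h).2.false
  rw [ha, hb, mul_zero, mul_zero, sub_zero, zero_sub] at e1
  have e2 : ∫ t in a..b, deriv (fun t => ∫ s in a..t, G s) t * χ t = ∫ t in a..b, G t * χ t := by
    refine intervalIntegral.integral_congr_ae ?_
    filter_upwards [hPd] with t h ht
    rw [(h (uIoc_subset_uIcc ht)).deriv]
  have e3 := h χ hχ hc hs
  rw [← integral_Ioc_eq_integral_Ioo, ← integral_Ioc_eq_integral_Ioo,
    ← intervalIntegral.integral_of_le hab.le, ← intervalIntegral.integral_of_le hab.le] at e3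
  simp only [sub_mul]
  rw [intervalIntegral.integral_sub, e3, e1, e2, sub_self]
  · rw [← uIcc_of_le hab.le] at hF
    exact (hF.mul hdc.continuousOn).intervalIntegrable
  · exact (hP.continuousOn.mul hdc.continuousOn).intervalIntegrable

/-- A test function with mean value zero has a primitive that is a test function. -/
lemma exists_test_primitive {ρ : ℝ → ℝ} {a b : ℝ} (hab : a < b)
    (hρ : ContDiff ℝ ((⊤ : ℕ∞) : WithTop ℕ∞) ρ) (hc : HasCompactSupport ρ)
    (hs : tsupport ρ ⊆ Ioo a b) (h0 : ∫ t in a..b, ρ t = 0) :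
    ∃ χ : ℝ → ℝ, ContDiff ℝ ((⊤ : ℕ∞) : WithTop ℕ∞) χ ∧ HasCompactSupport χ ∧
      tsupport χ ⊆ Ioo a b ∧ deriv χ = ρ := by
  have hcont : Continuous ρ := hρ.continuous
  have hd : ∀ t, HasDerivAt (fun t => ∫ s in a..t, ρ s) (ρ t) t := fun t =>
    intervalIntegral.integral_hasDerivAt_right (hcont.intervalIntegrable _ _)
      (hcont.stronglyMeasurableAtFilter _ _) hcont.continuousAt
  have hder : deriv (fun t => ∫ s in a..t, ρ s) = ρ := funext fun t => (hd t).deriv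
  -- an interval strictly inside `(a,b)` that carries the support
  obtain ⟨c, d, hac, hdb, hK⟩ : ∃ c d, a < c ∧ d < b ∧ tsupport ρ ⊆ Icc c d := by
    rcases (tsupport ρ).eq_empty_or_nonempty with he | hne
    · exact ⟨b, a, hab, hab, by simp [he]⟩
    · have hcomp : IsCompact (tsupport ρ) := hc
      exact ⟨sInf (tsupport ρ), sSup (tsupport ρ), (hs (hcomp.sInf_mem hne)).1,
        (hs (hcomp.sSup_mem hne)).2,
        fun t ht => ⟨csInf_le hcomp.bddBelow ht, le_csSup hcomp.bddAbove ht⟩⟩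
  have hz : ∀ t, t ∉ Icc c d → ρ t = 0 := fun t ht =>
    image_eq_zero_of_notMem_tsupport fun h => ht (hK h)
  have hsupp : Function.support (fun t => ∫ s in a..t, ρ s) ⊆ Icc c d := by
    intro t ht
    by_contra hn
    apply ht
    rw [mem_Icc, not_and_or, not_le, not_le] at hn
    rcases hn with hn | hn
    · refine (intervalIntegral.integral_congr (g := fun _ => 0) fun s hs => hz s ?_).trans
        (by simp)
      intro hs'
      have := hs.2
      have h3 := hs'.1
      rcases max_cases a t with h | h <;> linarith [h.1]
    · change ∫ s in a..t, ρ s = 0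
      rw [← intervalIntegral.integral_add_adjacent_intervals
        (hcont.intervalIntegrable a b) (hcont.intervalIntegrable b t), h0, zero_add]
      refine (intervalIntegral.integral_congr (g := fun _ => 0) fun s hs => hz s ?_).trans
        (by simp)
      intro hs'
      have := hs.1
      have h3 := hs'.2
      rcases min_cases b t with h | h <;> linarith [h.1]
  refine ⟨fun t => ∫ s in a..t, ρ s, ?_, HasCompactSupport.of_support_subset_isCompact
    isCompact_Icc hsupp, ?_, hder⟩
  · rw [contDiff_infty_iff_deriv, hder]
    exact ⟨fun t => (hd t).differentiableAt, hρ⟩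
  · refine (closure_minimal hsupp isClosed_Icc).trans fun t ht => ⟨?_, ?_⟩
    · exact hac.trans_le ht.1
    · exact ht.2.trans_lt hdb

/-- The lemma of du Bois-Reymond: a continuous function with integrable weak derivative is the
primitive of that derivative. -/
lemma sub_eq_integral_of_weak_deriv {F G : ℝ → ℝ} {a b : ℝ}
    (hF : ContinuousOn F (Icc a b)) (hG : IntervalIntegrable G volume a b)
    (h : ∀ χ : ℝ → ℝ, ContDiff ℝ ((⊤ : ℕ∞) : WithTop ℕ∞) χ → HasCompactSupport χ →
      tsupport χ ⊆ Ioo a b → ∫ t in Ioo a b, F t * deriv χ t = -∫ t in Ioo a b, G t * χ t)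
    {s t : ℝ} (hs : s ∈ Ioo a b) (ht : t ∈ Ioo a b) :
    F t - F s = ∫ x in s..t, G x := by
  have hab : a < b := hs.1.trans hs.2
  set D : ℝ → ℝ := fun t => F t - ∫ s in a..t, G s with hD
  have hDc : ContinuousOn D (Icc a b) := by
    have := (primitive_facts 0 hG).1.continuousOn
    rw [uIcc_of_le hab.le] at this
    simp only [zero_add] at this
    exact hF.sub this
  have hDi : ∀ ρ : ℝ → ℝ, Continuous ρ → IntervalIntegrable (fun t => D t * ρ t) volume a b := by
    intro ρ hρ
    apply ContinuousOn.intervalIntegrable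
    rw [uIcc_of_le hab.le]
    exact hDc.mul hρ.continuousOn
  -- a normalized bump function inside the interval
  let f : ContDiffBump ((a + b) / 2) := ⟨(b - a) / 8, (b - a) / 4, by linarith, by linarith⟩
  set ρ₀ : ℝ → ℝ := f.normed volume with hρ₀
  have hρ₀c : ContDiff ℝ ((⊤ : ℕ∞) : WithTop ℕ∞) ρ₀ := f.contDiff_normed
  have hρ₀s : tsupport ρ₀ ⊆ Ioo a b := by
    rw [hρ₀, f.tsupport_normed_eq, Real.closedBall_eq_Icc]
    intro x hx
    have h1 := hx.1
    have h2 := hx.2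
    simp only [f] at h1 h2
    constructor <;> linarith
  have hρ₀k : HasCompactSupport ρ₀ := f.hasCompactSupport_normed
  have hint : ∀ ρ : ℝ → ℝ, tsupport ρ ⊆ Ioo a b → ∫ t in a..b, ρ t = ∫ t, ρ t := by
    intro ρ hρ
    rw [intervalIntegral.integral_of_le hab.le]
    refine setIntegral_eq_integral_of_forall_compl_eq_zero fun x hx => ?_
    exact image_eq_zero_of_notMem_tsupport fun h => hx (Ioo_subset_Ioc_self (hρ h))
  have hρ₀i : ∫ t in a..b, ρ₀ t = 1 := by rw [hint ρ₀ hρ₀s]; exact f.integral_normed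
  set c := ∫ t in a..b, D t * ρ₀ t with hc
  have hz : ∀ᵐ x, x ∈ Ioo a b → D x - c = 0 := by
    refine isOpen_Ioo.ae_eq_zero_of_integral_contDiff_smul_eq_zero ?_ ?_
    · exact ((hDc.sub continuousOn_const).mono Ioo_subset_Icc_self).locallyIntegrableOn
        measurableSet_Ioo
    · intro ρ hρ hρk hρs
      set I := ∫ t in a..b, ρ t with hI
      have hcρ := hρ.continuous
      have hcρ₀ := hρ₀c.continuous
      have hsub : tsupport (fun t => ρ t - I * ρ₀ t) ⊆ tsupport ρ ∪ tsupport ρ₀ := by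
        refine (tsupport_sub ρ (fun t => I * ρ₀ t)).trans (union_subset_union_right _ ?_)
        exact tsupport_mul_subset_right
      obtain ⟨χ, hχ, hχk, hχs, hχd⟩ := exists_test_primitive (ρ := fun t => ρ t - I * ρ₀ t) hab
        (hρ.sub (contDiff_const.mul hρ₀c)) (HasCompactSupport.sub hρk hρ₀k.mul_left)
        (hsub.trans (union_subset hρs hρ₀s)) (by
          rw [intervalIntegral.integral_sub (hcρ.intervalIntegrable _ _)
            ((hcρ₀.intervalIntegrable a b).const_mul I),
            intervalIntegral.integral_const_mul, hρ₀i]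
          simp [hI])
      have hz := integral_sub_mul_deriv_eq_zero hab hF hG h hχ hχk hχs
      rw [hχd] at hz
      have hsm : tsupport (fun x => ρ x • (D x - c)) ⊆ Ioo a b :=
        (tsupport_smul_subset_left ρ _).trans hρs
      rw [← hint _ hsm]
      have e1 : ∫ t in a..b, D t * (ρ t - I * ρ₀ t) = (∫ t in a..b, D t * ρ t) - I * c := by
        rw [hc, ← intervalIntegral.integral_const_mul, ← intervalIntegral.integral_sub (hDi ρ hcρ)
          ((hDi ρ₀ hcρ₀).const_mul I)]
        congr 1; ext t; ring
      have e2 : ∫ t in a..b, ρ t • (D t - c) = (∫ t in a..b, D t * ρ t) - I * c := by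
        rw [hI, ← intervalIntegral.integral_mul_const, ← intervalIntegral.integral_sub (hDi ρ hcρ)
          ((hcρ.intervalIntegrable _ _).mul_const c)]
        congr 1; ext t; simp only [smul_eq_mul]; ring
      rw [e2, ← e1]
      exact hz
  have hae : D =ᵐ[volume.restrict (Ioo a b)] fun _ => c := by
    rw [EventuallyEq, ae_restrict_iff' measurableSet_Ioo]
    filter_upwards [hz] with x hx hx'
    linarith [hx hx']
  have heq := Measure.eqOn_open_of_ae_eq hae isOpen_Ioo (hDc.mono Ioo_subset_Icc_self)
    continuousOn_const
  have h1 : D t = c := heq ht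
  have h2 : D s = c := heq hs
  have hGi : ∀ x ∈ Ioo a b, IntervalIntegrable G volume a x := fun x hx =>
    hG.mono_set (by
      rw [uIcc_of_le hx.1.le, uIcc_of_le hab.le]
      exact Icc_subset_Icc_right hx.2.le)
  rw [← intervalIntegral.integral_interval_sub_left (hGi t ht) (hGi s hs)]
  simp only [hD] at h1 h2
  linarith

/-! ### Weak time derivatives and time slices -/

lemma isOpen_timeInterval (T : ℝ≥0∞) : IsOpen (timeInterval T) :=
  isOpen_Ioi.inter (isOpen_Iio.preimage ENNReal.continuous_ofReal)

lemma measurableSet_timeInterval (T : ℝ≥0∞) : MeasurableSet (timeInterval T) :=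
  (isOpen_timeInterval T).measurableSet

lemma Icc_subset_timeInterval {T : ℝ≥0∞} {a b : ℝ} (ha : a ∈ timeInterval T)
    (hb : b ∈ timeInterval T) : Icc a b ⊆ timeInterval T := fun _ ht =>
  ⟨ha.1.trans_le ht.1, (ENNReal.ofReal_le_ofReal ht.2).trans_lt hb.2⟩

lemma timeInterval_subset_closed (T : ℝ≥0∞) : timeInterval T ⊆ closedTimeInterval T :=
  fun _ h => ⟨h.1.le, h.2.le⟩

lemma exists_larger_Icc_subset_timeInterval {T : ℝ≥0∞} {α β : ℝ} (hα : α ∈ timeInterval T)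
    (hβ : β ∈ timeInterval T) : ∃ a b, a < α ∧ β < b ∧ Icc a b ⊆ timeInterval T := by
  obtain ⟨ε, hε, h1⟩ := Metric.isOpen_iff.1 (isOpen_timeInterval T) α hα
  obtain ⟨δ, hδ, h2⟩ := Metric.isOpen_iff.1 (isOpen_timeInterval T) β hβ
  refine ⟨α - ε / 2, β + δ / 2, by linarith, by linarith, Icc_subset_timeInterval (h1 ?_) (h2 ?_)⟩
  · rw [Metric.mem_ball, Real.dist_eq, show α - ε / 2 - α = -(ε / 2) by ring, abs_neg,
      abs_of_pos (by linarith)]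
    linarith
  · rw [Metric.mem_ball, Real.dist_eq, show β + δ / 2 - β = δ / 2 by ring,
      abs_of_pos (by linarith)]
    linarith

section

variable {N : ℕ} {Ω : Set (Sp N)} {T : ℝ≥0∞} {u g : Sp N → ℝ → ℝ}

lemma restrict_prod_eq (A : Set (Sp N)) (I : Set ℝ) :
    (volume : Measure (Sp N × ℝ)).restrict (A ×ˢ I) =
      (volume.restrict A).prod (volume.restrict I) := by
  rw [Measure.volume_eq_prod, Measure.prod_restrict]

lemma MemContL2.exists_eLpNorm_le (h : MemContL2 Ω T u) {a b : ℝ}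
    (hab : Icc a b ⊆ timeInterval T) :
    ∃ C : ℝ≥0∞, C < ⊤ ∧
      ∀ t ∈ Icc a b, eLpNorm (fun x => u x t) 2 (volume.restrict Ω) ≤ C := by
  refine isCompact_Icc.induction_on (p := fun s => ∃ C : ℝ≥0∞, C < ⊤ ∧
    ∀ t ∈ s, eLpNorm (fun x => u x t) 2 (volume.restrict Ω) ≤ C) ⟨0, by simp, by simp⟩ ?_ ?_ ?_
  · rintro s t hst ⟨C, hC, h⟩
    exact ⟨C, hC, fun x hx => h x (hst hx)⟩
  · rintro s t ⟨C, hC, h⟩ ⟨C', hC', h'⟩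
    refine ⟨max C C', max_lt hC hC', fun x hx => ?_⟩
    rcases hx with hx | hx
    · exact (h x hx).trans (le_max_left _ _)
    · exact (h' x hx).trans (le_max_right _ _)
  · intro t ht
    have hsub : Icc a b ⊆ closedTimeInterval T := hab.trans (timeInterval_subset_closed T)
    have htc := hsub ht
    have hev := ((h.tendsto t htc).mono_left (nhdsWithin_mono t hsub)).eventually_le_const
      (zero_lt_one)
    refine ⟨_, (hev.and self_mem_nhdsWithin), 1 + eLpNorm (fun x => u x t) 2 (volume.restrict Ω),
      ENNReal.add_lt_top.2 ⟨by simp, (h.memLp t htc).2⟩, ?_⟩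
    rintro s ⟨hs, hsI⟩
    have hsc := hsub hsI
    have e : (fun x => u x s) = (fun x => u x s - u x t) + fun x => u x t := by
      ext x; simp
    rw [e]
    refine (eLpNorm_add_le ((h.memLp s hsc).1.sub (h.memLp t htc).1) (h.memLp t htc).1
      (by norm_num)).trans ?_
    exact add_le_add hs le_rfl

lemma MemContL2.memLp_two (h : MemContL2 Ω T u)
    (hu : AEMeasurable (fun z : Sp N × ℝ => u z.1 z.2) (volume.restrict (univ ×ˢ timeInterval T)))
    {a b : ℝ} (hab : Icc a b ⊆ timeInterval T) :
    MemLp (fun z : Sp N × ℝ => u z.1 z.2) 2 (volume.restrict (Ω ×ˢ Icc a b)) := by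
  have hm : AEMeasurable (fun z : Sp N × ℝ => u z.1 z.2) (volume.restrict (Ω ×ˢ Icc a b)) :=
    hu.mono_set (prod_mono (subset_univ _) hab)
  refine ⟨hm.aestronglyMeasurable, ?_⟩
  obtain ⟨C, hC, hb⟩ := h.exists_eLpNorm_le hab
  rw [eLpNorm_lt_top_iff_lintegral_rpow_enorm_lt_top (by norm_num) (by norm_num)]
  simp only [ENNReal.toReal_ofNat]
  rw [restrict_prod_eq] at hm ⊢
  rw [lintegral_prod_symm _ (hm.enorm.pow_const _)]
  calc ∫⁻ t in Icc a b, ∫⁻ x in Ω, ‖u x t‖ₑ ^ (2 : ℝ)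
      ≤ ∫⁻ t in Icc a b, C ^ (2 : ℝ) := by
        refine setLIntegral_mono' measurableSet_Icc fun t ht => ?_
        have := hb t ht
        rw [eLpNorm_eq_lintegral_rpow_enorm_toReal (by norm_num) (by norm_num)] at this
        simp only [ENNReal.toReal_ofNat] at this
        have h2 := ENNReal.rpow_le_rpow this (z := 2) (by norm_num)
        rwa [← ENNReal.rpow_mul, one_div, inv_mul_cancel₀ (by norm_num), ENNReal.rpow_one] at h2
    _ < ⊤ := by
        rw [setLIntegral_const]
        exact ENNReal.mul_lt_top (ENNReal.rpow_lt_top_of_nonneg (by norm_num) hC.ne) (by simp)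

lemma isFiniteMeasure_restrict_of_isBounded (hΩ : Bornology.IsBounded Ω) :
    IsFiniteMeasure ((volume : Measure (Sp N)).restrict Ω) :=
  ⟨by rw [Measure.restrict_apply_univ]; exact hΩ.measure_lt_top⟩

lemma integrableOn_of_memLp_two (hΩ : Bornology.IsBounded Ω) {f : Sp N × ℝ → ℝ} {a b : ℝ}
    (hf : MemLp f 2 (volume.restrict (Ω ×ˢ Icc a b))) : IntegrableOn f (Ω ×ˢ Icc a b) := by
  have := isFiniteMeasure_restrict_of_isBounded hΩ
  have : IsFiniteMeasure ((volume : Measure (Sp N × ℝ)).restrict (Ω ×ˢ Icc a b)) := by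
    rw [restrict_prod_eq]; infer_instance
  exact hf.integrable (by norm_num)

lemma IsWeakTimeDerivL2.memLp_two_Icc (hg : IsWeakTimeDerivL2 Ω T u g) {a b : ℝ}
    (hab : Icc a b ⊆ timeInterval T) :
    MemLp (fun z : Sp N × ℝ => g z.1 z.2) 2 (volume.restrict (Ω ×ˢ Icc a b)) :=
  hg.memLp.mono_measure (Measure.restrict_mono (prod_mono_right hab) le_rfl)

/-- Pairings of `u(·,t)` with a bounded function depend continuously on the time. -/
lemma MemContL2.continuousOn_integral_mul (hΩ : Bornology.IsBounded Ω) (h : MemContL2 Ω T u)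
    {ξ : Sp N → ℝ} (hξ : Continuous ξ) (hξc : HasCompactSupport ξ) {a b : ℝ}
    (hab : Icc a b ⊆ timeInterval T) :
    ContinuousOn (fun t => ∫ x in Ω, ξ x * u x t) (Icc a b) := by
  have := isFiniteMeasure_restrict_of_isBounded hΩ
  have hξ2 : MemLp ξ 2 (volume.restrict Ω) :=
    (hξ.memLp_of_hasCompactSupport hξc).restrict Ω
  have hsub : Icc a b ⊆ closedTimeInterval T := hab.trans (timeInterval_subset_closed T)
  intro t ht
  have hint : ∀ s ∈ Icc a b, Integrable (fun x => ξ x * u x s) (volume.restrict Ω) := fun s hs =>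
    hξ2.integrable_mul (h.memLp s (hsub hs))
  rw [ContinuousWithinAt, tendsto_iff_edist_tendsto_0]
  have hlim : Tendsto (fun s => eLpNorm ξ 2 (volume.restrict Ω) *
      eLpNorm (fun x => u x s - u x t) 2 (volume.restrict Ω)) (𝓝[Icc a b] t) (𝓝 0) := by
    have := ENNReal.Tendsto.const_mul ((h.tendsto t (hsub ht)).mono_left (nhdsWithin_mono t hsub))
      (Or.inr hξ2.2.ne)
    rwa [mul_zero] at this
  refine tendsto_of_tendsto_of_tendsto_of_le_of_le' tendsto_const_nhds hlim
    (Eventually.of_forall fun _ => zero_le) ?_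
  filter_upwards [self_mem_nhdsWithin] with s hs
  rw [edist_eq_enorm_sub, ← integral_sub (hint s hs) (hint t ht)]
  refine (enorm_integral_le_lintegral_enorm _).trans ?_
  rw [← eLpNorm_one_eq_lintegral_enorm]
  have h3 := eLpNorm_smul_le_mul_eLpNorm (p := 2) (q := 2) (r := 1) (μ := volume.restrict Ω)
    ((h.memLp s (hsub hs)).1.sub (h.memLp t (hsub ht)).1) hξ2.1
  refine le_trans (le_of_eq ?_) h3
  congr 1; ext x; simp [mul_sub]

lemma tsupport_mul_prod_subset {ξ : Sp N → ℝ} {χ : ℝ → ℝ} :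
    tsupport (fun z : Sp N × ℝ => ξ z.1 * χ z.2) ⊆ tsupport ξ ×ˢ tsupport χ := by
  refine closure_minimal (fun z hz => ?_) ((isClosed_tsupport ξ).prod (isClosed_tsupport χ))
  have h := mul_ne_zero_iff.1 hz
  exact ⟨subset_tsupport _ h.1, subset_tsupport _ h.2⟩

/-- The weak derivative tested with a product `ξ(x) χ(t)`. -/
lemma IsWeakTimeDerivL2.integral_mul_test (hg : IsWeakTimeDerivL2 Ω T u g)
    (hΩm : MeasurableSet Ω) {a b : ℝ}
    (hab : Icc a b ⊆ timeInterval T)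
    (hui : IntegrableOn (fun z : Sp N × ℝ => u z.1 z.2) (Ω ×ˢ Icc a b))
    (hgi : IntegrableOn (fun z : Sp N × ℝ => g z.1 z.2) (Ω ×ˢ Icc a b))
    {ξ : Sp N → ℝ} (hξ : ContDiff ℝ ((⊤ : ℕ∞) : WithTop ℕ∞) ξ) (hξc : HasCompactSupport ξ)
    (hξs : tsupport ξ ⊆ Ω) {χ : ℝ → ℝ} (hχ : ContDiff ℝ ((⊤ : ℕ∞) : WithTop ℕ∞) χ)
    (hχc : HasCompactSupport χ) (hχs : tsupport χ ⊆ Ioo a b) :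
    ∫ t in Ioo a b, (∫ x in Ω, ξ x * u x t) * deriv χ t =
      -∫ t in Ioo a b, (∫ x in Ω, ξ x * g x t) * χ t := by
  have hIoo : Ioo a b ⊆ timeInterval T := Ioo_subset_Icc_self.trans hab
  have hts := tsupport_mul_prod_subset (ξ := ξ) (χ := χ)
  have hcomp : HasCompactSupport (fun z : Sp N × ℝ => ξ z.1 * χ z.2) :=
    IsCompact.of_isClosed_subset (hξc.isCompact.prod hχc.isCompact) (isClosed_tsupport _) hts
  have h := hg.integral_eq (fun z => ξ z.1 * χ z.2)
    ((hξ.comp contDiff_fst).mul (hχ.comp contDiff_snd)) hcomp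
    (hts.trans (prod_mono hξs (hχs.trans hIoo)))
  have hd : ∀ z : Sp N × ℝ, deriv (fun t => ξ z.1 * χ t) z.2 = ξ z.1 * deriv χ z.2 := fun z =>
    deriv_const_mul _ ((hχ.differentiable (by simp)).differentiableAt)
  simp only [hd] at h
  have hχ1 : ContDiff ℝ 1 χ := hχ.of_le (by exact_mod_cast le_top)
  have hdχ : Continuous (deriv χ) := hχ1.continuous_deriv le_rfl
  have hred : ∀ (f : Sp N → ℝ → ℝ) (κ : ℝ → ℝ), Continuous κ → HasCompactSupport κ →
      tsupport κ ⊆ Ioo a b →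
      IntegrableOn (fun z : Sp N × ℝ => f z.1 z.2) (Ω ×ˢ Icc a b) →
      ∫ z in Ω ×ˢ timeInterval T, f z.1 z.2 * (ξ z.1 * κ z.2) =
        ∫ t in Ioo a b, (∫ x in Ω, ξ x * f x t) * κ t := by
    intro f κ hκ hκc hκs hf
    rw [setIntegral_eq_of_subset_of_forall_sdiff_eq_zero
      (hΩm.prod (measurableSet_timeInterval T)) (prod_mono_right hIoo)]
    · have hfi : IntegrableOn (fun z : Sp N × ℝ => f z.1 z.2) (Ω ×ˢ Ioo a b) :=
        hf.mono_set (prod_mono_right Ioo_subset_Icc_self)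
      have hm : Integrable (fun z : Sp N × ℝ => f z.1 z.2 * (ξ z.1 * κ z.2))
          (volume.restrict (Ω ×ˢ Ioo a b)) := by
        obtain ⟨C, hC⟩ := hξ.continuous.bounded_above_of_compact_support hξc
        obtain ⟨D, hD⟩ := hκ.bounded_above_of_compact_support hκc
        refine Integrable.mul_bdd (c := C * D) hfi ?_ ?_
        · exact ((hξ.continuous.comp continuous_fst).mul
            (hκ.comp continuous_snd)).aestronglyMeasurable
        · refine ae_of_all _ fun z => ?_
          rw [norm_mul]
          exact mul_le_mul (hC _) (hD _) (norm_nonneg _) ((norm_nonneg _).trans (hC z.1))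
      rw [restrict_prod_eq] at hm ⊢
      rw [integral_prod_symm _ hm]
      congr 1; ext t
      rw [← integral_mul_const]
      congr 1; ext x; ring
    · intro z hz
      have : κ z.2 = 0 := image_eq_zero_of_notMem_tsupport fun hz2 => hz.2 ⟨hz.1.1, hκs hz2⟩
      simp [this]
  rw [hred u (deriv χ) hdχ hχc.deriv ((tsupport_deriv_subset (𝕜 := ℝ)).trans hχs) hui,
    hred g χ hχ.continuous hχc hχs hgi] at h
  exact h

/-- A function with weak time derivative `g` is, between any two times and for almost every `x`,
the integral of `g` in time. The exceptional null set depends on the two times. -/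
lemma IsWeakTimeDerivL2.ae_sub_eq_integral (hΩo : IsOpen Ω) (hΩ : Bornology.IsBounded Ω)
    (hg : IsWeakTimeDerivL2 Ω T u g) (hc : MemContL2 Ω T u)
    (hu : AEMeasurable (fun z : Sp N × ℝ => u z.1 z.2) (volume.restrict (univ ×ˢ timeInterval T)))
    {s t : ℝ} (hs : s ∈ timeInterval T) (ht : t ∈ timeInterval T) (hst : s ≤ t) :
    ∀ᵐ x ∂(volume.restrict Ω), u x t - u x s = ∫ τ in s..t, g x τ := by
  obtain ⟨a, b, has, htb, hab⟩ := exists_larger_Icc_subset_timeInterval hs ht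
  have hfin := isFiniteMeasure_restrict_of_isBounded hΩ
  have hab' : a ≤ b := by linarith
  have hui := integrableOn_of_memLp_two hΩ (hc.memLp_two hu hab)
  have hgi := integrableOn_of_memLp_two hΩ (hg.memLp_two_Icc hab)
  have hgst : Integrable (fun z : Sp N × ℝ => g z.1 z.2)
      ((volume.restrict Ω).prod (volume.restrict (Ioc s t))) := by
    rw [← restrict_prod_eq]
    exact hgi.mono_set (prod_mono_right (Ioc_subset_Icc_self.trans (Icc_subset_Icc has.le htb.le)))
  have hcl := timeInterval_subset_closed T
  have hut : ∀ r ∈ timeInterval T, Integrable (fun x => u x r) (volume.restrict Ω) := fun r hr =>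
    (hc.memLp r (hcl hr)).integrable (by norm_num)
  have hGint : Integrable (fun x => ∫ τ in s..t, g x τ) (volume.restrict Ω) := by
    simp_rw [intervalIntegral.integral_of_le hst]
    exact hgst.integral_prod_left
  have hDint : Integrable (fun x => u x t - u x s - ∫ τ in s..t, g x τ) (volume.restrict Ω) :=
    ((hut t ht).sub (hut s hs)).sub hGint
  have key : ∀ᵐ x, x ∈ Ω → u x t - u x s - ∫ τ in s..t, g x τ = 0 := by
    refine hΩo.ae_eq_zero_of_integral_contDiff_smul_eq_zero ?_ ?_
    · exact IntegrableOn.locallyIntegrableOn hDint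
    · intro ξ hξ hξc hξs
      obtain ⟨C, hC⟩ := hξ.continuous.bounded_above_of_compact_support hξc
      have hbdd : ∀ f : Sp N → ℝ, Integrable f (volume.restrict Ω) →
          Integrable (fun x => ξ x * f x) (volume.restrict Ω) := fun f hf =>
        hf.bdd_mul hξ.continuous.aestronglyMeasurable (ae_of_all _ hC)
      have hgξ : ∀ I : Set ℝ, IntegrableOn (fun z : Sp N × ℝ => g z.1 z.2) (Ω ×ˢ I) →
          Integrable (fun z : Sp N × ℝ => ξ z.1 * g z.1 z.2)
            ((volume.restrict Ω).prod (volume.restrict I)) := fun I hI => by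
        rw [← restrict_prod_eq]
        exact Integrable.bdd_mul (c := C) hI
          (hξ.continuous.comp continuous_fst).aestronglyMeasurable (ae_of_all _ fun z => hC z.1)
      have hGi : IntervalIntegrable (fun t => ∫ x in Ω, ξ x * g x t) volume a b := by
        rw [intervalIntegrable_iff_integrableOn_Icc_of_le hab']
        exact (hgξ _ hgi).integral_prod_right
      have h1 := sub_eq_integral_of_weak_deriv
        (hc.continuousOn_integral_mul hΩ hξ.continuous hξc hab) hGi
        (fun χ hχ hχc hχs => hg.integral_mul_test hΩo.measurableSet hab hui hgi hξ hξc hξs hχ hχc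
          hχs) (s := s) (t := t) ⟨has, by linarith⟩ ⟨by linarith, htb⟩
      have h2 : ∫ τ in s..t, ∫ x in Ω, ξ x * g x τ = ∫ x in Ω, ξ x * ∫ τ in s..t, g x τ := by
        rw [intervalIntegral.integral_of_le hst]
        have hI : Integrable (Function.uncurry fun x τ => ξ x * g x τ)
            ((volume.restrict Ω).prod (volume.restrict (Ioc s t))) := by
          refine hgξ _ ?_
          rw [IntegrableOn, restrict_prod_eq]; exact hgst
        rw [← integral_integral_swap hI]
        congr 1; ext x
        rw [intervalIntegral.integral_of_le hst, integral_const_mul]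
      have hzero : ∀ x, x ∉ Ω → ξ x • (u x t - u x s - ∫ τ in s..t, g x τ) = 0 := fun x hx => by
        rw [image_eq_zero_of_notMem_tsupport fun h => hx (hξs h), zero_smul]
      rw [← setIntegral_eq_integral_of_forall_compl_eq_zero hzero]
      have e : ∀ x, ξ x • (u x t - u x s - ∫ τ in s..t, g x τ) =
          ξ x * u x t - ξ x * u x s - ξ x * ∫ τ in s..t, g x τ := fun x => by
        rw [smul_eq_mul]; ring
      simp_rw [e]
      have hts : Integrable (fun x => ξ x * u x t - ξ x * u x s) (volume.restrict Ω) :=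
        (hbdd _ (hut t ht)).sub (hbdd _ (hut s hs))
      rw [integral_sub hts (hbdd _ hGint),
        integral_sub (hbdd _ (hut t ht)) (hbdd _ (hut s hs)), h1, h2, sub_self]
  rw [ae_restrict_iff' hΩo.measurableSet]
  filter_upwards [key] with x h hx
  linarith [h hx]

/-- The primitive in time of a jointly integrable function is jointly measurable. -/
lemma aestronglyMeasurable_primitive {a b : ℝ}
    (hg : Integrable (fun z : Sp N × ℝ => g z.1 z.2)
      ((volume.restrict Ω).prod (volume.restrict (Icc a b)))) :
    AEStronglyMeasurable (fun z : Sp N × ℝ => ∫ s in a..z.2, g z.1 s)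
      ((volume.restrict Ω).prod (volume.restrict (Icc a b))) := by
  set g' := hg.1.mk _ with hg'
  have hg'm : StronglyMeasurable g' := hg.1.stronglyMeasurable_mk
  have hslice := Measure.ae_ae_of_ae_prod hg.1.ae_eq_mk
  have hJm : StronglyMeasurable fun z : Sp N × ℝ =>
      ∫ s, (Ioc a z.2).indicator (fun s => g' (z.1, s)) s := by
    have hset : MeasurableSet {p : (Sp N × ℝ) × ℝ | a < p.2 ∧ p.2 ≤ p.1.2} :=
      (measurableSet_lt measurable_const measurable_snd).inter
        (measurableSet_le measurable_snd (measurable_snd.comp measurable_fst))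
    have hf : StronglyMeasurable ({p : (Sp N × ℝ) × ℝ | a < p.2 ∧ p.2 ≤ p.1.2}.indicator
        fun p => g' (p.1.1, p.2)) :=
      (hg'm.comp_measurable ((measurable_fst.comp measurable_fst).prodMk
        measurable_snd)).indicator hset
    exact hf.integral_prod_right'
  refine ⟨_, hJm, ?_⟩
  have h1 : ∀ᵐ z ∂((volume.restrict Ω).prod (volume.restrict (Icc a b))),
      ∀ᵐ s ∂(volume.restrict (Icc a b)), g z.1 s = g' (z.1, s) :=
    Measure.quasiMeasurePreserving_fst.ae hslice
  have h2 : ∀ᵐ z ∂((volume.restrict Ω).prod (volume.restrict (Icc a b))), z.2 ∈ Icc a b :=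
    Measure.quasiMeasurePreserving_snd.ae (ae_restrict_mem measurableSet_Icc)
  filter_upwards [h1, h2] with z hz1 hz2
  rw [integral_indicator measurableSet_Ioc, intervalIntegral.integral_of_le hz2.1]
  refine integral_congr_ae ?_
  exact ae_restrict_of_ae_restrict_of_subset
    (Ioc_subset_Icc_self.trans (Icc_subset_Icc_right hz2.2)) hz1

/-- For almost every `x`, the function `u(x,·)` agrees almost everywhere with the primitive of its
weak time derivative. -/
lemma IsWeakTimeDerivL2.ae_slice (hΩo : IsOpen Ω) (hΩ : Bornology.IsBounded Ω)
    (hg : IsWeakTimeDerivL2 Ω T u g) (hc : MemContL2 Ω T u)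
    (hu : AEMeasurable (fun z : Sp N × ℝ => u z.1 z.2) (volume.restrict (univ ×ˢ timeInterval T)))
    {a b : ℝ} (hab' : a ≤ b) (hab : Icc a b ⊆ timeInterval T) :
    ∀ᵐ x ∂(volume.restrict Ω), IntervalIntegrable (g x) volume a b ∧
      ∀ᵐ t ∂(volume.restrict (Icc a b)), u x t = u x a + ∫ s in a..t, g x s := by
  have hfin := isFiniteMeasure_restrict_of_isBounded hΩ
  have ha : a ∈ timeInterval T := hab (left_mem_Icc.2 hab')
  have hui := integrableOn_of_memLp_two hΩ (hc.memLp_two hu hab)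
  have hgi := integrableOn_of_memLp_two hΩ (hg.memLp_two_Icc hab)
  rw [IntegrableOn, restrict_prod_eq] at hui hgi
  have hua : AEStronglyMeasurable (fun z : Sp N × ℝ => u z.1 a)
      ((volume.restrict Ω).prod (volume.restrict (Icc a b))) :=
    (hc.memLp a (timeInterval_subset_closed T ha)).1.comp_fst
  set E : Sp N × ℝ → ℝ := fun z => u z.1 z.2 - (u z.1 a + ∫ s in a..z.2, g z.1 s) with hE
  have hEm : AEStronglyMeasurable E ((volume.restrict Ω).prod (volume.restrict (Icc a b))) :=
    hui.1.sub (hua.add (aestronglyMeasurable_primitive hgi))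
  have hz : ∫⁻ z, ‖E z‖ₑ ∂((volume.restrict Ω).prod (volume.restrict (Icc a b))) = 0 := by
    rw [lintegral_prod_symm _ hEm.aemeasurable.enorm]
    refine (setLIntegral_congr_fun measurableSet_Icc (g := fun _ => 0) fun t ht => ?_).trans
      (by simp)
    have h := hg.ae_sub_eq_integral hΩo hΩ hc hu ha (hab ht) ht.1
    rw [← lintegral_zero (μ := volume.restrict Ω)]
    refine lintegral_congr_ae ?_
    filter_upwards [h] with x hx
    simp only [hE, ← hx]
    simp
  rw [lintegral_eq_zero_iff' hEm.aemeasurable.enorm] at hz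
  filter_upwards [Measure.ae_ae_of_ae_prod hz, hgi.prod_right_ae] with x hx hgx
  refine ⟨(intervalIntegrable_iff_integrableOn_Icc_of_le hab').2 hgx, ?_⟩
  filter_upwards [hx] with t ht
  have : E (x, t) = 0 := by simpa using ht
  simp only [hE] at this
  linarith

lemma hasDerivAt_slice {Φ : Sp N × ℝ → ℝ} (hΦ : Differentiable ℝ Φ) (x : Sp N) (t : ℝ) :
    HasDerivAt (fun t => Φ (x, t)) (fderiv ℝ Φ (x, t) (0, 1)) t :=
  (hΦ (x, t)).hasFDerivAt.comp_hasDerivAt t ((hasDerivAt_const t x).prodMk (hasDerivAt_id t))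

/-- A test function on `Ω × (0,T)` lives on a compact time interval. -/
lemma exists_time_support {Φ : Sp N × ℝ → ℝ} (hc : HasCompactSupport Φ)
    (hs : tsupport Φ ⊆ Ω ×ˢ timeInterval T) (hne : (tsupport Φ).Nonempty) :
    ∃ a b : ℝ, a < b ∧ Icc a b ⊆ timeInterval T ∧
      tsupport Φ ⊆ univ ×ˢ Ioo a b := by
  have hK : IsCompact (Prod.snd '' tsupport Φ) := hc.isCompact.image continuous_snd
  have hne' : (Prod.snd '' tsupport Φ).Nonempty := hne.image _
  have hsub : Prod.snd '' tsupport Φ ⊆ timeInterval T := by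
    rintro _ ⟨z, hz, rfl⟩
    exact (hs hz).2
  obtain ⟨a, b, ha, hb, hab⟩ := exists_larger_Icc_subset_timeInterval
    (hsub (hK.sInf_mem hne')) (hsub (hK.sSup_mem hne'))
  have h1 : ∀ z ∈ tsupport Φ, a < z.2 ∧ z.2 < b := fun z hz =>
    ⟨ha.trans_le (csInf_le hK.bddBelow (mem_image_of_mem _ hz)),
      (le_csSup hK.bddAbove (mem_image_of_mem _ hz)).trans_lt hb⟩
  obtain ⟨z, hz⟩ := hne
  exact ⟨a, b, (h1 z hz).1.trans (h1 z hz).2, hab, fun z hz => ⟨mem_univ _, h1 z hz⟩⟩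

/-- A function whose time slices are absolutely continuous with derivative `G ∈ L²` has the weak
time derivative `G`. -/
lemma isWeakTimeDerivL2_of_slices (hΩm : MeasurableSet Ω) (hΩ : Bornology.IsBounded Ω)
    {P G : Sp N → ℝ → ℝ}
    (hG : MemLp (fun z : Sp N × ℝ => G z.1 z.2) 2 (volume.restrict (Ω ×ˢ timeInterval T)))
    (hP : ∀ a b : ℝ, Icc a b ⊆ timeInterval T →
      IntegrableOn (fun z : Sp N × ℝ => P z.1 z.2) (Ω ×ˢ Icc a b))
    (hslice : ∀ a b : ℝ, a ≤ b → Icc a b ⊆ timeInterval T → ∀ᵐ x ∂(volume.restrict Ω),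
      ∃ Q : ℝ → ℝ, AbsolutelyContinuousOnInterval Q a b ∧
        (∀ᵐ t ∂(volume.restrict (Icc a b)), P x t = Q t) ∧
        ∀ᵐ t, t ∈ uIcc a b → HasDerivAt Q (G x t) t) :
    IsWeakTimeDerivL2 Ω T P G := by
  refine ⟨hG, fun Φ hΦ hΦc hΦs => ?_⟩
  rcases (tsupport Φ).eq_empty_or_nonempty with he | hne
  · have : Φ = 0 := tsupport_eq_empty_iff.1 he
    simp [this]
  obtain ⟨a, b, hab', hab, hsupp⟩ := exists_time_support hΦc hΦs hne
  have hΦ1 : ContDiff ℝ 1 Φ := hΦ.of_le (by exact_mod_cast le_top)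
  have hdiff : Differentiable ℝ Φ := hΦ1.differentiable (by simp)
  have hd : ∀ x t, deriv (fun t => Φ (x, t)) t = fderiv ℝ Φ (x, t) (0, 1) := fun x t =>
    (hasDerivAt_slice hdiff x t).deriv
  simp only [hd]
  have hfc : Continuous (fderiv ℝ Φ) := hΦ1.continuous_fderiv (by simp)
  have hz0 : ∀ z : Sp N × ℝ, z.2 ∉ Ioo a b → z ∉ tsupport Φ := fun z hz h => hz (hsupp h).2
  have hzΦ : ∀ z : Sp N × ℝ, z.2 ∉ Ioo a b → Φ z = 0 := fun z hz =>
    image_eq_zero_of_notMem_tsupport (hz0 z hz)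
  have hzd : ∀ z : Sp N × ℝ, z.2 ∉ Ioo a b → fderiv ℝ Φ z = 0 := fun z hz =>
    image_eq_zero_of_notMem_tsupport fun h => hz0 z hz (tsupport_fderiv_subset ℝ h)
  have hred : ∀ f : Sp N × ℝ → ℝ, (∀ z, z.2 ∉ Ioo a b → f z = 0) →
      ∫ z in Ω ×ˢ timeInterval T, f z = ∫ z in Ω ×ˢ Icc a b, f z := fun f hf => by
    refine setIntegral_eq_of_subset_of_forall_sdiff_eq_zero
      (hΩm.prod (measurableSet_timeInterval T)) (prod_mono_right hab) fun z hz => hf z fun h => ?_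
    exact hz.2 ⟨hz.1.1, Ioo_subset_Icc_self h⟩
  rw [hred _ fun z hz => by simp [hzd z hz], hred _ fun z hz => by simp [hzΦ z hz]]
  have hPi := hP a b hab
  have hGi := integrableOn_of_memLp_two hΩ
    (hG.mono_measure (Measure.restrict_mono (prod_mono_right hab) le_rfl))
  have hPΦ : IntegrableOn (fun z : Sp N × ℝ => P z.1 z.2 * fderiv ℝ Φ (z.1, z.2) (0, 1))
      (Ω ×ˢ Icc a b) := by
    obtain ⟨C, hC⟩ := hfc.bounded_above_of_compact_support (hΦc.fderiv ℝ)
    refine Integrable.mul_bdd (c := C * ‖((0 : Sp N), (1 : ℝ))‖) hPi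
      (hfc.clm_apply continuous_const).aestronglyMeasurable (ae_of_all _ fun z => ?_)
    exact (ContinuousLinearMap.le_opNorm _ _).trans
      (mul_le_mul_of_nonneg_right (hC _) (norm_nonneg _))
  have hGΦ : IntegrableOn (fun z : Sp N × ℝ => G z.1 z.2 * Φ z) (Ω ×ˢ Icc a b) := by
    obtain ⟨C, hC⟩ := hΦ.continuous.bounded_above_of_compact_support hΦc
    exact Integrable.mul_bdd (c := C) hGi hΦ.continuous.aestronglyMeasurable (ae_of_all _ hC)
  rw [← add_eq_zero_iff_eq_neg, ← integral_add hPΦ hGΦ]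
  have hsum : IntegrableOn (fun z : Sp N × ℝ =>
      P z.1 z.2 * fderiv ℝ Φ (z.1, z.2) (0, 1) + G z.1 z.2 * Φ z) (Ω ×ˢ Icc a b) :=
    hPΦ.add hGΦ
  rw [IntegrableOn, restrict_prod_eq] at hsum
  rw [restrict_prod_eq, integral_prod _ hsum]
  refine (integral_congr_ae (g := fun _ => 0) ?_).trans (by simp)
  filter_upwards [hslice a b hab'.le hab] with x hx
  obtain ⟨Q, hQ, hPQ, hQd⟩ := hx
  have hΦx : ContDiff ℝ 1 fun t => Φ (x, t) := hΦ1.comp (contDiff_const.prodMk contDiff_id)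
  have hAC := hQ.fun_mul (absolutelyContinuousOnInterval_of_contDiff hΦx a b)
  have hder : ∀ᵐ t, t ∈ uIcc a b → HasDerivAt (fun t => Q t * Φ (x, t))
      (G x t * Φ (x, t) + Q t * fderiv ℝ Φ (x, t) (0, 1)) t := by
    filter_upwards [hQd] with t h ht
    exact (h ht).mul (hasDerivAt_slice hdiff x t)
  have h0 := integral_eq_sub_of_absolutelyContinuous hAC hder
  rw [hzΦ (x, a) (by simp), hzΦ (x, b) (by simp), mul_zero, mul_zero, sub_zero,
    intervalIntegral.integral_of_le hab'.le, ← integral_Icc_eq_integral_Ioc] at h0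
  rw [← h0]
  refine integral_congr_ae ?_
  filter_upwards [hPQ] with t ht
  rw [ht]; ring

lemma isWeakTimeDerivL2_const (hΩm : MeasurableSet Ω) (hΩ : Bornology.IsBounded Ω)
    {u₀ : Sp N → ℝ} (hu₀ : MemLp u₀ 2 (volume.restrict Ω)) :
    IsWeakTimeDerivL2 Ω T (fun x _ => u₀ x) fun _ _ => 0 := by
  have hfin := isFiniteMeasure_restrict_of_isBounded hΩ
  refine isWeakTimeDerivL2_of_slices hΩm hΩ (MemLp.zero') (fun a b _ => ?_) fun a b _ _ => ?_
  · rw [IntegrableOn, restrict_prod_eq]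
    exact (hu₀.integrable (by norm_num)).comp_fst _
  · refine ae_of_all _ fun x => ⟨fun _ => u₀ x, absolutelyContinuousOnInterval_const _ _ _,
      ae_of_all _ fun _ => rfl, ae_of_all _ fun t _ => hasDerivAt_const t _⟩

end

/-! ### The comparison map -/

/-- The comparison map `u - ψ(t) ζ(x) (u - k)₊`. -/
def testMap {N : ℕ} (ζ : Sp N → ℝ) (ψ : ℝ → ℝ) (k : ℝ) (u : Sp N → ℝ → ℝ) : Sp N → ℝ → ℝ :=
  fun x t => u x t - ψ t * ζ x * truncation u k x t

open Classical in
/-- The time derivative of the comparison map, where `g` is that of `u`. -/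
noncomputable def testDeriv {N : ℕ} (ζ : Sp N → ℝ) (ψ : ℝ → ℝ) (k : ℝ) (u g : Sp N → ℝ → ℝ) :
    Sp N → ℝ → ℝ :=
  fun x t => g x t - ζ x * (deriv ψ t * truncation u k x t +
    ψ t * (if k < u x t then g x t else 0))

lemma truncation_nonneg {N : ℕ} (u : Sp N → ℝ → ℝ) (k : ℝ) (x : Sp N) (t : ℝ) :
    0 ≤ truncation u k x t := le_max_right _ _

/-- The admissible time cutoffs: `C¹`, with values in `[0,1]` and support in `[α,β]`. -/
structure IsTimeCutoff (α β : ℝ) (ψ : ℝ → ℝ) : Prop where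
  contDiff : ContDiff ℝ 1 ψ
  nonneg : ∀ t, 0 ≤ ψ t
  le_one : ∀ t, ψ t ≤ 1
  eq_zero : ∀ t, t ∉ Ioo α β → ψ t = 0

lemma IsTimeCutoff.deriv_eq_zero {α β : ℝ} {ψ : ℝ → ℝ} (h : IsTimeCutoff α β ψ) {t : ℝ}
    (ht : t ∉ Icc α β) : deriv ψ t = 0 := by
  have : ψ =ᶠ[𝓝 t] fun _ => 0 := by
    filter_upwards [isClosed_Icc.isOpen_compl.mem_nhds ht] with s hs
    exact h.eq_zero s fun hs' => hs (Ioo_subset_Icc_self hs')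
  rw [this.deriv_eq, deriv_const]

lemma IsTimeCutoff.continuous_deriv {α β : ℝ} {ψ : ℝ → ℝ} (h : IsTimeCutoff α β ψ) :
    Continuous (deriv ψ) := h.contDiff.continuous_deriv le_rfl

lemma IsTimeCutoff.exists_deriv_bound {α β : ℝ} {ψ : ℝ → ℝ} (h : IsTimeCutoff α β ψ) :
    ∃ C, 0 ≤ C ∧ ∀ t, |deriv ψ t| ≤ C := by
  obtain ⟨C, hC⟩ := isCompact_Icc.exists_bound_of_continuousOn
    (h.continuous_deriv.continuousOn (s := Icc α β))
  refine ⟨max C 0, le_max_right _ _, fun t => ?_⟩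
  by_cases ht : t ∈ Icc α β
  · exact (hC t ht).trans (le_max_left _ _)
  · rw [h.deriv_eq_zero ht, abs_zero]; exact le_max_right _ _

section

variable {N : ℕ} {Ω : Set (Sp N)} {T : ℝ≥0∞} {u g : Sp N → ℝ → ℝ} {ζ : Sp N → ℝ} {ψ : ℝ → ℝ}
  {k α β : ℝ}

lemma memLp_truncation (hΩ : Bornology.IsBounded Ω) {a b : ℝ}
    (h : MemLp (fun z : Sp N × ℝ => u z.1 z.2) 2 (volume.restrict (Ω ×ˢ Icc a b))) :
    MemLp (fun z : Sp N × ℝ => truncation u k z.1 z.2) 2 (volume.restrict (Ω ×ˢ Icc a b)) := by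
  have := isFiniteMeasure_restrict_of_isBounded hΩ
  have : IsFiniteMeasure ((volume : Measure (Sp N × ℝ)).restrict (Ω ×ˢ Icc a b)) := by
    rw [restrict_prod_eq]; infer_instance
  exact (h.sub (memLp_const k)).pos_part

/-- Extension by zero in time of a function that is square integrable on a compact interval. -/
lemma memLp_timeInterval_of_eq_zero (hΩm : MeasurableSet Ω) {f : Sp N × ℝ → ℝ}
    (hαβ : Icc α β ⊆ timeInterval T)
    (hf : MemLp f 2 (volume.restrict (Ω ×ˢ Icc α β))) (h0 : ∀ z, z.2 ∉ Icc α β → f z = 0) :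
    MemLp f 2 (volume.restrict (Ω ×ˢ timeInterval T)) := by
  have hset : MeasurableSet (Ω ×ˢ Icc α β) := hΩm.prod measurableSet_Icc
  have h1 : MemLp ((Ω ×ˢ Icc α β).indicator f) 2 (volume.restrict (Ω ×ˢ timeInterval T)) := by
    rw [memLp_indicator_iff_restrict hset, Measure.restrict_restrict hset,
      inter_eq_self_of_subset_left (prod_mono_right hαβ)]
    exact hf
  refine h1.ae_eq ?_
  filter_upwards [ae_restrict_mem (hΩm.prod (measurableSet_timeInterval T))] with z hz
  by_cases hz2 : z.2 ∈ Icc α β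
  · exact indicator_of_mem (show z ∈ Ω ×ˢ Icc α β from ⟨hz.1, hz2⟩) _
  · rw [indicator_of_notMem (fun h => hz2 h.2), h0 z hz2]

lemma memLp_testDeriv (hΩm : MeasurableSet Ω) (hΩ : Bornology.IsBounded Ω)
    (hg : IsWeakTimeDerivL2 Ω T u g) (hc : MemContL2 Ω T u)
    (hu : AEMeasurable (fun z : Sp N × ℝ => u z.1 z.2) (volume.restrict (univ ×ˢ timeInterval T)))
    (hζ : Measurable ζ) (hζ0 : ∀ x, 0 ≤ ζ x) (hζ1 : ∀ x, ζ x ≤ 1)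
    (hαβ : Icc α β ⊆ timeInterval T) (hψ : IsTimeCutoff α β ψ) :
    MemLp (fun z : Sp N × ℝ => testDeriv ζ ψ k u g z.1 z.2) 2
      (volume.restrict (Ω ×ˢ timeInterval T)) := by
  obtain ⟨C, hC0, hC⟩ := hψ.exists_deriv_bound
  have hu' : AEMeasurable (fun z : Sp N × ℝ => u z.1 z.2)
      (volume.restrict (Ω ×ˢ timeInterval T)) := hu.mono_set (prod_mono_left (subset_univ _))
  have hζm : AEStronglyMeasurable (fun z : Sp N × ℝ => ζ z.1)
      (volume.restrict (Ω ×ˢ timeInterval T)) :=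
    (hζ.comp measurable_fst).aestronglyMeasurable
  have h1 : MemLp (fun z : Sp N × ℝ => deriv ψ z.2 * truncation u k z.1 z.2) 2
      (volume.restrict (Ω ×ˢ timeInterval T)) := by
    refine memLp_timeInterval_of_eq_zero hΩm hαβ ?_ fun z hz => by
      rw [hψ.deriv_eq_zero hz, zero_mul]
    have hw := memLp_truncation (k := k) hΩ (hc.memLp_two hu hαβ)
    refine MemLp.of_le_mul (c := C) hw ?_ (ae_of_all _ fun z => ?_)
    · exact (hψ.continuous_deriv.comp continuous_snd).aestronglyMeasurable.mul hw.1
    · rw [norm_mul]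
      exact mul_le_mul_of_nonneg_right (hC z.2) (norm_nonneg _)
  have h2 : MemLp (fun z : Sp N × ℝ => ψ z.2 * (open Classical in
      if k < u z.1 z.2 then g z.1 z.2 else 0)) 2 (volume.restrict (Ω ×ˢ timeInterval T)) := by
    refine hg.memLp.of_le ?_ (ae_of_all _ fun z => ?_)
    · refine (hψ.contDiff.continuous.comp continuous_snd).aestronglyMeasurable.mul ?_
      exact hg.memLp.1.indicator₀ (nullMeasurableSet_lt aemeasurable_const hu')
    · rw [norm_mul, Real.norm_eq_abs (ψ z.2), abs_of_nonneg (hψ.nonneg _)]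
      split_ifs
      · exact mul_le_of_le_one_left (norm_nonneg _) (hψ.le_one _)
      · simp
  refine hg.memLp.sub ((h1.add h2).of_le (hζm.mul (h1.add h2).1) (ae_of_all _ fun z => ?_))
  rw [norm_mul, Real.norm_eq_abs, abs_of_nonneg (hζ0 _)]
  exact mul_le_of_le_one_left (norm_nonneg _) (hζ1 _)

/-- The function subtracted from `u` in the comparison map is square integrable wherever `u` is. -/
lemma memLp_testMap_sub (hΩ : Bornology.IsBounded Ω) (hζ : Measurable ζ) (hζ0 : ∀ x, 0 ≤ ζ x)
    (hζ1 : ∀ x, ζ x ≤ 1) (hψ : IsTimeCutoff α β ψ) {a b : ℝ}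
    (h : MemLp (fun z : Sp N × ℝ => u z.1 z.2) 2 (volume.restrict (Ω ×ˢ Icc a b))) :
    MemLp (fun z : Sp N × ℝ => ψ z.2 * ζ z.1 * truncation u k z.1 z.2) 2
      (volume.restrict (Ω ×ˢ Icc a b)) := by
  have hw := memLp_truncation (k := k) hΩ h
  refine hw.of_le ?_ (ae_of_all _ fun z => ?_)
  · exact ((hψ.contDiff.continuous.comp continuous_snd).aestronglyMeasurable.mul
      (hζ.comp measurable_fst).aestronglyMeasurable).mul hw.1
  · rw [norm_mul, Real.norm_eq_abs (ψ z.2 * ζ z.1), abs_of_nonneg (mul_nonneg (hψ.nonneg _) (hζ0 _))]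
    exact mul_le_of_le_one_left (norm_nonneg _)
      (mul_le_one₀ (hψ.le_one _) (hζ0 _) (hζ1 _))

open Classical in
/-- Product and chain rule for the slices `ψ(t) c (U(t) - k)₊` of the function subtracted from `u` in
the comparison map, where `U` is absolutely continuous with derivative `γ`. -/
lemma slice_truncation_facts {U γ : ℝ → ℝ} {a b : ℝ} (hψ : ContDiff ℝ 1 ψ) (k : ℝ)
    (hU : AbsolutelyContinuousOnInterval U a b)
    (hγ : ∀ᵐ t, t ∈ uIcc a b → HasDerivAt U (γ t) t) (c : ℝ) :
    AbsolutelyContinuousOnInterval (fun t => ψ t * c * max (U t - k) 0) a b ∧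
    ∀ᵐ t, t ∈ uIcc a b → HasDerivAt (fun t => ψ t * c * max (U t - k) 0)
      (c * (deriv ψ t * max (U t - k) 0 + ψ t * (if k < U t then γ t else 0))) t := by
  refine ⟨((absolutelyContinuousOnInterval_of_contDiff hψ a b).fun_mul
    (absolutelyContinuousOnInterval_const c a b)).fun_mul
    (absolutelyContinuousOnInterval_max_sub k hU), ?_⟩
  filter_upwards [ae_hasDerivAt_max_sub (k := k) hU hγ] with t h ht
  have h1 := ((hψ.differentiable (by simp) t).hasDerivAt.mul_const c).mul (h ht)
  convert! h1 using 1
  ring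

lemma isWeakTimeDerivL2_testMap (hΩo : IsOpen Ω) (hΩ : Bornology.IsBounded Ω)
    (hg : IsWeakTimeDerivL2 Ω T u g) (hc : MemContL2 Ω T u)
    (hu : AEMeasurable (fun z : Sp N × ℝ => u z.1 z.2) (volume.restrict (univ ×ˢ timeInterval T)))
    (hζ : Measurable ζ) (hζ0 : ∀ x, 0 ≤ ζ x) (hζ1 : ∀ x, ζ x ≤ 1)
    (hαβ : Icc α β ⊆ timeInterval T) (hψ : IsTimeCutoff α β ψ) :
    IsWeakTimeDerivL2 Ω T (testMap ζ ψ k u) (testDeriv ζ ψ k u g) := by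
  refine isWeakTimeDerivL2_of_slices hΩo.measurableSet hΩ
    (memLp_testDeriv hΩo.measurableSet hΩ hg hc hu hζ hζ0 hζ1 hαβ hψ) (fun a b hab => ?_)
    fun a b hab' hab => ?_
  · have h := hc.memLp_two hu hab
    exact integrableOn_of_memLp_two hΩ (h.sub (memLp_testMap_sub hΩ hζ hζ0 hζ1 hψ h))
  · filter_upwards [hg.ae_slice hΩo hΩ hc hu hab' hab] with x hx
    obtain ⟨hgx, hux⟩ := hx
    obtain ⟨hU, hUd⟩ := primitive_facts (u x a) hgx
    obtain ⟨hP, hPd⟩ := slice_truncation_facts hψ.contDiff k hU hUd (ζ x)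
    refine ⟨_, hU.fun_sub hP, ?_, ?_⟩
    · filter_upwards [hux] with t ht
      simp only [testMap, truncation, ht]
    · rw [ae_restrict_iff' measurableSet_Icc] at hux
      filter_upwards [hUd, hPd, hux] with t h1 h2 h3 ht
      have h3' := h3 (by rwa [uIcc_of_le hab'] at ht)
      convert! (h1 ht).sub (h2 ht) using 1
      simp only [testDeriv, truncation, h3']

/-- The parabolic part of the variational inequality for the comparison map: the quadratic terms in
the test map cancel and only the energy of the truncation and the derivative of the time cutoff
are left. -/
lemma integral_testDeriv_mul (hΩo : IsOpen Ω) (hΩ : Bornology.IsBounded Ω)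
    (hg : IsWeakTimeDerivL2 Ω T u g) (hc : MemContL2 Ω T u)
    (hu : AEMeasurable (fun z : Sp N × ℝ => u z.1 z.2) (volume.restrict (univ ×ˢ timeInterval T)))
    (hζ : Measurable ζ) (hζ0 : ∀ x, 0 ≤ ζ x) (hζ1 : ∀ x, ζ x ≤ 1)
    (hαβ : Icc α β ⊆ timeInterval T) (hψ : IsTimeCutoff α β ψ) {τ : ℝ} (hτ : τ ∈ timeInterval T)
    (hατ : α < τ) (hα : α ∈ timeInterval T) :
    ∫ z in Ω ×ˢ Ioo 0 τ, testDeriv ζ ψ k u g z.1 z.2 * (testMap ζ ψ k u z.1 z.2 - u z.1 z.2) =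
      1 / 2 * (∫ x in Ω, (testMap ζ ψ k u x τ - u x τ) ^ 2) -
        1 / 2 * (∫ x in Ω, ψ τ * ζ x * truncation u k x τ ^ 2) +
        1 / 2 * ∫ z in Ω ×ˢ Icc α τ, ζ z.1 * deriv ψ z.2 * truncation u k z.1 z.2 ^ 2 := by
  have hΩm := hΩo.measurableSet
  have hfin := isFiniteMeasure_restrict_of_isBounded hΩ
  have hατT : Icc α τ ⊆ timeInterval T := Icc_subset_timeInterval hα hτ
  have hu2 := hc.memLp_two hu hατT
  have hw2 := memLp_truncation (k := k) hΩ hu2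
  obtain ⟨C, hC0, hC⟩ := hψ.exists_deriv_bound
  -- before `α` the comparison map is `u`
  have hred : ∫ z in Ω ×ˢ Ioo 0 τ,
      testDeriv ζ ψ k u g z.1 z.2 * (testMap ζ ψ k u z.1 z.2 - u z.1 z.2) =
      ∫ z in Ω ×ˢ Icc α τ,
        testDeriv ζ ψ k u g z.1 z.2 * (testMap ζ ψ k u z.1 z.2 - u z.1 z.2) := by
    rw [setIntegral_eq_of_subset_of_forall_sdiff_eq_zero (hΩm.prod measurableSet_Ioo)
      (prod_mono_right (Ioo_subset_Ioo_left hα.1.le) : Ω ×ˢ Ioo α τ ⊆ Ω ×ˢ Ioo 0 τ)]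
    · rw [restrict_prod_eq, restrict_prod_eq, Measure.restrict_congr_set Ioo_ae_eq_Icc]
    · intro z hz
      have : ψ z.2 = 0 := hψ.eq_zero _ fun h => hz.2 ⟨hz.1.1, h.1, hz.1.2.2⟩
      simp [testMap, this]
  have hI1 : IntegrableOn (fun z : Sp N × ℝ =>
      testDeriv ζ ψ k u g z.1 z.2 * (testMap ζ ψ k u z.1 z.2 - u z.1 z.2)) (Ω ×ˢ Icc α τ) := by
    have hd := (memLp_testDeriv (k := k) hΩm hΩ hg hc hu hζ hζ0 hζ1 hαβ hψ).mono_measure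
      (Measure.restrict_mono (prod_mono_right hατT) le_rfl)
    have hs := (memLp_testMap_sub (k := k) hΩ hζ hζ0 hζ1 hψ hu2).neg
    refine (hd.integrable_mul hs).congr (ae_of_all _ fun z => ?_)
    simp [testMap]
  have hI2 : IntegrableOn (fun z : Sp N × ℝ =>
      ζ z.1 * deriv ψ z.2 * truncation u k z.1 z.2 ^ 2) (Ω ×ˢ Icc α τ) := by
    refine Integrable.bdd_mul (c := C) hw2.integrable_sq ?_ (ae_of_all _ fun z => ?_)
    · exact (hζ.comp measurable_fst).aestronglyMeasurable.mul
        (hψ.continuous_deriv.comp continuous_snd).aestronglyMeasurable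
    · rw [norm_mul, Real.norm_eq_abs, abs_of_nonneg (hζ0 _)]
      exact (mul_le_of_le_one_left (norm_nonneg _) (hζ1 _)).trans (hC _)
  have hwτ : MemLp (fun x => truncation u k x τ) 2 (volume.restrict Ω) :=
    ((hc.memLp τ (timeInterval_subset_closed T hτ)).sub (memLp_const k)).pos_part
  have hw2τ := hwτ.integrable_sq
  have hI3 : Integrable (fun x => (testMap ζ ψ k u x τ - u x τ) ^ 2) (volume.restrict Ω) := by
    refine (hw2τ.bdd_mul (c := 1) (f := fun x => (ψ τ * ζ x) ^ 2) ?_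
      (ae_of_all _ fun x => ?_)).congr (ae_of_all _ fun x => ?_)
    · exact ((hζ.const_mul _).pow_const 2).aestronglyMeasurable
    · rw [Real.norm_eq_abs, abs_of_nonneg (sq_nonneg _)]
      exact pow_le_one₀ (mul_nonneg (hψ.nonneg _) (hζ0 _))
        (mul_le_one₀ (hψ.le_one _) (hζ0 _) (hζ1 _))
    · simp only [testMap]; ring
  have hI4 : Integrable (fun x => ψ τ * ζ x * truncation u k x τ ^ 2) (volume.restrict Ω) := by
    refine hw2τ.bdd_mul (c := 1) (hζ.const_mul _).aestronglyMeasurable (ae_of_all _ fun x => ?_)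
    rw [Real.norm_eq_abs, abs_of_nonneg (mul_nonneg (hψ.nonneg _) (hζ0 _))]
    exact mul_le_one₀ (hψ.le_one _) (hζ0 _) (hζ1 _)
  have hI2' : IntegrableOn (fun z : Sp N × ℝ =>
      1 / 2 * (ζ z.1 * deriv ψ z.2 * truncation u k z.1 z.2 ^ 2)) (Ω ×ˢ Icc α τ) :=
    hI2.const_mul _
  have key : ∫ z in Ω ×ˢ Icc α τ,
      (testDeriv ζ ψ k u g z.1 z.2 * (testMap ζ ψ k u z.1 z.2 - u z.1 z.2) -
        1 / 2 * (ζ z.1 * deriv ψ z.2 * truncation u k z.1 z.2 ^ 2)) =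
      ∫ x in Ω, (1 / 2 * (testMap ζ ψ k u x τ - u x τ) ^ 2 -
        1 / 2 * (ψ τ * ζ x * truncation u k x τ ^ 2)) := by
    have hI5 : IntegrableOn (fun z : Sp N × ℝ =>
        (testDeriv ζ ψ k u g z.1 z.2 * (testMap ζ ψ k u z.1 z.2 - u z.1 z.2) -
        1 / 2 * (ζ z.1 * deriv ψ z.2 * truncation u k z.1 z.2 ^ 2))) (Ω ×ˢ Icc α τ) :=
      hI1.sub hI2'
    rw [IntegrableOn, restrict_prod_eq] at hI5
    rw [restrict_prod_eq, integral_prod _ hI5]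
    refine integral_congr_ae ?_
    filter_upwards [hg.ae_slice hΩo hΩ hc hu hατ.le hατT,
      hg.ae_sub_eq_integral hΩo hΩ hc hu hα hτ hατ.le] with x hx hxτ
    obtain ⟨hgx, hux⟩ := hx
    obtain ⟨hU, hUd⟩ := primitive_facts (u x α) hgx
    have huτ : u x τ = u x α + ∫ s in α..τ, g x s := by linarith
    set U : ℝ → ℝ := fun t => u x α + ∫ s in α..t, g x s with hUdef
    obtain ⟨hP, hPd⟩ := slice_truncation_facts hψ.contDiff k hU hUd (ζ x)
    obtain ⟨hW, hWd⟩ := slice_truncation_facts (ψ := fun _ => 1) contDiff_const k hU hUd 1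
    -- with `P = ψ ζ w` and `W = w`, the integrand is the derivative of `½ P² - ½ P W`
    have hQ := ((hP.fun_mul hP).const_mul (1 / 2)).fun_sub ((hP.fun_mul hW).const_mul (1 / 2))
    have hQd := (hPd.and hWd).mono fun t h (ht : t ∈ uIcc α τ) =>
      (((h.1 ht).fun_mul (h.1 ht)).const_mul (1 / 2 : ℝ)).fun_sub
        (((h.1 ht).fun_mul (h.2 ht)).const_mul (1 / 2 : ℝ))
    have h0 := integral_eq_sub_of_absolutelyContinuous hQ hQd
    have hψα : ψ α = 0 := hψ.eq_zero α (by simp)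
    rw [intervalIntegral.integral_of_le hατ.le, ← integral_Icc_eq_integral_Ioc, hψα] at h0
    have eU : U τ = u x τ := huτ.symm
    rw [eU] at h0
    refine (Eq.trans ?_ h0).trans ?_
    · refine integral_congr_ae ?_
      filter_upwards [hux] with t ht
      have ht' : U t = u x t := ht.symm
      simp only [testDeriv, testMap, truncation, ht', deriv_const]
      split_ifs with hk
      · ring
      · rw [max_eq_right (by linarith)]; ring
    · simp only [testMap, truncation]
      ring
  rw [integral_sub hI1 hI2', integral_sub (hI3.const_mul _) (hI4.const_mul _),
    integral_const_mul, integral_const_mul, integral_const_mul] at key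
  rw [hred]
  linarith

end

/-! ### Measurability in time and the Sobolev modular -/

section

variable {N : ℕ} {Ω : Set (Sp N)} {T : ℝ≥0∞} {u v : Sp N → ℝ → ℝ} {s p σ m : ℝ}

/-- A jointly a.e. measurable function agrees at almost every time with a measurable one. -/
lemma exists_measurable_slices
    (hv : AEMeasurable (fun z : Sp N × ℝ => v z.1 z.2) (volume.restrict (univ ×ˢ timeInterval T))) :
    ∃ v' : Sp N × ℝ → ℝ, Measurable v' ∧ ∀ᵐ t ∂(volume.restrict (timeInterval T)),
      (fun x => v x t) =ᵐ[volume] fun x => v' (x, t) := by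
  obtain ⟨v', hv', h⟩ := hv
  refine ⟨v', hv', ?_⟩
  rw [restrict_prod_eq, Measure.restrict_univ] at h
  exact Measure.ae_ae_of_ae_prod
    ((Measure.measurePreserving_swap (μ := volume.restrict (timeInterval T))
      (ν := (volume : Measure (Sp N)))).quasiMeasurePreserving.ae h)

lemma phaseEnergy_congr_ae {b : Sp N → Sp N → ℝ} {A : Set (Sp N)} {f h : Sp N → ℝ}
    (hfh : f =ᵐ[volume] h) : phaseEnergy σ m b A f = phaseEnergy σ m b A h := by
  unfold phaseEnergy
  refine lintegral_congr_ae ?_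
  filter_upwards [ae_restrict_of_ae hfh] with x hx
  refine lintegral_congr_ae ?_
  filter_upwards [ae_restrict_of_ae hfh] with y hy
  rw [hx, hy]

lemma measurable_phaseEnergy_slice {b : Sp N → Sp N → ℝ}
    (hb : Measurable fun z : Sp N × Sp N => b z.1 z.2) (A : Set (Sp N)) {v' : Sp N × ℝ → ℝ}
    (hv : Measurable v') : Measurable fun t => phaseEnergy σ m b A fun x => v' (x, t) := by
  unfold phaseEnergy
  have h1 : Measurable fun q : (ℝ × Sp N) × Sp N => ENNReal.ofReal
      (b q.1.2 q.2 * |v' (q.1.2, q.1.1) - v' (q.2, q.1.1)| ^ m * kernel σ m q.1.2 q.2) := by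
    have hpair : Measurable fun q : (ℝ × Sp N) × Sp N => (q.1.2, q.2) := by fun_prop
    have h2 : Measurable fun q : (ℝ × Sp N) × Sp N => (q.1.2, q.1.1) := by fun_prop
    have h3 : Measurable fun q : (ℝ × Sp N) × Sp N => (q.2, q.1.1) := by fun_prop
    exact (((hb.comp hpair).mul ((((hv.comp h2).sub (hv.comp h3)).abs).pow_const m)).mul
      ((measurable_kernel σ m).comp hpair)).ennreal_ofReal
  exact (h1.lintegral_prod_right' (ν := volume.restrict A)).lintegral_prod_right'
    (ν := volume.restrict A)

lemma aemeasurable_phaseEnergy {b : Sp N → Sp N → ℝ}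
    (hb : Measurable fun z : Sp N × Sp N => b z.1 z.2) (A : Set (Sp N))
    (hv : AEMeasurable (fun z : Sp N × ℝ => v z.1 z.2) (volume.restrict (univ ×ˢ timeInterval T))) :
    AEMeasurable (fun t => phaseEnergy σ m b A fun x => v x t)
      (volume.restrict (timeInterval T)) := by
  obtain ⟨v', hv', h⟩ := exists_measurable_slices hv
  refine ⟨fun t => phaseEnergy σ m b A fun x => v' (x, t),
    measurable_phaseEnergy_slice hb A hv', ?_⟩
  filter_upwards [h] with t ht
  exact phaseEnergy_congr_ae ht

lemma gagliardo_eq_phaseEnergy (hN : 0 < N) (hps : 0 < p * s) (f : Sp N → ℝ) :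
    gagliardo s p f = phaseEnergy s p (fun _ _ => 1) univ f := by
  unfold gagliardo phaseEnergy
  simp only [Measure.restrict_univ]
  congr 1; ext x; congr 1; ext y
  congr 1
  unfold kernel
  rw [one_mul, div_eq_mul_inv]
  congr 2
  rcases (norm_nonneg (x - y)).eq_or_lt with h | h
  · rw [← h, Real.zero_rpow hps.ne', Real.zero_rpow (by positivity), zero_mul]
  · rw [Real.rpow_add h, Real.rpow_natCast, mul_comm]

/-- The modular `‖f‖_p^p + [f]_{s,p}^p` of the fractional Sobolev space. -/
noncomputable def sobolevModular (s p : ℝ) (f : Sp N → ℝ) : ℝ≥0∞ :=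
  (∫⁻ x, ‖f x‖ₑ ^ p) + phaseEnergy s p (fun _ _ => 1) univ f

lemma sobolevModular_congr_ae {f h : Sp N → ℝ} (hfh : f =ᵐ[volume] h) :
    sobolevModular s p f = sobolevModular s p h := by
  unfold sobolevModular
  rw [phaseEnergy_congr_ae hfh]
  congr 1
  refine lintegral_congr_ae ?_
  filter_upwards [hfh] with x hx
  rw [hx]

lemma eLpNorm_rpow_eq {X : Type*} [MeasurableSpace X] {μ : Measure X} (hp : 1 ≤ p) (f : X → ℝ) :
    eLpNorm f (ENNReal.ofReal p) μ ^ p = ∫⁻ x, ‖f x‖ₑ ^ p ∂μ := by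
  have hp0 : 0 < p := by linarith
  rw [eLpNorm_eq_lintegral_rpow_enorm_toReal (by simpa using hp0) ENNReal.ofReal_ne_top,
    ENNReal.toReal_ofReal hp0.le, ← ENNReal.rpow_mul, one_div, inv_mul_cancel₀ hp0.ne',
    ENNReal.rpow_one]

lemma sobolevNorm_rpow_le (hN : 0 < N) (hs : 0 < s) (hp : 1 ≤ p) (f : Sp N → ℝ) :
    sobolevNorm s p f ^ p ≤ 2 ^ (p - 1) * sobolevModular s p f := by
  have hp0 : 0 < p := by linarith
  unfold sobolevNorm sobolevModular
  refine (ENNReal.rpow_add_le_mul_rpow_add_rpow _ _ hp).trans ?_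
  rw [eLpNorm_rpow_eq hp, ← ENNReal.rpow_mul, one_div, inv_mul_cancel₀ hp0.ne', ENNReal.rpow_one,
    gagliardo_eq_phaseEnergy hN (by positivity)]

lemma sobolevModular_le (hN : 0 < N) (hs : 0 < s) (hp : 1 ≤ p) (f : Sp N → ℝ) :
    sobolevModular s p f ≤ 2 * sobolevNorm s p f ^ p := by
  have hp0 : 0 < p := by linarith
  unfold sobolevNorm sobolevModular
  rw [two_mul]
  refine add_le_add ?_ ?_
  · rw [← eLpNorm_rpow_eq hp]
    exact ENNReal.rpow_le_rpow le_self_add hp0.le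
  · rw [← gagliardo_eq_phaseEnergy hN (by positivity)]
    calc gagliardo s p f = (gagliardo s p f ^ (1 / p)) ^ p := by
          rw [← ENNReal.rpow_mul, one_div, inv_mul_cancel₀ hp0.ne', ENNReal.rpow_one]
      _ ≤ _ := ENNReal.rpow_le_rpow le_add_self hp0.le

lemma aemeasurable_sobolevModular
    (hv : AEMeasurable (fun z : Sp N × ℝ => v z.1 z.2) (volume.restrict (univ ×ˢ timeInterval T))) :
    AEMeasurable (fun t => sobolevModular s p fun x => v x t)
      (volume.restrict (timeInterval T)) := by
  obtain ⟨v', hv', h⟩ := exists_measurable_slices hv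
  refine ⟨fun t => sobolevModular s p fun x => v' (x, t), ?_, ?_⟩
  · unfold sobolevModular
    refine Measurable.add ?_ (measurable_phaseEnergy_slice measurable_const _ hv')
    have h1 : Measurable fun q : ℝ × Sp N => ‖v' (q.2, q.1)‖ₑ ^ p := by fun_prop
    exact h1.lintegral_prod_right'
  · filter_upwards [h] with t ht
    exact sobolevModular_congr_ae ht

/-- The space `L^p(0,T;W^{s,p})` through the modular. -/
lemma memLpSobolev_iff (hN : 0 < N) (hs : 0 < s) (hp : 1 ≤ p) :
    MemLpSobolev s p T v ↔
      AEMeasurable (fun z : Sp N × ℝ => v z.1 z.2) (volume.restrict (univ ×ˢ timeInterval T)) ∧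
      ∫⁻ t in timeInterval T, sobolevModular s p (fun x => v x t) < ⊤ := by
  have hp0 : 0 < p := by linarith
  constructor
  · intro h
    refine ⟨h.aemeasurable, ?_⟩
    refine (lintegral_mono fun t => sobolevModular_le hN hs hp _).trans_lt ?_
    rw [lintegral_const_mul' _ _ (by simp)]
    exact ENNReal.mul_lt_top (by simp) h.lintegral_lt_top
  · rintro ⟨hv, h⟩
    obtain ⟨v', hv', hvv'⟩ := exists_measurable_slices hv
    have hfin := ae_lt_top' (aemeasurable_sobolevModular hv) h.ne
    have hC : (2 : ℝ≥0∞) ^ (p - 1) ≠ ⊤ :=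
      ENNReal.rpow_ne_top_of_nonneg (by linarith) (by simp)
    refine ⟨hv, ?_, ?_⟩
    · filter_upwards [hvv', hfin] with t ht1 ht2
      refine ⟨(hv'.comp measurable_prodMk_right).aestronglyMeasurable.congr ht1.symm, ?_⟩
      have h1 := (sobolevNorm_rpow_le hN hs hp fun x => v x t).trans_lt
        (ENNReal.mul_lt_top hC.lt_top ht2)
      rwa [ENNReal.rpow_lt_top_iff_of_pos hp0] at h1
    · refine (lintegral_mono fun t => sobolevNorm_rpow_le hN hs hp _).trans_lt ?_
      rw [lintegral_const_mul' _ _ hC]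
      exact ENNReal.mul_lt_top hC.lt_top h

lemma abs_sub_rpow_le_two (hp : 1 ≤ p) (a b : ℝ) :
    |a - b| ^ p ≤ 2 ^ p * (|a| ^ p + |b| ^ p) := by
  have h1 : |a - b| ≤ 2 * max |a| |b| := by
    refine (abs_sub a b).trans ?_
    have := le_max_left |a| |b|
    have := le_max_right |a| |b|
    linarith
  refine (Real.rpow_le_rpow (abs_nonneg _) h1 (by linarith)).trans ?_
  rw [Real.mul_rpow (by norm_num) (by positivity)]
  gcongr
  have h2 : 0 ≤ |a| ^ p := by positivity
  have h3 : 0 ≤ |b| ^ p := by positivity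
  rcases max_cases |a| |b| with h | h <;> rw [h.1] <;> linarith

lemma ofReal_rpow_abs (hp : 0 ≤ p) (a : ℝ) : ENNReal.ofReal (|a| ^ p) = ‖a‖ₑ ^ p := by
  rw [← ENNReal.ofReal_rpow_of_nonneg (abs_nonneg a) hp, Real.enorm_eq_ofReal_abs]

lemma phaseEnergy_sub_le_of_measurable (hp : 1 ≤ p) {f h : Sp N → ℝ} (hf : Measurable f) :
    phaseEnergy s p (fun _ _ => 1) univ (fun x => f x - h x) ≤
      ENNReal.ofReal (2 ^ p) * (phaseEnergy s p (fun _ _ => 1) univ f +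
        phaseEnergy s p (fun _ _ => 1) univ h) := by
  have hm : Measurable fun z : Sp N × Sp N =>
      ENNReal.ofReal (1 * |f z.1 - f z.2| ^ p * kernel s p z.1 z.2) := by fun_prop
  unfold phaseEnergy
  simp only [Measure.restrict_univ]
  rw [← lintegral_add_left hm.lintegral_prod_right',
    ← lintegral_const_mul' _ _ ENNReal.ofReal_ne_top]
  refine lintegral_mono fun x => ?_
  have hmx : Measurable fun y => ENNReal.ofReal (1 * |f x - f y| ^ p * kernel s p x y) := by
    have := measurable_kernel_right s p x
    fun_prop
  rw [← lintegral_add_left hmx, ← lintegral_const_mul' _ _ ENNReal.ofReal_ne_top]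
  refine lintegral_mono fun y => ?_
  have hK := kernel_nonneg s p x y
  rw [← ENNReal.ofReal_add (by positivity) (by positivity),
    ← ENNReal.ofReal_mul (by positivity)]
  apply ENNReal.ofReal_le_ofReal
  have h1 := abs_sub_rpow_le_two hp (f x - f y) (h x - h y)
  rw [show f x - h x - (f y - h y) = f x - f y - (h x - h y) by ring]
  calc 1 * |f x - f y - (h x - h y)| ^ p * kernel s p x y
      ≤ 1 * (2 ^ p * (|f x - f y| ^ p + |h x - h y| ^ p)) * kernel s p x y := by gcongr
    _ = _ := by ring

lemma phaseEnergy_sub_le (hp : 1 ≤ p) {f h : Sp N → ℝ} (hf : AEMeasurable f volume) :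
    phaseEnergy s p (fun _ _ => 1) univ (fun x => f x - h x) ≤
      ENNReal.ofReal (2 ^ p) * (phaseEnergy s p (fun _ _ => 1) univ f +
        phaseEnergy s p (fun _ _ => 1) univ h) := by
  obtain ⟨f', hf', hff'⟩ := hf
  rw [phaseEnergy_congr_ae hff', phaseEnergy_congr_ae (f := fun x => f x - h x)
    (h := fun x => f' x - h x) (by filter_upwards [hff'] with x hx; rw [hx])]
  exact phaseEnergy_sub_le_of_measurable hp hf'

lemma sobolevModular_sub_le (hp : 1 ≤ p) {f h : Sp N → ℝ} (hf : AEMeasurable f volume) :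
    sobolevModular s p (fun x => f x - h x) ≤
      ENNReal.ofReal (2 ^ p) * (sobolevModular s p f + sobolevModular s p h) := by
  have hp0 : 0 ≤ p := by linarith
  unfold sobolevModular
  have h1 : ∫⁻ x, ‖f x - h x‖ₑ ^ p ≤
      ENNReal.ofReal (2 ^ p) * ((∫⁻ x, ‖f x‖ₑ ^ p) + ∫⁻ x, ‖h x‖ₑ ^ p) := by
    rw [← lintegral_add_left' (hf.enorm.pow_const _),
      ← lintegral_const_mul' _ _ ENNReal.ofReal_ne_top]
    refine lintegral_mono fun x => ?_
    rw [← ofReal_rpow_abs hp0, ← ofReal_rpow_abs hp0, ← ofReal_rpow_abs hp0,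
      ← ENNReal.ofReal_add (by positivity) (by positivity), ← ENNReal.ofReal_mul (by positivity)]
    exact ENNReal.ofReal_le_ofReal (abs_sub_rpow_le_two hp _ _)
  refine (add_le_add h1 (phaseEnergy_sub_le hp hf)).trans (le_of_eq ?_)
  ring

lemma MemLpSobolev.sub (hN : 0 < N) (hs : 0 < s) (hp : 1 ≤ p) (hu : MemLpSobolev s p T u)
    (hv : MemLpSobolev s p T v) : MemLpSobolev s p T fun x t => u x t - v x t := by
  rw [memLpSobolev_iff hN hs hp] at *
  refine ⟨hu.1.sub hv.1, ?_⟩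
  obtain ⟨u', hu', huu'⟩ := exists_measurable_slices hu.1
  have hle : ∀ᵐ t ∂(volume.restrict (timeInterval T)),
      sobolevModular s p (fun x => u x t - v x t) ≤ ENNReal.ofReal (2 ^ p) *
        (sobolevModular s p (fun x => u x t) + sobolevModular s p fun x => v x t) := by
    filter_upwards [huu'] with t ht
    exact sobolevModular_sub_le hp ⟨_, hu'.comp measurable_prodMk_right, ht⟩
  refine (lintegral_mono_ae hle).trans_lt ?_
  rw [lintegral_const_mul' _ _ ENNReal.ofReal_ne_top,
    lintegral_add_left' (aemeasurable_sobolevModular hu.1)]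
  exact ENNReal.mul_lt_top ENNReal.ofReal_lt_top (ENNReal.add_lt_top.2 ⟨hu.2, hv.2⟩)

/-- Time-independent data belong to the class as soon as the class is not empty; for `T = ∞` this
forces the data to vanish almost everywhere. -/
lemma InClass.const (hN : 0 < N) (hs : 0 < s) (hp : 1 ≤ p) {u₀ : Sp N → ℝ}
    (h : InClass s p Ω T u₀ u) (hu₀ : MemLp u₀ 2 (volume.restrict Ω)) :
    InClass s p Ω T u₀ fun x _ => u₀ x := by
  refine ⟨?_, ⟨fun _ _ => hu₀, fun t _ => ?_⟩, ?_, ?_⟩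
  · have := h.memLpSobolev.sub hN hs hp h.sub_memLpSobolev
    simpa using this
  · simpa using tendsto_const_nhds
  · have := h.memLpSobolev.sub hN hs hp h.memLpSobolev
    simpa using this
  · simp

end

/-! ### The comparison map is admissible -/

section

variable {N : ℕ} {Ω : Set (Sp N)} {T : ℝ≥0∞} {u : Sp N → ℝ → ℝ} {s p : ℝ} {ζ : Sp N → ℝ}

/-- The Gagliardo density of a bounded Lipschitz function is bounded. -/
lemma exists_lintegral_lipschitz_kernel_le (hN : 0 < N) (hs : s ∈ Ioo (0 : ℝ) 1) (hp : 0 < p)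
    (L : ℝ) :
    ∃ C : ℝ≥0∞, C < ⊤ ∧ ∀ ζ : Sp N → ℝ, (∀ x, 0 ≤ ζ x) → (∀ x, ζ x ≤ 1) →
      (∀ x y, |ζ x - ζ y| ≤ L * ‖x - y‖) →
      ∀ x, ∫⁻ y, ENNReal.ofReal (|ζ x - ζ y| ^ p * kernel s p x y) ≤ C := by
  have hps : 0 < p * s := mul_pos hp hs.1
  obtain ⟨c, hc, hball⟩ := exists_lintegral_norm_rpow_ball_le N hN
    (mul_pos hp (sub_pos.2 hs.2))
  set F : Sp N → ℝ≥0∞ := fun z =>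
    (Metric.ball (0 : Sp N) 1).indicator
      (fun z => ENNReal.ofReal (|L| ^ p) * ENNReal.ofReal (‖z‖ ^ (p * (1 - s) - N))) z +
    ENNReal.ofReal (2 ^ ((N : ℝ) + p * s) * (1 + ‖z‖) ^ (-((N : ℝ) + p * s))) with hF
  refine ⟨∫⁻ z, F z, ?_, fun ζ hζ0 hζ1 hL x => ?_⟩
  · have h2 : Integrable fun z : Sp N => 2 ^ ((N : ℝ) + p * s) *
        (1 + ‖z‖) ^ (-((N : ℝ) + p * s)) :=
      (integrable_one_add_norm (by simp [hps])).const_mul _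
    rw [hF, lintegral_add_right' _ h2.1.aemeasurable.ennreal_ofReal,
      lintegral_indicator measurableSet_ball, lintegral_const_mul' _ _ ENNReal.ofReal_ne_top]
    refine ENNReal.add_lt_top.2 ⟨ENNReal.mul_lt_top ENNReal.ofReal_lt_top
      ((hball 1 one_pos).trans_lt ENNReal.ofReal_lt_top), ?_⟩
    exact h2.lintegral_lt_top
  · rw [← lintegral_sub_left_eq_self F x]
    refine lintegral_mono fun y => ?_
    have hK := kernel_nonneg s p x y
    by_cases hxy : ‖x - y‖ < 1
    · have hmem : x - y ∈ Metric.ball (0 : Sp N) 1 := by simpa using hxy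
      simp only [hF]
      rw [indicator_of_mem hmem, ← ENNReal.ofReal_mul (by positivity)]
      refine le_trans (ENNReal.ofReal_le_ofReal ?_) le_self_add
      have h1 : |ζ x - ζ y| ^ p ≤ |L| ^ p * ‖x - y‖ ^ p := by
        rw [← Real.mul_rpow (abs_nonneg _) (norm_nonneg _)]
        refine Real.rpow_le_rpow (abs_nonneg _) ((hL x y).trans ?_) hp.le
        exact mul_le_mul_of_nonneg_right (le_abs_self L) (norm_nonneg _)
      calc |ζ x - ζ y| ^ p * kernel s p x y
          ≤ |L| ^ p * ‖x - y‖ ^ p * kernel s p x y := by gcongr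
        _ = |L| ^ p * (‖x - y‖ ^ p * kernel s p x y) := by ring
        _ ≤ _ := by gcongr; exact norm_rpow_mul_kernel_le hp x y
    · simp only [hF]
      refine le_trans (ENNReal.ofReal_le_ofReal ?_) le_add_self
      have hpos : 0 < ‖x - y‖ := by linarith [not_lt.1 hxy]
      have h1 : |ζ x - ζ y| ^ p ≤ 1 := by
        refine Real.rpow_le_one (abs_nonneg _) ?_ hp.le
        rw [abs_le]
        constructor <;> linarith [hζ0 x, hζ1 x, hζ0 y, hζ1 y]
      have h2 : kernel s p x y = ‖x - y‖ ^ (-((N : ℝ) + p * s)) := by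
        unfold kernel
        rw [← Real.rpow_natCast, ← Real.rpow_add hpos, ← Real.rpow_neg hpos.le]
        congr 1; ring
      calc |ζ x - ζ y| ^ p * kernel s p x y ≤ 1 * kernel s p x y := by gcongr
        _ = ‖x - y‖ ^ (-((N : ℝ) + p * s)) := by rw [one_mul, h2]
        _ ≤ ((1 + ‖x - y‖) / 2) ^ (-((N : ℝ) + p * s)) := by
            refine Real.rpow_le_rpow_of_nonpos (by positivity) ?_ ?_
            · linarith [not_lt.1 hxy]
            · have : (0 : ℝ) ≤ N := by positivity
              linarith
        _ = _ := by
            rw [Real.div_rpow (by positivity) (by norm_num), Real.rpow_neg (by norm_num : (0:ℝ) ≤ 2)]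
            field_simp

lemma abs_rpow_sub_rpow_le {q α β : ℝ} (hq : 1 ≤ q) (hα : 0 ≤ α) (hα1 : α ≤ 1) (hβ : 0 ≤ β)
    (hβ1 : β ≤ 1) : |α ^ q - β ^ q| ≤ q * |α - β| := by
  wlog h : β ≤ α generalizing α β
  · rw [abs_sub_comm, abs_sub_comm α]
    exact this hβ hβ1 hα hα1 (le_of_not_ge h)
  have hq0 : 0 < q := by linarith
  rw [abs_of_nonneg (sub_nonneg.2 (Real.rpow_le_rpow hβ h hq0.le)), abs_of_nonneg (sub_nonneg.2 h)]
  rcases hα.eq_or_lt with h0 | h0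
  · have : β = 0 := le_antisymm (h0 ▸ h) hβ
    simp [← h0, this]
  have h1 := one_sub_div_rpow_le hq hβ h0
  have hαq : 0 < α ^ q := Real.rpow_pos_of_pos h0 _
  have hαq1 : α ^ q ≤ α := by
    have := Real.rpow_le_rpow_of_exponent_ge h0 hα1 hq
    rwa [Real.rpow_one] at this
  have h2 : α ^ q - β ^ q = α ^ q * (1 - β ^ q / α ^ q) := by field_simp
  rw [h2]
  have hs : 0 ≤ α - β := sub_nonneg.2 h
  calc α ^ q * (1 - β ^ q / α ^ q) ≤ α ^ q * (q * ((α - β) / α)) := by gcongr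
    _ ≤ α * (q * ((α - β) / α)) := by gcongr
    _ = q * (α - β) := by field_simp

/-- The pointwise bound behind the Gagliardo seminorm of a cut off truncation. -/
lemma abs_mul_sub_mul_rpow_le (hp : 1 ≤ p) {c a b X Y : ℝ} (hc0 : 0 ≤ c) (hc1 : c ≤ 1)
    (hb0 : 0 ≤ b) (hb1 : b ≤ 1) :
    |c * a * max X 0 - c * b * max Y 0| ^ p ≤
      2 ^ p * (|X - Y| ^ p + |a - b| ^ p * max X 0 ^ p) := by
  have hp0 : 0 ≤ p := by linarith
  have hX : 0 ≤ max X 0 := le_max_right _ _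
  have h1 : |c * a * max X 0 - c * b * max Y 0| ≤
      |(a - b) * max X 0 - b * (max Y 0 - max X 0)| := by
    rw [show c * a * max X 0 - c * b * max Y 0 =
      c * ((a - b) * max X 0 - b * (max Y 0 - max X 0)) by ring, abs_mul, abs_of_nonneg hc0]
    exact mul_le_of_le_one_left (abs_nonneg _) hc1
  refine (Real.rpow_le_rpow (abs_nonneg _) h1 hp0).trans
    ((abs_sub_rpow_le_two hp _ _).trans ?_)
  have h2 : |b * (max Y 0 - max X 0)| ≤ |X - Y| := by
    rw [abs_mul, abs_of_nonneg hb0, abs_sub_comm]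
    exact (mul_le_of_le_one_left (abs_nonneg _) hb1).trans (abs_max_sub_max_le_abs _ _ _)
  rw [abs_mul (a - b), abs_of_nonneg hX, Real.mul_rpow (abs_nonneg _) hX]
  have h3 := Real.rpow_le_rpow (abs_nonneg _) h2 hp0
  have h4 : (0 : ℝ) ≤ 2 ^ p := by positivity
  nlinarith [mul_le_mul_of_nonneg_left h3 h4]

/-- The Gagliardo seminorm of a cut off truncation. -/
lemma phaseEnergy_cutoff_le (hp : 1 ≤ p) {B : Set (Sp N)} (hB : MeasurableSet B) {C : ℝ≥0∞}
    (hζm : Measurable ζ) (hζ0 : ∀ x, 0 ≤ ζ x) (hζ1 : ∀ x, ζ x ≤ 1) (hζB : ∀ x, x ∉ B → ζ x = 0)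
    (hC : ∀ x, ∫⁻ y, ENNReal.ofReal (|ζ x - ζ y| ^ p * kernel s p x y) ≤ C)
    {f : Sp N → ℝ} (hf : Measurable f) (k : ℝ) {c : ℝ} (hc0 : 0 ≤ c) (hc1 : c ≤ 1) :
    phaseEnergy s p (fun _ _ => 1) univ (fun x => c * ζ x * posTrunc f k x) ≤
      ENNReal.ofReal (2 ^ p) * (phaseEnergy s p (fun _ _ => 1) univ f +
        2 * (C * ∫⁻ x in B, ENNReal.ofReal (posTrunc f k x ^ p))) := by
  have hwm : Measurable (posTrunc f k) := by unfold posTrunc; fun_prop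
  have hw0 := posTrunc_nonneg f k
  obtain ⟨E, hE⟩ : ∃ E : Sp N → Sp N → ℝ≥0∞, E = fun x y => B.indicator (fun x =>
      ENNReal.ofReal (posTrunc f k x ^ p) *
        ENNReal.ofReal (|ζ x - ζ y| ^ p * kernel s p x y)) x := ⟨_, rfl⟩
  have hEm : Measurable fun z : Sp N × Sp N => E z.1 z.2 := by
    have h1 : Measurable fun z : Sp N × Sp N => ENNReal.ofReal (posTrunc f k z.1 ^ p) *
        ENNReal.ofReal (|ζ z.1 - ζ z.2| ^ p * kernel s p z.1 z.2) := by fun_prop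
    have h2 := h1.indicator (measurable_fst hB : MeasurableSet {z : Sp N × Sp N | z.1 ∈ B})
    rw [hE]
    convert! h2 using 1
  have hEint : ∫⁻ x, ∫⁻ y, E x y ≤ C * ∫⁻ x in B, ENNReal.ofReal (posTrunc f k x ^ p) := by
    rw [← lintegral_indicator hB, ← lintegral_const_mul _
      ((by fun_prop : Measurable fun x => ENNReal.ofReal (posTrunc f k x ^ p)).indicator hB)]
    refine lintegral_mono fun x => ?_
    rw [hE]
    by_cases hx : x ∈ B
    · simp only [indicator_of_mem hx]
      rw [lintegral_const_mul' _ _ ENNReal.ofReal_ne_top, mul_comm]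
      exact mul_le_mul_left (hC x) _
    · simp [indicator_of_notMem hx]
  have hEm1 : Measurable fun x => ∫⁻ y, E x y := hEm.lintegral_prod_right'
  have hEx : ∀ x, Measurable fun y => E x y := fun x => hEm.comp measurable_prodMk_left
  have hswap : ∫⁻ x, ∫⁻ y, E y x = ∫⁻ x, ∫⁻ y, E x y :=
    (lintegral_lintegral_swap (f := E) hEm.aemeasurable).symm
  have hpt : ∀ x y, ENNReal.ofReal (1 * |c * ζ x * posTrunc f k x - c * ζ y * posTrunc f k y| ^ p *
      kernel s p x y) ≤ ENNReal.ofReal (2 ^ p) *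
      (ENNReal.ofReal (1 * |f x - f y| ^ p * kernel s p x y) + (E x y + E y x)) := by
    intro x y
    have hK := kernel_nonneg s p x y
    have hone : ∀ x y, x ∈ B → ENNReal.ofReal (1 * |c * ζ x * posTrunc f k x -
        c * ζ y * posTrunc f k y| ^ p * kernel s p x y) ≤ ENNReal.ofReal (2 ^ p) *
        (ENNReal.ofReal (1 * |f x - f y| ^ p * kernel s p x y) + E x y) := by
      intro x y hx
      have hK := kernel_nonneg s p x y
      have hwx := hw0 x
      simp only [hE, indicator_of_mem hx]
      rw [← ENNReal.ofReal_mul (by positivity), ← ENNReal.ofReal_add (by positivity)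
        (by positivity), ← ENNReal.ofReal_mul (by positivity)]
      apply ENNReal.ofReal_le_ofReal
      have h := abs_mul_sub_mul_rpow_le (a := ζ x) (X := f x - k) (Y := f y - k) hp hc0 hc1
        (hζ0 y) (hζ1 y)
      rw [show f x - k - (f y - k) = f x - f y by ring] at h
      have h' := mul_le_mul_of_nonneg_right h hK
      simp only [posTrunc]
      nlinarith [h']
    by_cases hx : x ∈ B
    · refine (hone x y hx).trans ?_
      gcongr
      exact le_self_add
    · by_cases hy : y ∈ B
      · have h := hone y x hy
        rw [abs_sub_comm, abs_sub_comm (f y), kernel_comm] at h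
        refine h.trans ?_
        gcongr
        exact le_add_self
      · rw [hζB x hx, hζB y hy]
        simp [Real.zero_rpow (by linarith : p ≠ 0)]
  have hfm : Measurable fun z : Sp N × Sp N =>
      ENNReal.ofReal (1 * |f z.1 - f z.2| ^ p * kernel s p z.1 z.2) := by fun_prop
  calc phaseEnergy s p (fun _ _ => 1) univ (fun x => c * ζ x * posTrunc f k x)
      ≤ ∫⁻ x, ∫⁻ y, ENNReal.ofReal (2 ^ p) *
        (ENNReal.ofReal (1 * |f x - f y| ^ p * kernel s p x y) + (E x y + E y x)) := by
        unfold phaseEnergy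
        simp only [Measure.restrict_univ]
        exact lintegral_mono fun x => lintegral_mono fun y => hpt x y
    _ = ENNReal.ofReal (2 ^ p) * (phaseEnergy s p (fun _ _ => 1) univ f +
        2 * ∫⁻ x, ∫⁻ y, E x y) := by
        unfold phaseEnergy
        simp only [Measure.restrict_univ]
        rw [two_mul]
        nth_rw 2 [← hswap]
        rw [← lintegral_add_left hEm1, ← lintegral_add_left hfm.lintegral_prod_right',
          ← lintegral_const_mul' _ _ ENNReal.ofReal_ne_top]
        congr 1; ext x
        have hmx : Measurable fun y => ENNReal.ofReal (1 * |f x - f y| ^ p * kernel s p x y) := by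
          have := measurable_kernel_right s p x
          fun_prop
        rw [lintegral_const_mul' _ _ ENNReal.ofReal_ne_top, ← lintegral_add_left (hEx x),
          ← lintegral_add_left hmx]
    _ ≤ _ := by gcongr

/-- The modular of a cut off truncation is controlled by that of the function. -/
lemma exists_sobolevModular_cutoff_le (hN : 0 < N) (hs : s ∈ Ioo (0 : ℝ) 1) (hp : 1 ≤ p)
    {B : Set (Sp N)} (hB : MeasurableSet B) (hBv : volume B < ⊤)
    (hζm : Measurable ζ) (hζ0 : ∀ x, 0 ≤ ζ x) (hζ1 : ∀ x, ζ x ≤ 1) (hζB : ∀ x, x ∉ B → ζ x = 0)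
    {L : ℝ} (hL : ∀ x y, |ζ x - ζ y| ≤ L * ‖x - y‖) (k : ℝ) :
    ∃ A D : ℝ≥0∞, A < ⊤ ∧ D < ⊤ ∧ ∀ (f : Sp N → ℝ) (c : ℝ), AEMeasurable f volume → 0 ≤ c →
      c ≤ 1 → sobolevModular s p (fun x => c * ζ x * posTrunc f k x) ≤
        A * sobolevModular s p f + D := by
  have hp0 : 0 < p := by linarith
  obtain ⟨C, hCt, hC⟩ := exists_lintegral_lipschitz_kernel_le hN hs hp0 L
  have hC' := hC ζ hζ0 hζ1 hL
  set κ : ℝ≥0∞ := ENNReal.ofReal (2 ^ p) with hκ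
  have hκt : κ < ⊤ := ENNReal.ofReal_lt_top
  set V : ℝ≥0∞ := ‖k‖ₑ ^ p * volume B with hV
  have hVt : V < ⊤ := ENNReal.mul_lt_top (ENNReal.rpow_lt_top_of_nonneg hp0.le (by simp)) hBv
  refine ⟨(1 + κ * (2 * C)) * κ + κ, (1 + κ * (2 * C)) * (κ * V), ?_, ?_, ?_⟩
  · finiteness
  · finiteness
  intro f c hf hc0 hc1
  wlog hfm : Measurable f generalizing f
  · obtain ⟨f', hf', hff'⟩ := hf
    rw [sobolevModular_congr_ae hff', sobolevModular_congr_ae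
      (f := fun x => c * ζ x * posTrunc f k x) (h := fun x => c * ζ x * posTrunc f' k x)
      (by filter_upwards [hff'] with x hx; simp only [posTrunc, hx])]
    exact this f' hf'.aemeasurable hf'
  have hw0 := posTrunc_nonneg f k
  set W := ∫⁻ x in B, ENNReal.ofReal (posTrunc f k x ^ p) with hW
  have hWle : W ≤ κ * ((∫⁻ x, ‖f x‖ₑ ^ p) + V) := by
    calc W ≤ ∫⁻ x in B, κ * (‖f x‖ₑ ^ p + ‖k‖ₑ ^ p) := by
          refine lintegral_mono fun x => ?_
          rw [← ofReal_rpow_abs hp0.le, ← ofReal_rpow_abs hp0.le,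
            ← ENNReal.ofReal_add (by positivity) (by positivity),
            ← ENNReal.ofReal_mul (by positivity)]
          apply ENNReal.ofReal_le_ofReal
          refine le_trans ?_ (abs_sub_rpow_le_two hp (f x) k)
          refine Real.rpow_le_rpow (hw0 x) ?_ hp0.le
          exact max_le (le_abs_self _) (abs_nonneg _)
      _ = κ * ((∫⁻ x in B, ‖f x‖ₑ ^ p) + V) := by
          rw [lintegral_const_mul' _ _ hκt.ne, lintegral_add_left (by fun_prop), setLIntegral_const]
      _ ≤ _ := by gcongr; exact Measure.restrict_le_self
  have h1 : ∫⁻ x, ‖c * ζ x * posTrunc f k x‖ₑ ^ p ≤ W := by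
    rw [hW, ← lintegral_indicator hB]
    refine lintegral_mono fun x => ?_
    rw [← ofReal_rpow_abs hp0.le]
    by_cases hx : x ∈ B
    · rw [indicator_of_mem hx]
      apply ENNReal.ofReal_le_ofReal
      refine Real.rpow_le_rpow (abs_nonneg _) ?_ hp0.le
      have h0 : 0 ≤ c * ζ x := mul_nonneg hc0 (hζ0 x)
      rw [abs_of_nonneg (mul_nonneg h0 (hw0 x))]
      exact mul_le_of_le_one_left (hw0 x) (mul_le_one₀ hc1 (hζ0 x) (hζ1 x))
    · rw [hζB x hx]
      simp [Real.zero_rpow hp0.ne']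
  have h2 := phaseEnergy_cutoff_le hp hB hζm hζ0 hζ1 hζB hC' hfm k hc0 hc1
  unfold sobolevModular
  set G := phaseEnergy s p (fun _ _ => 1) univ f
  set F := ∫⁻ x, ‖f x‖ₑ ^ p
  calc _ ≤ W + κ * (G + 2 * (C * W)) := add_le_add h1 h2
    _ = (1 + κ * (2 * C)) * W + κ * G := by ring
    _ ≤ (1 + κ * (2 * C)) * (κ * (F + V)) + κ * G := by gcongr
    _ ≤ (1 + κ * (2 * C)) * (κ * (F + V)) + κ * G +
          ((1 + κ * (2 * C)) * κ * G + κ * F) := le_self_add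
    _ = _ := by ring

end

section

variable {N : ℕ} {Ω B : Set (Sp N)} {T : ℝ≥0∞} {u : Sp N → ℝ → ℝ} {u₀ : Sp N → ℝ} {s p : ℝ}
  {ζ : Sp N → ℝ} {ψ : ℝ → ℝ} {k α β L : ℝ}

lemma memLpSobolev_cutoff_truncation (hN : 0 < N) (hs : s ∈ Ioo (0 : ℝ) 1) (hp : 1 ≤ p)
    (hu : MemLpSobolev s p T u) (hB : MeasurableSet B) (hBv : volume B < ⊤)
    (hζm : Measurable ζ) (hζ0 : ∀ x, 0 ≤ ζ x) (hζ1 : ∀ x, ζ x ≤ 1) (hζB : ∀ x, x ∉ B → ζ x = 0)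
    (hL : ∀ x y, |ζ x - ζ y| ≤ L * ‖x - y‖) (hψ : IsTimeCutoff α β ψ) :
    MemLpSobolev s p T fun x t => ψ t * ζ x * truncation u k x t := by
  have hp0 : 0 < p := by linarith
  obtain ⟨A, D, hA, hD, h⟩ := exists_sobolevModular_cutoff_le hN hs hp hB hBv hζm hζ0 hζ1 hζB hL k
  rw [memLpSobolev_iff hN hs.1 hp] at *
  refine ⟨?_, ?_⟩
  · exact ((hψ.contDiff.continuous.measurable.comp measurable_snd).mul
      (hζm.comp measurable_fst)).aemeasurable.mul ((hu.1.sub_const k).max aemeasurable_const)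
  obtain ⟨u', hu', huu'⟩ := exists_measurable_slices hu.1
  have hle : ∀ᵐ t ∂(volume.restrict (timeInterval T)),
      sobolevModular s p (fun x => ψ t * ζ x * truncation u k x t) ≤
        A * sobolevModular s p (fun x => u x t) + (Icc α β).indicator (fun _ => D) t := by
    filter_upwards [huu'] with t ht
    by_cases hts : t ∈ Icc α β
    · rw [indicator_of_mem hts]
      exact h (fun x => u x t) (ψ t) ⟨_, hu'.comp measurable_prodMk_right, ht⟩ (hψ.nonneg t)
        (hψ.le_one t)
    · have h0 : ψ t = 0 := hψ.eq_zero t fun h' => hts (Ioo_subset_Icc_self h')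
      have : sobolevModular s p (fun x => ψ t * ζ x * truncation u k x t) = 0 := by
        simp [h0, sobolevModular, phaseEnergy, Real.zero_rpow hp0.ne', hp0]
      rw [this]
      exact zero_le
  refine (lintegral_mono_ae hle).trans_lt ?_
  rw [lintegral_add_right _ (measurable_const.indicator measurableSet_Icc),
    lintegral_const_mul' _ _ hA.ne]
  refine ENNReal.add_lt_top.2 ⟨ENNReal.mul_lt_top hA hu.2, ?_⟩
  refine (setLIntegral_le_lintegral _ _).trans_lt ?_
  rw [lintegral_indicator measurableSet_Icc, setLIntegral_const]
  exact ENNReal.mul_lt_top hD (by simp)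

lemma MemContL2.testMap (hΩ : Bornology.IsBounded Ω) (hc : MemContL2 Ω T u)
    (hζm : Measurable ζ) (hζ0 : ∀ x, 0 ≤ ζ x) (hζ1 : ∀ x, ζ x ≤ 1) (hψ : IsTimeCutoff α β ψ) :
    MemContL2 Ω T (testMap ζ ψ k u) := by
  have hfin := isFiniteMeasure_restrict_of_isBounded hΩ
  have hw : ∀ t ∈ closedTimeInterval T,
      MemLp (fun x => truncation u k x t) 2 (volume.restrict Ω) := fun t ht =>
    ((hc.memLp t ht).sub (memLp_const k)).pos_part
  have hmul : ∀ (c : ℝ) {f : Sp N → ℝ}, AEStronglyMeasurable f (volume.restrict Ω) →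
      AEStronglyMeasurable (fun x => c * ζ x * f x) (volume.restrict Ω) := fun c f hf =>
    (hζm.const_mul c).aestronglyMeasurable.mul hf
  have hnorm : ∀ (c : ℝ) (f : Sp N → ℝ),
      eLpNorm (fun x => c * ζ x * f x) 2 (volume.restrict Ω) ≤
        ‖c‖ₑ * eLpNorm f 2 (volume.restrict Ω) := fun c f => by
    rw [← eLpNorm_const_smul]
    refine eLpNorm_mono fun x => ?_
    rw [Pi.smul_apply, smul_eq_mul, norm_mul, norm_mul, norm_mul, Real.norm_eq_abs (ζ x),
      abs_of_nonneg (hζ0 x)]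
    exact mul_le_mul_of_nonneg_right (mul_le_of_le_one_right (norm_nonneg _) (hζ1 x))
      (norm_nonneg _)
  refine ⟨fun t ht => ?_, fun t ht => ?_⟩
  · exact (hc.memLp t ht).sub ⟨hmul _ (hw t ht).1,
      (hnorm _ _).trans_lt (ENNReal.mul_lt_top (by simp) (hw t ht).2)⟩
  · have hlim : Tendsto (fun τ => eLpNorm (fun x => u x τ - u x t) 2 (volume.restrict Ω) +
        (eLpNorm (fun x => u x τ - u x t) 2 (volume.restrict Ω) +
          ‖ψ τ - ψ t‖ₑ * eLpNorm (fun x => truncation u k x t) 2 (volume.restrict Ω)))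
        (𝓝[closedTimeInterval T] t) (𝓝 0) := by
      have h1 : Tendsto (fun τ => ‖ψ τ - ψ t‖ₑ) (𝓝[closedTimeInterval T] t) (𝓝 0) := by
        have : Continuous fun τ => ‖ψ τ - ψ t‖ₑ :=
          (hψ.contDiff.continuous.sub continuous_const).enorm
        have h2 := (this.tendsto t).mono_left (nhdsWithin_le_nhds (s := closedTimeInterval T))
        simpa using h2
      have h2 := ENNReal.Tendsto.mul_const (b := eLpNorm (fun x => truncation u k x t) 2
        (volume.restrict Ω)) h1 (Or.inr (hw t ht).2.ne)
      have := (hc.tendsto t ht).add ((hc.tendsto t ht).add h2)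
      simpa using this
    refine tendsto_of_tendsto_of_tendsto_of_le_of_le' tendsto_const_nhds hlim
      (Eventually.of_forall fun _ => zero_le) ?_
    filter_upwards [self_mem_nhdsWithin] with τ hτ
    have hd := ((hc.memLp τ hτ).sub (hc.memLp t ht)).1
    have hwd := ((hw τ hτ).sub (hw t ht)).1
    have e : (fun x => NonlocalDoublePhase.testMap ζ ψ k u x τ -
        NonlocalDoublePhase.testMap ζ ψ k u x t) =
        (fun x => u x τ - u x t) - ((fun x => ψ τ * ζ x * (truncation u k x τ - truncation u k x t))
          + fun x => (ψ τ - ψ t) * ζ x * truncation u k x t) := by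
      ext x; simp only [NonlocalDoublePhase.testMap, Pi.sub_apply, Pi.add_apply]; ring
    rw [e]
    refine (eLpNorm_sub_le hd ((hmul _ hwd).add (hmul _ (hw t ht).1)) (by norm_num)).trans ?_
    refine add_le_add le_rfl ((eLpNorm_add_le (hmul _ hwd) (hmul _ (hw t ht).1)
      (by norm_num)).trans (add_le_add ?_ (hnorm _ _)))
    refine eLpNorm_mono fun x => ?_
    rw [norm_mul, Real.norm_eq_abs (ψ τ * ζ x), abs_of_nonneg (mul_nonneg (hψ.nonneg _) (hζ0 _))]
    refine (mul_le_of_le_one_left (norm_nonneg _)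
      (mul_le_one₀ (hψ.le_one _) (hζ0 _) (hζ1 _))).trans ?_
    simp only [truncation, Real.norm_eq_abs]
    refine (abs_max_sub_max_le_abs _ _ _).trans (le_of_eq ?_)
    congr 1; ring

lemma InClass.testMap (hN : 0 < N) (hs : s ∈ Ioo (0 : ℝ) 1) (hp : 1 ≤ p)
    (hΩ : Bornology.IsBounded Ω) (hu : InClass s p Ω T u₀ u) (hB : MeasurableSet B) (hBΩ : B ⊆ Ω)
    (hζm : Measurable ζ) (hζ0 : ∀ x, 0 ≤ ζ x) (hζ1 : ∀ x, ζ x ≤ 1) (hζB : ∀ x, x ∉ B → ζ x = 0)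
    (hL : ∀ x y, |ζ x - ζ y| ≤ L * ‖x - y‖) (hψ : IsTimeCutoff α β ψ) :
    InClass s p Ω T u₀ (testMap ζ ψ k u) := by
  have hφ := memLpSobolev_cutoff_truncation (k := k) hN hs hp hu.memLpSobolev hB
    ((measure_mono hBΩ).trans_lt hΩ.measure_lt_top) hζm hζ0 hζ1 hζB hL hψ
  refine ⟨hu.memLpSobolev.sub hN hs.1 hp hφ, hu.memContL2.testMap hΩ hζm hζ0 hζ1 hψ, ?_, ?_⟩
  · have := hu.sub_memLpSobolev.sub hN hs.1 hp hφ
    convert! this using 3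
    simp only [NonlocalDoublePhase.testMap]; ring
  · filter_upwards [hu.eq_outside] with t ht
    filter_upwards [ht] with x hx hxΩ
    have := hx hxΩ
    simp only [NonlocalDoublePhase.testMap, hζB x fun h => hxΩ (hBΩ h)]
    linarith

end

/-! ### The cutoff in time -/

/-- A cutoff given on `(a,t₀)`, extended by `0` before `α` and by `1` after `γ`, and then cut off
smoothly between `t₀` and some later time `β < T`. The derivative on `(α,t₀)` does not change. -/
lemma exists_isTimeCutoff {T : ℝ≥0∞} {a α γ t₀ : ℝ} {ψ : ℝ → ℝ} (haα : a < α) (hαγ : α < γ)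
    (hγ : γ < t₀) (hT : Icc a t₀ ⊆ timeInterval T) (hψ : ContDiffOn ℝ 1 ψ (Ioo a t₀))
    (h0 : ∀ t ∈ Ioo a α, ψ t = 0) (h1 : ∀ t ∈ Ioo γ t₀, ψ t = 1)
    (h01 : ∀ t ∈ Ioo a t₀, 0 ≤ ψ t ∧ ψ t ≤ 1) :
    ∃ (β : ℝ) (η : ℝ → ℝ), Icc α β ⊆ timeInterval T ∧ IsTimeCutoff α β η ∧
      (∀ t ∈ Ioo α t₀, η t = ψ t) ∧ ∀ t ∈ Ioc γ t₀, η t = 1 := by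
  have ht₀ : t₀ ∈ timeInterval T := hT (right_mem_Icc.2 (by linarith))
  have hαT : α ∈ timeInterval T := hT ⟨haα.le, by linarith⟩
  obtain ⟨α', β, hα', hβ, hsub⟩ := exists_larger_Icc_subset_timeInterval hαT ht₀
  obtain ⟨a', ha1, ha2⟩ := exists_between haα
  obtain ⟨γ', hγ1, hγ2⟩ := exists_between hγ
  set φ : ℝ → ℝ := fun t => if t ≤ a' then 0 else if γ' ≤ t then 1 else ψ t with hφ
  have e0 : ∀ t ∈ Iio α, φ t = 0 := fun t (ht : t < α) => by
    simp only [hφ]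
    split_ifs with h h'
    · rfl
    · linarith
    · exact h0 t ⟨by linarith, ht⟩
  have eψ : ∀ t ∈ Ioo a t₀, φ t = ψ t := fun t ht => by
    simp only [hφ]
    split_ifs with h h'
    · exact (h0 t ⟨ht.1, by linarith⟩).symm
    · exact (h1 t ⟨by linarith, ht.2⟩).symm
    · rfl
  have e1 : ∀ t ∈ Ioi γ, φ t = 1 := fun t (ht : γ < t) => by
    simp only [hφ]
    split_ifs with h h'
    · linarith
    · rfl
    · exact h1 t ⟨ht, by linarith⟩
  have hφC : ContDiff ℝ 1 φ := by
    rw [contDiff_iff_contDiffAt]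
    intro t
    rcases lt_or_ge t α with h | h
    · exact contDiffAt_const.congr_of_eventuallyEq (eventually_of_mem (Iio_mem_nhds h) e0)
    rcases lt_or_ge γ t with h' | h'
    · exact contDiffAt_const.congr_of_eventuallyEq (eventually_of_mem (Ioi_mem_nhds h') e1)
    · have hmem : Ioo a t₀ ∈ 𝓝 t := Ioo_mem_nhds (by linarith) (by linarith)
      exact (hψ.contDiffAt hmem).congr_of_eventuallyEq (eventually_of_mem hmem eψ)
  have hφ01 : ∀ t, 0 ≤ φ t ∧ φ t ≤ 1 := fun t => by
    simp only [hφ]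
    split_ifs with h h'
    · simp
    · simp
    · exact h01 t ⟨by linarith, by linarith⟩
  have hφα : ∀ t ≤ α, φ t = 0 := fun t ht => by
    have hcl : closure (Iio α) ⊆ {t | φ t = 0} :=
      closure_minimal e0 (isClosed_eq hφC.continuous continuous_const)
    rw [closure_Iio] at hcl
    exact hcl ht
  set χ : ℝ → ℝ := fun t => Real.smoothTransition ((β - t) / (β - t₀)) with hχ
  have hd : 0 < β - t₀ := by linarith
  have hχC : ContDiff ℝ 1 χ := Real.smoothTransition.contDiff.comp (by fun_prop)
  have hχ1 : ∀ t ≤ t₀, χ t = 1 := fun t ht =>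
    Real.smoothTransition.one_of_one_le (by rw [le_div_iff₀ hd]; linarith)
  have hχ0 : ∀ t, β ≤ t → χ t = 0 := fun t ht =>
    Real.smoothTransition.zero_of_nonpos (div_nonpos_of_nonpos_of_nonneg (by linarith) hd.le)
  refine ⟨β, fun t => φ t * χ t, Icc_subset_timeInterval hαT
    (hsub ⟨by linarith, le_rfl⟩), ⟨hφC.mul hχC, fun t => ?_, fun t => ?_, fun t ht => ?_⟩,
    fun t ht => ?_, fun t ht => ?_⟩
  · exact mul_nonneg (hφ01 t).1 (Real.smoothTransition.nonneg _)
  · exact mul_le_one₀ (hφ01 t).2 (Real.smoothTransition.nonneg _)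
      (Real.smoothTransition.le_one _)
  · rcases le_or_gt t α with h | h
    · simp [hφα t h]
    · simp [hχ0 t (not_lt.1 fun h' => ht ⟨h, h'⟩)]
  · simp [hχ1 t ht.2.le, eψ t ⟨by linarith [ht.1], ht.2⟩]
  · simp [hχ1 t ht.2, e1 t ht.1]

/-! ### The energy estimate for the double phase -/

section

variable {N : ℕ} {s s' p q : ℝ} {a : Sp N → Sp N → ℝ}

lemma energy_eq_of_measurable
    (ha0 : ∀ x y, 0 ≤ a x y) (A : Set (Sp N)) {f : Sp N → ℝ} (hf : Measurable f) :
    energy s s' p q a A f =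
      phaseEnergy s p (fun _ _ => 1) A f + phaseEnergy s' q a A f := by
  have hm : Measurable fun z : Sp N × Sp N =>
      ENNReal.ofReal (1 * |f z.1 - f z.2| ^ p * kernel s p z.1 z.2) := by fun_prop
  have hmx : ∀ x, Measurable fun y =>
      ENNReal.ofReal (1 * |f x - f y| ^ p * kernel s p x y) := fun x => by
    have := measurable_kernel_right s p x
    fun_prop
  unfold energy phaseEnergy
  rw [← lintegral_add_left (hm.lintegral_prod_right' (ν := volume.restrict A))]
  congr 1; ext x
  rw [← lintegral_add_left (hmx x)]
  congr 1; ext y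
  have h1 := kernel_nonneg s p x y
  have h2 := kernel_nonneg s' q x y
  have h3 := ha0 x y
  rw [← ENNReal.ofReal_add (by positivity) (by positivity)]
  congr 1
  simp only [H, kernel, mul_inv, div_eq_mul_inv]
  ring

lemma energy_congr_ae {A : Set (Sp N)} {f h : Sp N → ℝ} (hfh : f =ᵐ[volume] h) :
    energy s s' p q a A f = energy s s' p q a A h := by
  unfold energy
  refine lintegral_congr_ae ?_
  filter_upwards [ae_restrict_of_ae hfh] with x hx
  refine lintegral_congr_ae ?_
  filter_upwards [ae_restrict_of_ae hfh] with y hy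
  rw [hx, hy]

/-- The double phase energy is the sum of the energies of its two phases. -/
lemma energy_eq (ha0 : ∀ x y, 0 ≤ a x y) (A : Set (Sp N)) {f : Sp N → ℝ} (hf : AEMeasurable f volume) :
    energy s s' p q a A f =
      phaseEnergy s p (fun _ _ => 1) A f + phaseEnergy s' q a A f := by
  obtain ⟨f', hf', h⟩ := hf
  rw [energy_congr_ae h, phaseEnergy_congr_ae h, phaseEnergy_congr_ae h]
  exact energy_eq_of_measurable ha0 A hf'

lemma aemeasurable_energy {T : ℝ≥0∞} {v : Sp N → ℝ → ℝ}
    (ha : Measurable fun z : Sp N × Sp N => a z.1 z.2) (ha0 : ∀ x y, 0 ≤ a x y) (A : Set (Sp N))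
    (hv : AEMeasurable (fun z : Sp N × ℝ => v z.1 z.2) (volume.restrict (univ ×ˢ timeInterval T))) :
    AEMeasurable (fun t => energy s s' p q a A fun x => v x t)
      (volume.restrict (timeInterval T)) := by
  obtain ⟨v', hv', h⟩ := exists_measurable_slices hv
  refine ((aemeasurable_phaseEnergy (σ := s) (m := p) (b := fun _ _ => 1) measurable_const A hv).add
    (aemeasurable_phaseEnergy (σ := s') (m := q) ha A hv)).congr ?_
  filter_upwards [h] with t ht
  exact (energy_eq ha0 A ⟨_, hv'.comp measurable_prodMk_right, ht⟩).symm

/-- The error of one phase at a fixed time, for the truncation `w`. -/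
noncomputable def phaseError (σ m C r R : ℝ) (x₀ : Sp N) (w : Sp N → ℝ) : ℝ≥0∞ :=
  ENNReal.ofReal (C * (R ^ (m * (1 - σ)) / (R - r) ^ m)) *
      (∫⁻ x in Metric.ball x₀ R, ENNReal.ofReal (w x ^ m)) +
    ENNReal.ofReal (C * (R / r) ^ (σ * m) * (R ^ N / (R - r) ^ ((N : ℝ) + σ * m))) *
      (∫⁻ x in Metric.ball x₀ R, ENNReal.ofReal (w x)) * tailSlice σ m w x₀ r

lemma phaseError_mono {σ m C C' r R : ℝ} (hr : 0 < r) (hrR : r < R) (hC : C ≤ C') (x₀ : Sp N)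
    (w : Sp N → ℝ) : phaseError σ m C r R x₀ w ≤ phaseError σ m C' r R x₀ w := by
  have hR : 0 < R := hr.trans hrR
  have hd : 0 < R - r := by linarith
  unfold phaseError
  gcongr

/-- The energy estimate at a fixed time. Both phases use the same cutoff power `η^q`, which is
possible since `p ≤ q`. -/
lemma exists_energy_sub_cutoff_le (hN : 0 < N) {M : ℝ} (hs : s ∈ Ioo (0 : ℝ) 1)
    (hs' : s' ∈ Ioo (0 : ℝ) 1) (hp : 1 < p) (hpq : p ≤ q) (hM : 0 ≤ M) :
    ∃ C : ℝ, 1 ≤ C ∧ ∀ a : Sp N → Sp N → ℝ, (Measurable fun z : Sp N × Sp N => a z.1 z.2) →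
      (∀ x y, 0 ≤ a x y ∧ a x y ≤ M) →
      ∀ (x₀ : Sp N) (r R k ψ : ℝ) (f : Sp N → ℝ), 0 < r → r < R → 0 ≤ ψ → ψ ≤ 1 →
        AEMeasurable f volume →
        energy s s' p q a univ (fun x => f x - ψ * cutoff x₀ r R x ^ q * posTrunc f k x) +
            ENNReal.ofReal ψ * energy s s' p q a (Metric.ball x₀ r) (posTrunc f k) ≤
          energy s s' p q a univ f + (phaseError s p C r R x₀ (posTrunc f k) +
            phaseError s' q C r R x₀ (posTrunc f k)) := by
  obtain ⟨C₁, hC₁, h₁⟩ := exists_phaseEnergy_sub_cutoff_le hN hs hp hpq zero_le_one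
  obtain ⟨C₂, hC₂, h₂⟩ := exists_phaseEnergy_sub_cutoff_le hN hs' (hp.trans_le hpq) le_rfl hM
  refine ⟨max 1 (max C₁ C₂), le_max_left _ _, fun a ha haM x₀ r R k ψ f hr hrR hψ0 hψ1 hf => ?_⟩
  wlog hfm : Measurable f generalizing f
  · obtain ⟨f', hf', h⟩ := hf
    have hw : posTrunc f k =ᵐ[volume] posTrunc f' k := by
      filter_upwards [h] with x hx; simp only [posTrunc, hx]
    have hv : (fun x => f x - ψ * cutoff x₀ r R x ^ q * posTrunc f k x) =ᵐ[volume]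
        fun x => f' x - ψ * cutoff x₀ r R x ^ q * posTrunc f' k x := by
      filter_upwards [h, hw] with x hx hx'; rw [hx, hx']
    have he : ∀ σ m C, phaseError σ m C r R x₀ (posTrunc f k) =
        phaseError σ m C r R x₀ (posTrunc f' k) := fun σ m C => by
      unfold phaseError tailSlice
      congr 1
      · congr 1
        exact lintegral_congr_ae (by filter_upwards [ae_restrict_of_ae hw] with x hx; rw [hx])
      · congr 2
        · exact lintegral_congr_ae (by filter_upwards [ae_restrict_of_ae hw] with x hx; rw [hx])
        · exact lintegral_congr_ae (by filter_upwards [ae_restrict_of_ae hw] with x hx; rw [hx])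
    rw [energy_congr_ae h, energy_congr_ae hw, energy_congr_ae hv, he, he]
    exact this f' hf'.aemeasurable hf'
  have hwm : Measurable (posTrunc f k) := (hfm.sub_const k).max measurable_const
  have hcm : Measurable fun x => cutoff x₀ r R x ^ q := continuous_cutoff.measurable.pow_const q
  have hvm : Measurable fun x => f x - ψ * cutoff x₀ r R x ^ q * posTrunc f k x :=
    hfm.sub ((hcm.const_mul ψ).mul hwm)
  have ha0 := fun x y => (haM x y).1
  rw [energy_eq_of_measurable ha0 _ hvm, energy_eq_of_measurable ha0 _ hwm,
    energy_eq_of_measurable ha0 _ hfm]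
  have e₁ := (h₁ (fun _ _ => 1) measurable_const (fun _ _ => ⟨zero_le_one, le_rfl⟩) x₀ r R k ψ f
    hr hrR hψ0 hψ1 hfm).trans (add_le_add le_rfl (phaseError_mono hr hrR
      ((le_max_left C₁ C₂).trans (le_max_right 1 _)) x₀ _))
  have e₂ := (h₂ a ha haM x₀ r R k ψ f hr hrR hψ0 hψ1 hfm).trans (add_le_add le_rfl
    (phaseError_mono hr hrR ((le_max_right C₁ C₂).trans (le_max_right 1 _)) x₀ _))
  rw [mul_add, add_add_add_comm]
  exact (add_le_add e₁ e₂).trans (le_of_eq (add_add_add_comm _ _ _ _))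

end

/-! ### The energy inequality for the solution -/

lemma add_ofReal_le_of_coe_le {A B : ℝ≥0∞} {c x y : ℝ} (h : (A : EReal) ≤ B + (c : EReal))
    (hx : 0 ≤ x) (hy : 0 ≤ y) (hc : c + x ≤ y) : A + ENNReal.ofReal x ≤ B + ENNReal.ofReal y := by
  rw [← EReal.coe_ennreal_le_coe_ennreal_iff, EReal.coe_ennreal_add, EReal.coe_ennreal_add,
    EReal.coe_ennreal_ofReal, EReal.coe_ennreal_ofReal, max_eq_left hx, max_eq_left hy]
  calc (A : EReal) + x ≤ B + (c : EReal) + x := by gcongr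
    _ = B + ((c + x : ℝ) : EReal) := by rw [EReal.coe_add, add_assoc]
    _ ≤ B + (y : EReal) := by gcongr

/-- Two opposite inequalities between `A` and `B` may be added and `A`, `B` cancelled. No finiteness
of `B` is needed: if `B = ⊤`, the remaining error `Z` is infinite. -/
lemma add_le_add_of_crossed_le {A B G X Y Z : ℝ≥0∞} (hA : A ≠ ⊤) (h₁ : A + X ≤ B + Y)
    (h₂ : B + G ≤ A + Z) : G + X ≤ Z + Y := by
  rcases eq_or_ne Z ⊤ with rfl | hZ
  · simp
  have hB : B ≠ ⊤ := ne_top_of_le_ne_top (ENNReal.add_ne_top.2 ⟨hA, hZ⟩) (le_self_add.trans h₂)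
  have h := add_le_add h₁ h₂
  rw [show A + X + (B + G) = A + B + (G + X) by ring,
    show B + Y + (A + Z) = A + B + (Z + Y) by ring] at h
  exact (ENNReal.add_le_add_iff_left (ENNReal.add_ne_top.2 ⟨hA, hB⟩)).1 h

section

variable {N : ℕ} {s s' p q : ℝ} {a : Sp N → Sp N → ℝ} {Ω : Set (Sp N)} {T : ℝ≥0∞}
  {u₀ : Sp N → ℝ} {u g : Sp N → ℝ → ℝ} {ζ : Sp N → ℝ} {ψ : ℝ → ℝ} {k α β τ : ℝ}

/-- The solution has finite energy up to every time before `T`: the initial datum is an admissible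
comparison map. -/
lemma IsVariationalSolution.lintegral_energy_lt_top (hN : 0 < N) (hs : 0 < s) (hp : 1 ≤ p)
    (hΩm : MeasurableSet Ω) (hΩ : Bornology.IsBounded Ω) (hd : IsData s s' p q a Ω u₀)
    (hu : IsVariationalSolution s s' p q a Ω T u₀ u) (hτ : τ ∈ timeInterval T) :
    ∫⁻ t in Ioo 0 τ, energy s s' p q a univ (fun x => u x t) < ⊤ := by
  have h := hu.variational _ _ (hu.inClass.const hN hs hp hd.memLp)
    (isWeakTimeDerivL2_const hΩm hΩ hd.memLp) τ hτ
  rw [setLIntegral_const] at h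
  generalize (∫ z in Ω ×ˢ Ioo 0 τ, (0 : ℝ) * (u₀ z.1 - u z.1 z.2)) +
    1 / 2 * (∫ x in Ω, (u₀ x - u x 0) ^ 2) - 1 / 2 * (∫ x in Ω, (u₀ x - u x τ) ^ 2) = c at h
  have h1 := add_ofReal_le_of_coe_le h le_rfl (abs_nonneg c) (by simpa using le_abs_self c)
  rw [ENNReal.ofReal_zero, add_zero] at h1
  refine h1.trans_lt (ENNReal.add_lt_top.2 ⟨?_, ENNReal.ofReal_lt_top⟩)
  exact ENNReal.mul_lt_top hd.energy_lt_top (by simp)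

/-- The variational inequality tested with the comparison map. -/
lemma IsVariationalSolution.lintegral_energy_add_le (hΩo : IsOpen Ω) (hΩ : Bornology.IsBounded Ω)
    (hu : IsVariationalSolution s s' p q a Ω T u₀ u) (hg : IsWeakTimeDerivL2 Ω T u g)
    (hv : InClass s p Ω T u₀ (testMap ζ ψ k u))
    (hζ : Measurable ζ) (hζ0 : ∀ x, 0 ≤ ζ x) (hζ1 : ∀ x, ζ x ≤ 1)
    (hαβ : Icc α β ⊆ timeInterval T) (hψ : IsTimeCutoff α β ψ) (hτ : τ ∈ timeInterval T)
    (hατ : α < τ) (hα : α ∈ timeInterval T) :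
    (∫⁻ t in Ioo 0 τ, energy s s' p q a univ (fun x => u x t)) +
        ENNReal.ofReal (1 / 2) *
          (∫⁻ x in Ω, ENNReal.ofReal (ψ τ * ζ x * truncation u k x τ ^ 2)) ≤
      (∫⁻ t in Ioo 0 τ, energy s s' p q a univ (fun x => testMap ζ ψ k u x t)) +
        ENNReal.ofReal (1 / 2) * (∫⁻ t in Ioo α τ, ∫⁻ x in Ω,
          ENNReal.ofReal (ζ x * |deriv ψ t| * truncation u k x t ^ 2)) := by
  have hum := hu.inClass.memLpSobolev.aemeasurable
  have hc := hu.inClass.memContL2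
  have hfin := isFiniteMeasure_restrict_of_isBounded hΩ
  have h := hu.variational _ _ hv
    (isWeakTimeDerivL2_testMap hΩo hΩ hg hc hum hζ hζ0 hζ1 hαβ hψ) τ hτ
  rw [integral_testDeriv_mul hΩo hΩ hg hc hum hζ hζ0 hζ1 hαβ hψ hτ hατ hα] at h
  -- the comparison map starts from the initial values of `u`
  have hψ0 : ψ 0 = 0 := hψ.eq_zero 0 fun h' => (h'.1.trans hα.1).false
  have hv0 : ∫ x in Ω, (testMap ζ ψ k u x 0 - u x 0) ^ 2 = 0 := by
    simp [testMap, hψ0]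
  rw [hv0] at h
  have hατT : Icc α τ ⊆ timeInterval T := Icc_subset_timeInterval hα hτ
  have hw2 := memLp_truncation (k := k) hΩ (hc.memLp_two hum hατT)
  obtain ⟨C, hC0, hC⟩ := hψ.exists_deriv_bound
  have hI : ∀ κ : ℝ → ℝ, Continuous κ → (∀ t, |κ t| ≤ C) → IntegrableOn (fun z : Sp N × ℝ =>
      ζ z.1 * κ z.2 * truncation u k z.1 z.2 ^ 2) (Ω ×ˢ Icc α τ) := fun κ hκ hκC => by
    refine Integrable.bdd_mul (c := C) hw2.integrable_sq ?_ (ae_of_all _ fun z => ?_)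
    · exact (hζ.comp measurable_fst).aestronglyMeasurable.mul
        (hκ.comp continuous_snd).aestronglyMeasurable
    · rw [norm_mul, Real.norm_eq_abs, abs_of_nonneg (hζ0 _)]
      exact (mul_le_of_le_one_left (norm_nonneg _) (hζ1 _)).trans (hκC _)
  have hI1 := hI _ hψ.continuous_deriv hC
  have hI2 := hI (fun t => |deriv ψ t|) hψ.continuous_deriv.abs (fun t => by simpa using hC t)
  have hI3 : Integrable (fun x => ψ τ * ζ x * truncation u k x τ ^ 2) (volume.restrict Ω) := by
    have hwτ : MemLp (fun x => truncation u k x τ) 2 (volume.restrict Ω) :=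
      ((hc.memLp τ (timeInterval_subset_closed T hτ)).sub (memLp_const k)).pos_part
    refine hwτ.integrable_sq.bdd_mul (c := 1) (hζ.const_mul _).aestronglyMeasurable
      (ae_of_all _ fun x => ?_)
    rw [Real.norm_eq_abs, abs_of_nonneg (mul_nonneg (hψ.nonneg _) (hζ0 _))]
    exact mul_le_one₀ (hψ.le_one _) (hζ0 _) (hζ1 _)
  have hpos3 : ∀ x, 0 ≤ ψ τ * ζ x * truncation u k x τ ^ 2 := fun x =>
    mul_nonneg (mul_nonneg (hψ.nonneg _) (hζ0 _)) (sq_nonneg _)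
  have hpos2 : ∀ z : Sp N × ℝ, 0 ≤ ζ z.1 * |deriv ψ z.2| * truncation u k z.1 z.2 ^ 2 := fun z =>
    mul_nonneg (mul_nonneg (hζ0 _) (abs_nonneg _)) (sq_nonneg _)
  have hle : ∫ z in Ω ×ˢ Icc α τ, ζ z.1 * deriv ψ z.2 * truncation u k z.1 z.2 ^ 2 ≤
      ∫ z in Ω ×ˢ Icc α τ, ζ z.1 * |deriv ψ z.2| * truncation u k z.1 z.2 ^ 2 := by
    refine integral_mono hI1 hI2 fun z => ?_
    exact mul_le_mul_of_nonneg_right (mul_le_mul_of_nonneg_left (le_abs_self _) (hζ0 _))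
      (sq_nonneg _)
  have h1 := add_ofReal_le_of_coe_le h
    (x := 1 / 2 * ∫ x in Ω, ψ τ * ζ x * truncation u k x τ ^ 2)
    (y := 1 / 2 * ∫ z in Ω ×ˢ Icc α τ, ζ z.1 * |deriv ψ z.2| * truncation u k z.1 z.2 ^ 2)
    (mul_nonneg (by norm_num) (integral_nonneg hpos3))
    (mul_nonneg (by norm_num) (integral_nonneg hpos2)) (by linarith)
  rw [ENNReal.ofReal_mul (by norm_num), ENNReal.ofReal_mul (by norm_num),
    ofReal_integral_eq_lintegral_ofReal hI3 (ae_of_all _ hpos3),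
    ofReal_integral_eq_lintegral_ofReal hI2 (ae_of_all _ hpos2)] at h1
  have hI2m := hI2.1.aemeasurable.ennreal_ofReal
  rw [restrict_prod_eq] at h1 hI2m
  rwa [lintegral_prod_symm _ hI2m, Measure.restrict_congr_set Ioo_ae_eq_Icc.symm] at h1

/-- The energy inequality for the truncation: the finite energy of the solution cancels between
the variational inequality and the energy estimate at fixed times. -/
lemma IsVariationalSolution.lintegral_cutoff_energy_add_le (hN : 0 < N)
    (hs : s ∈ Ioo (0 : ℝ) 1) (hp : 1 < p) (hpq : p ≤ q)
    (hΩo : IsOpen Ω) (hΩ : Bornology.IsBounded Ω)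
    (ha : Measurable fun z : Sp N × Sp N => a z.1 z.2) (ha0 : ∀ x y, 0 ≤ a x y)
    (hd : IsData s s' p q a Ω u₀)
    (hu : IsVariationalSolution s s' p q a Ω T u₀ u) (hg : IsWeakTimeDerivL2 Ω T u g)
    {x₀ : Sp N} {r R : ℝ} (hrR : r < R) (hB : Metric.closedBall x₀ R ⊆ Ω)
    {Err : (Sp N → ℝ) → ℝ≥0∞}
    (hErr : ∀ (c : ℝ) (f : Sp N → ℝ), 0 ≤ c → c ≤ 1 → AEMeasurable f volume →
      energy s s' p q a univ (fun x => f x - c * cutoff x₀ r R x ^ q * posTrunc f k x) +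
          ENNReal.ofReal c * energy s s' p q a (Metric.ball x₀ r) (posTrunc f k) ≤
        energy s s' p q a univ f + Err (posTrunc f k))
    (hαβ : Icc α β ⊆ timeInterval T) (hψ : IsTimeCutoff α β ψ) (hτ : τ ∈ timeInterval T)
    (hατ : α < τ) (hα : α ∈ timeInterval T) :
    (∫⁻ t in Ioo α τ, ENNReal.ofReal (ψ t) *
          energy s s' p q a (Metric.ball x₀ r) (fun x => truncation u k x t)) +
        ENNReal.ofReal (1 / 2) * (∫⁻ x in Metric.ball x₀ r,
          ENNReal.ofReal (ψ τ * truncation u k x τ ^ 2)) ≤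
      (∫⁻ t in Ioo α τ, Err fun x => truncation u k x t) +
        ENNReal.ofReal (1 / 2) * (∫⁻ t in Ioo α τ, ∫⁻ x in Metric.ball x₀ R,
          ENNReal.ofReal (truncation u k x t ^ 2 * |deriv ψ t|)) := by
  have hq0 : 0 < q := by linarith
  have hum := hu.inClass.memLpSobolev.aemeasurable
  set ζ : Sp N → ℝ := fun x => cutoff x₀ r R x ^ q with hζdef
  have hζ : Measurable ζ := continuous_cutoff.measurable.pow_const q
  have hζ0 : ∀ x, 0 ≤ ζ x := fun x => Real.rpow_nonneg (cutoff_nonneg x) _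
  have hζ1 : ∀ x, ζ x ≤ 1 := fun x =>
    Real.rpow_le_one (cutoff_nonneg x) (cutoff_le_one x) hq0.le
  have hζB : ∀ x, x ∉ Metric.ball x₀ R → ζ x = 0 := fun x hx => by
    rw [Metric.mem_ball, not_lt] at hx
    simp only [hζdef]
    rw [cutoff_eq_zero hrR (by linarith), Real.zero_rpow hq0.ne']
  have hL : ∀ x y, |ζ x - ζ y| ≤ q * (2 / (R - r)) * ‖x - y‖ := fun x y => by
    refine (abs_rpow_sub_rpow_le (by linarith) (cutoff_nonneg x) (cutoff_le_one x)
      (cutoff_nonneg y) (cutoff_le_one y)).trans ?_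
    rw [mul_assoc]
    exact mul_le_mul_of_nonneg_left (abs_cutoff_sub_le hrR x y) hq0.le
  have hBΩ : Metric.ball x₀ R ⊆ Ω := Metric.ball_subset_closedBall.trans hB
  have hv : InClass s p Ω T u₀ (testMap ζ ψ k u) :=
    hu.inClass.testMap hN hs hp.le hΩ measurableSet_ball hBΩ hζ hζ0 hζ1 hζB hL hψ
  have hmain := hu.lintegral_energy_add_le hΩo hΩ hg hv hζ hζ0 hζ1 hαβ hψ hτ hατ hα
  have hfinE := hu.lintegral_energy_lt_top hN hs.1 hp.le hΩo.measurableSet hΩ hd hτ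
  have hIT : Ioo 0 τ ⊆ timeInterval T := fun t ht =>
    ⟨ht.1, (ENNReal.ofReal_le_ofReal ht.2.le).trans_lt hτ.2⟩
  -- the estimate at fixed times, integrated; before `α` the comparison map is `u`
  have hslice : (∫⁻ t in Ioo 0 τ, energy s s' p q a univ fun x => testMap ζ ψ k u x t) +
      (∫⁻ t in Ioo 0 τ, ENNReal.ofReal (ψ t) *
        energy s s' p q a (Metric.ball x₀ r) (fun x => truncation u k x t)) ≤
      (∫⁻ t in Ioo 0 τ, energy s s' p q a univ fun x => u x t) +
        ∫⁻ t in Ioo 0 τ, (Ioo α τ).indicator (fun t => Err fun x => truncation u k x t) t := by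
    have hm1 := (aemeasurable_energy (s := s) (s' := s') (p := p) (q := q) ha ha0 univ
      hv.memLpSobolev.aemeasurable).mono_set hIT
    have hm2 := (aemeasurable_energy (s := s) (s' := s') (p := p) (q := q) ha ha0 univ
      hum).mono_set hIT
    rw [← lintegral_add_left' hm1, ← lintegral_add_left' hm2]
    obtain ⟨u', hu', huu'⟩ := exists_measurable_slices hum
    refine lintegral_mono_ae ?_
    filter_upwards [ae_restrict_of_ae_restrict_of_subset hIT huu',
      ae_restrict_mem measurableSet_Ioo] with t ht htI
    by_cases htα : α < t
    · rw [indicator_of_mem (show t ∈ Ioo α τ from ⟨htα, htI.2⟩)]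
      exact hErr (ψ t) (fun x => u x t) (hψ.nonneg t) (hψ.le_one t)
        ⟨_, hu'.comp measurable_prodMk_right, ht⟩
    · have h0 : ψ t = 0 := hψ.eq_zero t fun h => htα h.1
      simp [testMap, h0]
  rw [setLIntegral_indicator measurableSet_Ioo,
    inter_eq_self_of_subset_left (Ioo_subset_Ioo_left hα.1.le)] at hslice
  have hsq : (∫⁻ x in Metric.ball x₀ r, ENNReal.ofReal (ψ τ * truncation u k x τ ^ 2)) ≤
      ∫⁻ x in Ω, ENNReal.ofReal (ψ τ * ζ x * truncation u k x τ ^ 2) := by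
    refine le_trans (le_of_eq ?_)
      (lintegral_mono_set ((Metric.ball_subset_ball hrR.le).trans hBΩ))
    refine setLIntegral_congr_fun measurableSet_ball fun x hx => ?_
    simp only [hζdef]
    rw [cutoff_eq_one hrR hx, Real.one_rpow, mul_one]
  have hdt : (∫⁻ t in Ioo α τ, ∫⁻ x in Ω,
      ENNReal.ofReal (ζ x * |deriv ψ t| * truncation u k x t ^ 2)) ≤
      ∫⁻ t in Ioo α τ, ∫⁻ x in Metric.ball x₀ R,
        ENNReal.ofReal (truncation u k x t ^ 2 * |deriv ψ t|) := by
    refine lintegral_mono fun t => ?_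
    calc ∫⁻ x in Ω, ENNReal.ofReal (ζ x * |deriv ψ t| * truncation u k x t ^ 2)
        ≤ ∫⁻ x, (Metric.ball x₀ R).indicator
            (fun x => ENNReal.ofReal (truncation u k x t ^ 2 * |deriv ψ t|)) x := by
          refine (setLIntegral_le_lintegral _ _).trans (lintegral_mono fun x => ?_)
          by_cases hx : x ∈ Metric.ball x₀ R
          · rw [indicator_of_mem hx, mul_comm (truncation u k x t ^ 2)]
            exact ENNReal.ofReal_le_ofReal (mul_le_mul_of_nonneg_right
              (mul_le_of_le_one_left (abs_nonneg _) (hζ1 x)) (sq_nonneg _))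
          · simp [hζB x hx]
      _ = _ := lintegral_indicator measurableSet_ball _
  have hG : (∫⁻ t in Ioo α τ, ENNReal.ofReal (ψ t) *
      energy s s' p q a (Metric.ball x₀ r) (fun x => truncation u k x t)) ≤
      ∫⁻ t in Ioo 0 τ, ENNReal.ofReal (ψ t) *
        energy s s' p q a (Metric.ball x₀ r) (fun x => truncation u k x t) :=
    lintegral_mono_set (Ioo_subset_Ioo_left hα.1.le)
  refine (add_le_add hG (mul_le_mul_right hsq _)).trans (le_trans ?_
    (add_le_add le_rfl (mul_le_mul_right hdt _)))
  exact add_le_add_of_crossed_le hfinE.ne hmain hslice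

end

/-! ### The error integrated in time -/

section

variable {N : ℕ} {w : Sp N → ℝ → ℝ} {x₀ : Sp N} {t₀ R τ : ℝ}

lemma cylinderNorm_rpow {m : ℝ} (hm : 1 ≤ m) (hw0 : ∀ x t, 0 ≤ w x t)
    (hw : AEMeasurable (fun z : Sp N × ℝ => w z.1 z.2)
      (volume.restrict (Metric.ball x₀ R ×ˢ Ioo (t₀ - τ) t₀))) :
    cylinderNorm m w x₀ t₀ R τ ^ m =
      ∫⁻ t in Ioo (t₀ - τ) t₀, ∫⁻ x in Metric.ball x₀ R, ENNReal.ofReal (w x t ^ m) := by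
  unfold cylinderNorm
  rw [eLpNorm_rpow_eq hm]
  rw [restrict_prod_eq] at hw ⊢
  rw [lintegral_prod_symm _ (hw.enorm.pow_const _)]
  refine lintegral_congr fun t => lintegral_congr fun x => ?_
  rw [← ofReal_rpow_abs (by linarith), abs_of_nonneg (hw0 x t)]

lemma ae_tailSlice_le {σ m r : ℝ} (hm : 1 < m) (I : Set ℝ) :
    ∀ᵐ t ∂(volume.restrict I), tailSlice σ m (fun x => w x t) x₀ r ≤
      tail m σ w x₀ r I ^ (m - 1) := by
  have hm1 : 0 < m - 1 := by linarith
  filter_upwards [ENNReal.ae_le_essSup (μ := volume.restrict I)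
    (fun t => tailSlice σ m (fun x => w x t) x₀ r ^ (1 / (m - 1)))] with t ht
  calc tailSlice σ m (fun x => w x t) x₀ r
      = (tailSlice σ m (fun x => w x t) x₀ r ^ (1 / (m - 1))) ^ (m - 1) := by
        rw [← ENNReal.rpow_mul, one_div, inv_mul_cancel₀ hm1.ne', ENNReal.rpow_one]
    _ ≤ _ := ENNReal.rpow_le_rpow ht hm1.le

/-- A measurable majorant of the error with explicit integral. Passing to the essential supremum of
the tail before integrating avoids the measurability of the tail in time. -/
lemma exists_phaseError_le {σ m C r : ℝ} (hm : 1 < m) (hw0 : ∀ x t, 0 ≤ w x t)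
    (hw : AEMeasurable (fun z : Sp N × ℝ => w z.1 z.2)
      (volume.restrict (Metric.ball x₀ R ×ˢ Ioo (t₀ - τ) t₀))) {I : Set ℝ}
    (hI : Ioo (t₀ - τ) t₀ ⊆ I) :
    ∃ b : ℝ → ℝ≥0∞, AEMeasurable b (volume.restrict (Ioo (t₀ - τ) t₀)) ∧
      (∀ᵐ t ∂(volume.restrict (Ioo (t₀ - τ) t₀)),
        phaseError σ m C r R x₀ (fun x => w x t) ≤ b t) ∧
      ∫⁻ t in Ioo (t₀ - τ) t₀, b t =
        ENNReal.ofReal (C * (R ^ (m * (1 - σ)) / (R - r) ^ m)) * cylinderNorm m w x₀ t₀ R τ ^ m +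
        ENNReal.ofReal (C * (R / r) ^ (σ * m) * (R ^ N / (R - r) ^ ((N : ℝ) + σ * m))) *
          cylinderNorm 1 w x₀ t₀ R τ * tail m σ w x₀ r I ^ (m - 1) := by
  have h1 : cylinderNorm 1 w x₀ t₀ R τ =
      ∫⁻ t in Ioo (t₀ - τ) t₀, ∫⁻ x in Metric.ball x₀ R, ENNReal.ofReal (w x t) := by
    have := cylinderNorm_rpow le_rfl hw0 hw
    simpa using this
  rw [cylinderNorm_rpow hm.le hw0 hw, h1]
  have hw' := hw
  rw [restrict_prod_eq] at hw'
  have hswap : AEMeasurable (fun z : ℝ × Sp N => w z.2 z.1)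
      ((volume.restrict (Ioo (t₀ - τ) t₀)).prod (volume.restrict (Metric.ball x₀ R))) :=
    hw'.prod_swap
  have hm1 := (hswap.pow_const m).ennreal_ofReal.lintegral_prod_right'
  have hm2 := hswap.ennreal_ofReal.lintegral_prod_right'
  rw [← lintegral_const_mul'' _ hm1, ← lintegral_const_mul'' _ hm2,
    ← lintegral_mul_const'' _ (hm2.const_mul _), ← lintegral_add_left' (hm1.const_mul _)]
  refine ⟨_, (hm1.const_mul _).add ((hm2.const_mul _).mul_const _), ?_, rfl⟩
  filter_upwards [ae_restrict_of_ae_restrict_of_subset hI (ae_tailSlice_le (σ := σ) (w := w)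
    (x₀ := x₀) (r := r) hm I)] with t ht
  exact add_le_add le_rfl (mul_le_mul_right ht _)

end

end NonlocalDoublePhase

theorem lemma3p1 (N : ℕ) (hN : 0 < N) (s s' p q M : ℝ)
    (hs : s ∈ Ioo (0 : ℝ) 1) (hs' : s' ∈ Ioo (0 : ℝ) 1)
    (hp : 1 < p) (hpq : p ≤ q) (hq : q ≤ p * ((2 * s + N) / N)) :
    ∃ C : ℝ, 0 < C ∧
      ∀ (Ω : Set (Sp N)), IsOpen Ω → Bornology.IsBounded Ω →
      ∀ (T : ℝ≥0∞) (a : Sp N → Sp N → ℝ),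
        Measurable (fun z : Sp N × Sp N => a z.1 z.2) → (∀ x y, 0 ≤ a x y ∧ a x y ≤ M) →
      ∀ (u₀ : Sp N → ℝ) (u : Sp N → ℝ → ℝ),
        IsData s s' p q a Ω u₀ →
        IsVariationalSolution s s' p q a Ω T u₀ u →
        (∃ g : Sp N → ℝ → ℝ, IsWeakTimeDerivL2 Ω T u g) →
        MemLinftyTailSpace (p - 1) (s * p) T u →
        MemLinftyTailSpace (q - 1) (q * s') T u →
      ∀ (x₀ : Sp N) (t₀ r R θ τ₁ τ₂ k : ℝ) (ψ : ℝ → ℝ),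
        Metric.closedBall x₀ R ⊆ Ω → Icc (t₀ - θ) t₀ ⊆ timeInterval T →
        0 < r → r < R →
        t₀ - θ < t₀ - τ₂ → t₀ - τ₂ < t₀ - τ₁ → t₀ - τ₁ ≤ t₀ - θ / 2 →
        ContDiffOn ℝ 1 ψ (Ioo (t₀ - θ) t₀) →
        (∀ t ∈ Ioo (t₀ - θ) (t₀ - τ₂), ψ t = 0) →
        (∀ t ∈ Ioo (t₀ - τ₁) t₀, ψ t = 1) →
        (∀ t ∈ Ioo (t₀ - θ) t₀, 0 ≤ ψ t ∧ ψ t ≤ 1) →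
        (⨆ t ∈ Ioo (t₀ - τ₁) t₀,
            ∫⁻ x in Metric.ball x₀ r, ENNReal.ofReal (truncation u k x t ^ 2)) +
          (∫⁻ t in Ioo (t₀ - τ₁) t₀,
            energy s s' p q a (Metric.ball x₀ r) (fun x => truncation u k x t)) ≤
        ENNReal.ofReal (C * (R ^ (p * (1 - s)) / (R - r) ^ p)) *
            cylinderNorm p (truncation u k) x₀ t₀ R τ₂ ^ p +
          ENNReal.ofReal (C * (R ^ (q * (1 - s')) / (R - r) ^ q)) *
            cylinderNorm q (truncation u k) x₀ t₀ R τ₂ ^ q +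
          ENNReal.ofReal (C * (R / r) ^ (s * p) * (R ^ N / (R - r) ^ ((N : ℝ) + s * p))) *
            cylinderNorm 1 (truncation u k) x₀ t₀ R τ₂ *
            tail p s (truncation u k) x₀ r (Ioo (t₀ - θ) t₀) ^ (p - 1) +
          ENNReal.ofReal (C * (R / r) ^ (s' * q) * (R ^ N / (R - r) ^ ((N : ℝ) + s' * q))) *
            cylinderNorm 1 (truncation u k) x₀ t₀ R τ₂ *
            tail q s' (truncation u k) x₀ r (Ioo (t₀ - θ) t₀) ^ (q - 1) +
          ENNReal.ofReal C *
            ∫⁻ t in Ioo (t₀ - τ₂) t₀, ∫⁻ x in Metric.ball x₀ R,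
              ENNReal.ofReal (truncation u k x t ^ 2 * |deriv ψ t|) := by
  -- the constant is chosen before `a`, hence before `0 ≤ M` is known
  obtain ⟨C, hC, hslice⟩ := exists_energy_sub_cutoff_le hN hs hs' hp hpq (le_max_right M 0)
  refine ⟨3 * C, by linarith, ?_⟩
  rintro Ω hΩo hΩ T a ha haM u₀ u hd hu ⟨g, hg⟩ - - x₀ t₀ r R θ τ₁ τ₂ k ψ hB hT hr hrR hθτ hττ
    hτθ hψ hψ0 hψ1 hψ01
  have hτ₁ : t₀ - τ₁ < t₀ := by linarith
  have ht₀ : t₀ ∈ timeInterval T := hT ⟨by linarith, le_rfl⟩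
  have hα : t₀ - τ₂ ∈ timeInterval T := hT ⟨hθτ.le, by linarith⟩
  obtain ⟨β, η, hαβ, hη, hηψ, hη1⟩ := exists_isTimeCutoff hθτ hττ hτ₁ hT hψ hψ0 hψ1 hψ01
  set w := truncation u k with hw
  set E : ℝ → ℝ≥0∞ := fun t => energy s s' p q a (Metric.ball x₀ r) fun x => w x t with hE
  set S : ℝ → ℝ≥0∞ := fun t => phaseError s p C r R x₀ (fun x => w x t) +
    phaseError s' q C r R x₀ (fun x => w x t) with hS
  set K := ∫⁻ t in Ioo (t₀ - τ₂) t₀, ∫⁻ x in Metric.ball x₀ R,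
    ENNReal.ofReal (w x t ^ 2 * |deriv ψ t|) with hK
  -- the energy inequality up to the time `τ`, with the error up to the time `t₀`
  have hkey : ∀ τ ∈ Ioc (t₀ - τ₁) t₀,
      (∫⁻ t in Ioo (t₀ - τ₁) τ, E t) + ENNReal.ofReal (1 / 2) *
        (∫⁻ x in Metric.ball x₀ r, ENNReal.ofReal (w x τ ^ 2)) ≤
      (∫⁻ t in Ioo (t₀ - τ₂) t₀, S t) + ENNReal.ofReal (1 / 2) * K := fun τ hτ => by
    have h := hu.lintegral_cutoff_energy_add_le (k := k) (x₀ := x₀) (r := r) (R := R) (τ := τ)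
      (Err := fun f => phaseError s p C r R x₀ f + phaseError s' q C r R x₀ f) hN hs hp hpq hΩo hΩ
      ha (fun x y => (haM x y).1) hd hg hrR hB
      (fun c f hc0 hc1 hf => hslice a ha (fun x y => ⟨(haM x y).1, (haM x y).2.trans
        (le_max_left _ _)⟩) x₀ r R k c f hr hrR hc0 hc1 hf) hαβ hη
      (Icc_subset_timeInterval hα ht₀ ⟨by linarith [hτ.1], hτ.2⟩) (hττ.trans hτ.1) hα
    have hsub : Ioo (t₀ - τ₂) τ ⊆ Ioo (t₀ - τ₂) t₀ := Ioo_subset_Ioo_right hτ.2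
    refine le_trans (add_le_add ?_ (le_of_eq ?_)) (h.trans (add_le_add (lintegral_mono_set hsub)
      (mul_le_mul_right ((lintegral_mono_set hsub).trans (le_of_eq ?_)) _)))
    · refine le_trans (le_of_eq ?_) (lintegral_mono_set (Ioo_subset_Ioo_left hττ.le))
      refine setLIntegral_congr_fun measurableSet_Ioo fun t ht => ?_
      simp only [hE]
      rw [hη1 t ⟨ht.1, ht.2.le.trans hτ.2⟩, ENNReal.ofReal_one, one_mul]
    · simp only [hη1 τ hτ, one_mul, hw]
    · refine setLIntegral_congr_fun measurableSet_Ioo fun t ht => ?_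
      have : deriv η t = deriv ψ t :=
        Filter.EventuallyEq.deriv_eq (eventually_of_mem (isOpen_Ioo.mem_nhds ht) hηψ)
      simp only [this, hw]
  set Z := ∫⁻ t in Ioo (t₀ - τ₂) t₀, S t with hZ
  have two_half : ∀ X : ℝ≥0∞, 2 * (ENNReal.ofReal (1 / 2) * X) = X := fun X => by
    rw [← mul_assoc, ← ENNReal.ofReal_ofNat, ← ENNReal.ofReal_mul (by norm_num)]
    norm_num
  -- the supremum is estimated with `τ = t`, the energy with `τ = t₀`
  have hsup : (⨆ t ∈ Ioo (t₀ - τ₁) t₀,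
      ∫⁻ x in Metric.ball x₀ r, ENNReal.ofReal (w x t ^ 2)) ≤ 2 * Z + K := by
    refine iSup₂_le fun t ht => ?_
    have h := mul_le_mul_right (le_add_self.trans (hkey t ⟨ht.1, ht.2.le⟩)) 2
    rwa [two_half, mul_add, two_half] at h
  have hen : (∫⁻ t in Ioo (t₀ - τ₁) t₀, E t) ≤ Z + K := by
    refine (le_self_add.trans (hkey t₀ ⟨hτ₁, le_rfl⟩)).trans (add_le_add le_rfl ?_)
    exact mul_le_of_le_one_left' (by simp)
  have hwm : AEMeasurable (fun z : Sp N × ℝ => w z.1 z.2)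
      (volume.restrict (Metric.ball x₀ R ×ˢ Ioo (t₀ - τ₂) t₀)) := by
    have hum := hu.inClass.memLpSobolev.aemeasurable.mono_set (prod_mono (subset_univ
      (Metric.ball x₀ R)) (Ioo_subset_Icc_self.trans (Icc_subset_timeInterval hα ht₀)))
    exact (hum.sub_const k).max aemeasurable_const
  have hI : Ioo (t₀ - τ₂) t₀ ⊆ Ioo (t₀ - θ) t₀ := Ioo_subset_Ioo_left hθτ.le
  obtain ⟨b₁, hb₁, hle₁, hint₁⟩ := exists_phaseError_le (σ := s) (C := C) (r := r) hp
    (truncation_nonneg u k) hwm hI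
  obtain ⟨b₂, -, hle₂, hint₂⟩ := exists_phaseError_le (σ := s') (C := C) (r := r) (hp.trans_le hpq)
    (truncation_nonneg u k) hwm hI
  have hZle := lintegral_mono_ae (hle₁.and hle₂ |>.mono fun t h => add_le_add h.1 h.2)
  rw [lintegral_add_left' hb₁, hint₁, hint₂] at hZle
  have three : ∀ x : ℝ, ENNReal.ofReal (3 * x) = 3 * ENNReal.ofReal x := fun x => by
    rw [ENNReal.ofReal_mul (by norm_num), ENNReal.ofReal_ofNat]
  have hK2 : 2 * K ≤ ENNReal.ofReal (3 * C) * K := by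
    gcongr
    rw [← ENNReal.ofReal_ofNat]
    exact ENNReal.ofReal_le_ofReal (by linarith)
  calc _ ≤ 2 * Z + K + (Z + K) := add_le_add hsup hen
    _ = 3 * Z + 2 * K := by ring
    _ ≤ _ := add_le_add (mul_le_mul_right hZle 3) hK2
    _ = _ := by
      simp only [mul_assoc (3 : ℝ), three]
      ring
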